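/- Let $q_0>0$, $q_-\in\mathbb C$ with $|q_-|=q_0$, and let $^*$ denote complex conjugation. Put $\vartheta(x,t;k)=\frac12\left(k+\frac{q_0^2}{k}\right)\left[x-\left(k-\frac{q_0^2}{k}\right)t\right]$, $\sigma_3Q_-=\begin{pmatrix}0&q_-\\q_-^*&0\end{pmatrix}$, and $\mathbb D^{\pm}=\{k:\pm\operatorname{Im}(k)(1-q_0^2/|k|^2)>0\}$. A $2\times2$ matrix function $M(k)$ is called *normalized* if $M=\mathbb I+O(1/k)$ as $k\to\infty$ and $M=\frac ik\sigma_3Q_-+O(1)$ as $k\to0$. **$N$-breather.** Let $k_1,\dots,k_N\in\mathbb D^+$ be distinct and $c_1,\dots,c_N\in\mathbb C$. The (reflectionless) breather problem asks, for given $(x,t)\in\mathbb R^2$, for a normalized $M$, analytic off $0$ and the points $k_j,-q_0^2/k_j^*,k_j^*,-q_0^2/k_j$, which has at these points simple poles (removable if the constant vanishes) with $$\operatorname*{Res}_{k=\eta}M=\lim_{k\to\eta}M(k)\begin{pmatrix}0&0\\a_\eta e^{-2i\vartheta(\eta)}&0\end{pmatrix},\quad a_{k_j}=c_j,\quad a_{-q_0^2/k_j^*}=-\frac{q_0^2q_-^*}{k_j^{*2}q_-}c_j^*,$$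 $$\operatorname*{Res}_{k=\eta}M=\lim_{k\to\eta}M(k)\begin{pmatrix}0&b_\eta e^{2i\vartheta(\eta)}\\0&0\end{pmatrix},\quad b_{k_j^*}=-c_j^*,\quad b_{-q_0^2/k_j}=\frac{q_0^2q_-}{k_j^{2}q_-^*}c_j.$$ The $N$-breather solution with discrete eigenvalues $k_j$ and norming constants $c_j$ is the function $q(x,t)=-i\lim_{k\to\infty}(kM(x,t;k))_{12}$. **Breather gas.** Let $n\ge1$, $s_1,s_2\in\mathbb C$, $s_3>0$, $\Omega_1=\{k:|(k-s_1)^n-s_2|<s_3\}$, and let $r_1$ be holomorphic in a neighbourhood of $\overline{\Omega_1}$ (write $r_1^*(\lambda)=\overline{r_1(\lambda)}$). Let $\Gamma_{1+},\Gamma_{2+}$ be counterclockwise and $\Gamma_{1-},\Gamma_{2-}$ clockwise smooth simple closed contours which, with their interiors, lie in $\mathbb D^+$ and $\mathbb D^-$ respectively, and such that $\Gamma_{1+},\Gamma_{2+},\Gamma_{1-},\Gamma_{2-}$ encircle the images of $\overline{\Omega_1}$ under $k\mapsto k$, $-q_0^2/k^*$, $k^*$, $-q_0^2/k$ respectively.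 The gas problem asks, for given $(x,t)\in\mathbb R^2$, for a normalized $M_2$, analytic off $0$ and the four contours, which takes continuous boundary values $M_{2\pm}$ from the left and the right side of the contours with $M_{2+}=M_{2-}V_2$, where $V_2=\begin{pmatrix}1&0\\v&1\end{pmatrix}$ on $\Gamma_{1+}\cup\Gamma_{2+}$, $V_2=\begin{pmatrix}1&v\\0&1\end{pmatrix}$ on $\Gamma_{1-}\cup\Gamma_{2-}$, and, with $\partial\Omega_1$ oriented counterclockwise, $$v(k)=\begin{cases}-\displaystyle\int_{\partial\Omega_1}\frac{(\lambda^*-s_1^*)^nr_1(\lambda)e^{-2i\vartheta(\lambda)}}{2\pi i(k-\lambda)}d\lambda,&k\in\Gamma_{1+},\\[2mm]-\displaystyle\int_{\partial\Omega_1}\frac{q_0^2q_-^*}{\lambda^{*2}q_-}\frac{(\lambda-s_1)^nr_1^*(\lambda)e^{-2i\vartheta(-q_0^2/\lambda^*)}}{2\pi i(k+q_0^2/\lambda^*)}d\lambda^*,&k\in\Gamma_{2+},\\[2mm]\displaystyle\int_{\partial\Omega_1}\frac{(\lambda-s_1)^nr_1^*(\lambda)e^{2i\vartheta(\lambda^*)}}{2\pi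 i(k-\lambda^*)}d\lambda^*,&k\in\Gamma_{1-},\\[2mm]\displaystyle\int_{\partial\Omega_1}\frac{q_0^2q_-}{\lambda^{2}q_-^*}\frac{(\lambda^*-s_1^*)^nr_1(\lambda)e^{2i\vartheta(-q_0^2/\lambda)}}{2\pi i(k+q_0^2/\lambda)}d\lambda,&k\in\Gamma_{2-}.\end{cases}$$ **Proposition 4.** Suppose that $(k-s_1)^n=s_2$ has $n$ distinct roots $\lambda_1,\dots,\lambda_n$, and put $c_j=\dfrac{s_3^2\,r_1(\lambda_j)}{\prod_{k\ne j}(\lambda_j-\lambda_k)}$. Then for all $(x,t)\in\mathbb R^2$ the gas problem has exactly one solution $M_2$, the breather problem with discrete eigenvalues $\lambda_j$ and norming constants $c_j$ has exactly one solution $M$, the two coincide outside the four contours and their interiors, and $-i\lim_{k\to\infty}(kM_2(x,t;k))_{12}=q_n(x,t)$ is the $n$-breather solution with discrete eigenvalues $\lambda_j$ and norming constants $c_j$. -/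

import Mathlib

open Complex Filter Topology Set MeasureTheory
open scoped ComplexConjugate

noncomputable section

namespace BreatherGas

/-- Complex `2 × 2` matrices. -/
abbrev Mat := Matrix (Fin 2) (Fin 2) ℂ

/-! ### The background -/

/-- The phase `ϑ(x,t;k) = ½ (k + q₀²/k) [x - (k - q₀²/k) t]`. -/
def phase (q₀ x t : ℝ) (k : ℂ) : ℂ :=
  (1 / 2) * (k + (q₀ : ℂ) ^ 2 / k) * ((x : ℂ) - (k - (q₀ : ℂ) ^ 2 / k) * (t : ℂ))

/-- The region `𝔻⁺ = {k | Im k · (1 - q₀²/|k|²) > 0}`. -/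
def regionPlus (q₀ : ℝ) : Set ℂ := {k | 0 < k.im * (1 - q₀ ^ 2 / ‖k‖ ^ 2)}

/-- The region `𝔻⁻ = {k | Im k · (1 - q₀²/|k|²) < 0}`. -/
def regionMinus (q₀ : ℝ) : Set ℂ := {k | k.im * (1 - q₀ ^ 2 / ‖k‖ ^ 2) < 0}

/-- The Pauli matrix `σ₃`. -/
def sigma3 : Mat := !![1, 0; 0, -1]

/-- The boundary value `Q₋` of the potential matrix. -/
def Qminus (qm : ℂ) : Mat := !![0, qm; -conj qm, 0]

/-- The normalization `M = I + O(1/k)` as `k → ∞` and `M = (i/k) σ₃ Q₋ + O(1)` as `k → 0`. -/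
structure IsNormalized (qm : ℂ) (M : ℂ → Mat) : Prop where
  at_infty : ∀ i j, (fun k => M k i j - (1 : Mat) i j) =O[Bornology.cobounded ℂ] fun k => k⁻¹
  at_zero : ∀ i j,
    (fun k => M k i j - (I / k) * (sigma3 * Qminus qm) i j) =O[𝓝[≠] 0] fun _ => (1 : ℂ)

/-- `q` is recovered from `M`: `q = -i lim_{k → ∞} (k M(k))₁₂`. -/
def Recovers (M : ℂ → Mat) (q : ℂ) : Prop :=
  Tendsto (fun k => -I * (k * M k 0 1)) (Bornology.cobounded ℂ) (𝓝 q)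

/-! ### `N`-breather solutions -/

/-- `M` has at `η` an (at most) simple pole, with `Res_{k=η} M = lim_{k → η} M(k) N`; the pole is a
genuine one as soon as `N ≠ 0`. -/
def HasResidueCondition (M : ℂ → Mat) (η : ℂ) (N : Mat) : Prop :=
  ∃ R : Mat, Tendsto (fun k => (k - η) • M k) (𝓝[≠] η) (𝓝 R) ∧
    Tendsto (fun k => M k * N) (𝓝[≠] η) (𝓝 R) ∧ (N ≠ 0 → R ≠ 0)

/-- The discrete spectrum `{k_j, -q₀²/k_j^*, k_j^*, -q₀²/k_j}`. -/
def discreteSpectrum {N : ℕ} (q₀ : ℝ) (z : Fin N → ℂ) : Set ℂ :=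
  {k | ∃ j, k = z j ∨ k = -(q₀ : ℂ) ^ 2 / conj (z j) ∨ k = conj (z j) ∨ k = -(q₀ : ℂ) ^ 2 / z j}

/-- The reflectionless Riemann-Hilbert problem of the focusing NLS equation with nonzero background
for the discrete eigenvalues `z j` and the norming constants `c j`. As the reflection coefficient
vanishes, there is no jump on the continuous spectrum, so `M` is analytic off the discrete
spectrum and the origin. -/
structure IsBreatherRHP {N : ℕ} (q₀ : ℝ) (qm : ℂ) (z c : Fin N → ℂ) (x t : ℝ)
    (M : ℂ → Mat) : Prop where
  analytic : ∀ i j, DifferentiableOn ℂ (fun k => M k i j) ({0} ∪ discreteSpectrum q₀ z)ᶜ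
  normalized : IsNormalized qm M
  residue₁ : ∀ j, HasResidueCondition M (z j)
    !![0, 0; c j * exp (-2 * I * phase q₀ x t (z j)), 0]
  residue₂ : ∀ j, HasResidueCondition M (-(q₀ : ℂ) ^ 2 / conj (z j))
    !![0, 0; -((q₀ : ℂ) ^ 2 * conj qm / (conj (z j) ^ 2 * qm)) * conj (c j) *
      exp (-2 * I * phase q₀ x t (-(q₀ : ℂ) ^ 2 / conj (z j))), 0]
  residue₃ : ∀ j, HasResidueCondition M (conj (z j))
    !![0, -conj (c j) * exp (2 * I * phase q₀ x t (conj (z j))); 0, 0]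
  residue₄ : ∀ j, HasResidueCondition M (-(q₀ : ℂ) ^ 2 / z j)
    !![0, ((q₀ : ℂ) ^ 2 * qm / (z j ^ 2 * conj qm)) * c j *
      exp (2 * I * phase q₀ x t (-(q₀ : ℂ) ^ 2 / z j)); 0, 0]

/-- `q` is the `N`-breather solution with the discrete eigenvalues `z j ∈ 𝔻⁺` and the norming
constants `c j`: for all `(x,t)` the reflectionless Riemann-Hilbert problem has exactly one
solution, and `q(x,t)` is recovered from it. -/
def IsBreatherSolution {N : ℕ} (q₀ : ℝ) (qm : ℂ) (z c : Fin N → ℂ) (q : ℝ → ℝ → ℂ) : Prop :=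
  Function.Injective z ∧ (∀ j, z j ∈ regionPlus q₀) ∧
  ∀ x t : ℝ, ∃ M : ℂ → Mat, IsBreatherRHP q₀ qm z c x t M ∧
    (∀ M' : ℂ → Mat, IsBreatherRHP q₀ qm z c x t M' →
      EqOn M' M ({0} ∪ discreteSpectrum q₀ z)ᶜ) ∧
    Recovers M (q x t)

/-! ### The quadrature domain and integrals along its boundary -/

/-- The quadrature domain `{k | |(k - s₁)^m - s₂| < s₃}`. -/
def quadratureDomain (m : ℕ) (s₁ s₂ : ℂ) (s₃ : ℝ) : Set ℂ := {k | ‖(k - s₁) ^ m - s₂‖ < s₃}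

/-- The `j`-th branch (`j < m`) of the parametrization of the boundary of the quadrature domain that
solves `(γ(θ) - s₁)^m = s₂ + s₃ e^{iθ}`. For `θ ∈ (0, 2π]` the `m` branches together run through the
boundary exactly once, counterclockwise, apart from the crossing point `s₁` of the singular
lemniscate `s₃ = |s₂|` (each is continuously differentiable except for at most two values
of `θ`). -/
def boundaryBranch (m : ℕ) (s₁ s₂ : ℂ) (s₃ : ℝ) (j : ℕ) (θ : ℝ) : ℂ :=
  s₁ + exp (2 * Real.pi * I * (j / m)) * (s₂ + s₃ * exp (θ * I)) ^ ((1 : ℂ) / m)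

theorem boundaryBranch_sub_pow {m : ℕ} (hm : m ≠ 0) (s₁ s₂ : ℂ) (s₃ : ℝ) (j : ℕ) (θ : ℝ) :
    (boundaryBranch m s₁ s₂ s₃ j θ - s₁) ^ m = s₂ + s₃ * exp (θ * I) := by
  have hm' : (m : ℂ) ≠ 0 := by exact_mod_cast hm
  rw [boundaryBranch, add_sub_cancel_left, mul_pow, ← Complex.exp_nat_mul, one_div,
    Complex.cpow_nat_inv_pow _ hm,
    show (m : ℂ) * (2 * Real.pi * I * (j / m)) = j * (2 * Real.pi * I) by field_simp,
    Complex.exp_nat_mul_two_pi_mul_I, one_mul]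

/-- The contour integral `∫_{∂Ω} f(λ) dλ` along the counterclockwise boundary. -/
def boundaryIntegral (m : ℕ) (s₁ s₂ : ℂ) (s₃ : ℝ) (f : ℂ → ℂ) : ℂ :=
  ∫ θ in (0 : ℝ)..2 * Real.pi, ∑ j ∈ Finset.range m,
    f (boundaryBranch m s₁ s₂ s₃ j θ) * deriv (boundaryBranch m s₁ s₂ s₃ j) θ

/-- The contour integral `∫_{∂Ω} f(λ) dλ^*` along the counterclockwise boundary. -/
def boundaryIntegralConj (m : ℕ) (s₁ s₂ : ℂ) (s₃ : ℝ) (f : ℂ → ℂ) : ℂ :=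
  ∫ θ in (0 : ℝ)..2 * Real.pi, ∑ j ∈ Finset.range m,
    f (boundaryBranch m s₁ s₂ s₃ j θ) * conj (deriv (boundaryBranch m s₁ s₂ s₃ j) θ)

/-! ### The Riemann-Hilbert problem of the breather gas -/

/-- `D` is the interior of a smooth closed contour `Γ = frontier D`: a bounded domain with connected
exterior which near each of its boundary points is the sublevel set of a `C¹` function with nonzero
derivative. -/
structure IsContourInterior (D : Set ℂ) : Prop where
  isOpen : IsOpen D
  isConnected : IsConnected D
  isBounded : Bornology.IsBounded D
  isConnected_exterior : IsConnected (closure D)ᶜ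
  smooth : ∀ ζ ∈ frontier D, ∃ ρ : ℂ → ℝ, ContDiffAt ℝ 1 ρ ζ ∧ fderiv ℝ ρ ζ ≠ 0 ∧
    ∀ᶠ k in 𝓝 ζ, (k ∈ D ↔ ρ k < 0)

/-- `M` takes continuous boundary values `M₊` from the left side `L` and `M₋` from the right side
`R` of the oriented contour `Γ`, and `M₊ = M₋ V` there. -/
def HasJump (M : ℂ → Mat) (Γ L R : Set ℂ) (V : ℂ → Mat) : Prop :=
  ∃ Mp Mm : ℂ → Mat, ContinuousOn Mp Γ ∧ ContinuousOn Mm Γ ∧ ∀ ζ ∈ Γ,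
    Tendsto M (𝓝[L] ζ) (𝓝 (Mp ζ)) ∧ Tendsto M (𝓝[R] ζ) (𝓝 (Mm ζ)) ∧ Mp ζ = Mm ζ * V ζ

/-- The jump across a counterclockwise contour with interior `D`. -/
def HasJumpCCW (M : ℂ → Mat) (D : Set ℂ) (V : ℂ → Mat) : Prop :=
  HasJump M (frontier D) D (closure D)ᶜ V

/-- The jump across a clockwise contour with interior `D`. -/
def HasJumpCW (M : ℂ → Mat) (D : Set ℂ) (V : ℂ → Mat) : Prop :=
  HasJump M (frontier D) (closure D)ᶜ D V

/-- The jump matrix on `Γ₁₊`. -/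
def jump₁p (q₀ : ℝ) (n m : ℕ) (s₁ s₂ : ℂ) (s₃ : ℝ) (r₁ : ℂ → ℂ) (x t : ℝ) (k : ℂ) : Mat :=
  !![1, 0;
    -boundaryIntegral m s₁ s₂ s₃ (fun l =>
      (conj l - conj s₁) ^ n * r₁ l * exp (-2 * I * phase q₀ x t l) /
        (2 * Real.pi * I * (k - l))), 1]

/-- The jump matrix on `Γ₂₊`. -/
def jump₂p (q₀ : ℝ) (qm : ℂ) (n m : ℕ) (s₁ s₂ : ℂ) (s₃ : ℝ) (r₁ : ℂ → ℂ) (x t : ℝ) (k : ℂ) :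
    Mat :=
  !![1, 0;
    -boundaryIntegralConj m s₁ s₂ s₃ (fun l =>
      ((q₀ : ℂ) ^ 2 * conj qm / (conj l ^ 2 * qm)) * (l - s₁) ^ n * conj (r₁ l) *
        exp (-2 * I * phase q₀ x t (-(q₀ : ℂ) ^ 2 / conj l)) /
        (2 * Real.pi * I * (k + (q₀ : ℂ) ^ 2 / conj l))), 1]

/-- The jump matrix on `Γ₁₋`. -/
def jump₁m (q₀ : ℝ) (n m : ℕ) (s₁ s₂ : ℂ) (s₃ : ℝ) (r₁ : ℂ → ℂ) (x t : ℝ) (k : ℂ) : Mat :=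
  !![1, boundaryIntegralConj m s₁ s₂ s₃ (fun l =>
      (l - s₁) ^ n * conj (r₁ l) * exp (2 * I * phase q₀ x t (conj l)) /
        (2 * Real.pi * I * (k - conj l)));
    0, 1]

/-- The jump matrix on `Γ₂₋`. -/
def jump₂m (q₀ : ℝ) (qm : ℂ) (n m : ℕ) (s₁ s₂ : ℂ) (s₃ : ℝ) (r₁ : ℂ → ℂ) (x t : ℝ) (k : ℂ) :
    Mat :=
  !![1, boundaryIntegral m s₁ s₂ s₃ (fun l =>
      ((q₀ : ℂ) ^ 2 * qm / (l ^ 2 * conj qm)) * (conj l - conj s₁) ^ n * r₁ l *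
        exp (2 * I * phase q₀ x t (-(q₀ : ℂ) ^ 2 / l)) /
        (2 * Real.pi * I * (k + (q₀ : ℂ) ^ 2 / l)));
    0, 1]

/-- The union of the four contours. -/
def contours (D₁p D₂p D₁m D₂m : Set ℂ) : Set ℂ :=
  frontier D₁p ∪ frontier D₂p ∪ frontier D₁m ∪ frontier D₂m

/-- The Riemann-Hilbert problem of the breather gas whose spectrum fills the quadrature domain
`Ω₁ = {k | |(k - s₁)^m - s₂| < s₃}` with weight `n (k^* - s₁^*)^(n-1) r₁(k)`. The sets `D₁p`, `D₂p`
are the interiors of the counterclockwise contours `Γ₁₊`, `Γ₂₊`, and `D₁m`, `D₂m` are those of the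
clockwise contours `Γ₁₋`, `Γ₂₋`. -/
structure IsGasRHP (q₀ : ℝ) (qm : ℂ) (n m : ℕ) (s₁ s₂ : ℂ) (s₃ : ℝ) (r₁ : ℂ → ℂ)
    (D₁p D₂p D₁m D₂m : Set ℂ) (x t : ℝ) (M : ℂ → Mat) : Prop where
  analytic : ∀ i j, DifferentiableOn ℂ (fun k => M k i j) ({0} ∪ contours D₁p D₂p D₁m D₂m)ᶜ
  normalized : IsNormalized qm M
  jump_one_plus : HasJumpCCW M D₁p (jump₁p q₀ n m s₁ s₂ s₃ r₁ x t)
  jump_two_plus : HasJumpCCW M D₂p (jump₂p q₀ qm n m s₁ s₂ s₃ r₁ x t)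
  jump_one_minus : HasJumpCW M D₁m (jump₁m q₀ n m s₁ s₂ s₃ r₁ x t)
  jump_two_minus : HasJumpCW M D₂m (jump₂m q₀ qm n m s₁ s₂ s₃ r₁ x t)

end BreatherGas

end

noncomputable section
namespace BreatherGas

/-! On `∂Ω₁` put `w = (λ - s₁)^n`. Since `w` lies on the circle `|w - s₂| = s₃`, the conjugate
weight equals `w* = s₂* + s₃² / (w - s₂)` there, which is meromorphic in `λ` with simple poles at
the `n` roots `λ_j`. Pushing the integrals forward to the `w`-plane and applying Cauchy's formula on
a disc turns each Cauchy-type integral in the jumps into a sum of residues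
(`boundaryIntegral_conj_pow_mul`). As `n (λ_j - s₁)^(n-1) = ∏ (λ_j - λ_k)`, the constants `c_j`
appear, and the off-diagonal entries of all four jumps are rational functions with poles at the
discrete spectrum (`isGasRHP_iff`).

The jumps now have the form `1 ± v U` with `U² = 0` and with the poles of the rational function `v`
inside the contour. Multiplying a gas solution by `1 + v U` inside each contour removes the jump; by
Painlevé's theorem the product is holomorphic across the contour, and the poles of `v` become simple
poles with exactly the breather residue relations (`IsContourRHP.exists_dressed`). Multiplication by
`1 - v U` leads back (`IsContourSystem.exists_isContourRHP`). Nothing changes outside the contours,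
so the two problems are equivalent and recover the same `q`.

The pole problem is linear algebra. By Liouville's theorem (`eq_partialFraction`) a solution is a
partial fraction, and its residues solve a square linear system for each row (`IsRow`). Unique
solvability follows from a vanishing lemma: for a row `(f, g)` the residues of `f(k) f(k*)* + g(k)
g(k*)*` cancel at every discrete point (`IsRow.norm_sq_eq`). For homogeneous data this function is
zero, and on the real axis it is `|f|² + |g|²`. The second row comes from the first by conjugation
symmetry (`IsRow.conj_swap`).

The same identity shows that the poles are genuine (`IsRow.ne_zero`): a degenerate one would be a
nonreal root of `z² - x z + q₀²` with `x` real, hence on the circle `|z| = q₀`, which `𝔻⁺` omits. -/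

/-! ### Painlevé's theorem: removability of contours -/

/-- The integral of `f` along the boundary of the rectangle `[a, b] × [c, d]`. -/
def rectIntegral (f : ℂ → ℂ) (a b c d : ℝ) : ℂ :=
  (∫ x in a..b, f (x + c * I)) - (∫ x in a..b, f (x + d * I)) +
    I • (∫ y in c..d, f (b + y * I)) - I • (∫ y in c..d, f (a + y * I))

section
variable {f : ℂ → ℂ}

theorem intervalIntegrable_horizontal (hf : Continuous f) (a b y : ℝ) :
    IntervalIntegrable (fun x : ℝ => f (x + y * I)) volume a b :=
  (by fun_prop : Continuous fun x : ℝ => f (x + y * I)).intervalIntegrable _ _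

theorem intervalIntegrable_vertical (hf : Continuous f) (a b x : ℝ) :
    IntervalIntegrable (fun y : ℝ => f (x + y * I)) volume a b :=
  (by fun_prop : Continuous fun y : ℝ => f (x + y * I)).intervalIntegrable _ _

theorem rectIntegral_add_horizontal (hf : Continuous f) (a b e c d : ℝ) :
    rectIntegral f a b c d + rectIntegral f b e c d = rectIntegral f a e c d := by
  simp only [rectIntegral]
  rw [← intervalIntegral.integral_add_adjacent_intervals
      (intervalIntegrable_horizontal hf a b c) (intervalIntegrable_horizontal hf b e c),
    ← intervalIntegral.integral_add_adjacent_intervals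
      (intervalIntegrable_horizontal hf a b d) (intervalIntegrable_horizontal hf b e d)]
  ring

theorem rectIntegral_add_vertical (hf : Continuous f) (a b c d e : ℝ) :
    rectIntegral f a b c d + rectIntegral f a b d e = rectIntegral f a b c e := by
  simp only [rectIntegral]
  rw [← intervalIntegral.integral_add_adjacent_intervals
      (intervalIntegrable_vertical hf c d a) (intervalIntegrable_vertical hf d e a),
    ← intervalIntegral.integral_add_adjacent_intervals
      (intervalIntegrable_vertical hf c d b) (intervalIntegrable_vertical hf d e b)]
  simp only [smul_eq_mul]
  ring

theorem rectIntegral_eq_zero_of_differentiableAt (hf : Continuous f) {a b c d : ℝ}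
    (hab : a ≤ b) (hcd : c ≤ d)
    (hd : ∀ x y : ℝ, a < x → x < b → c < y → y < d → DifferentiableAt ℂ f (x + y * I)) :
    rectIntegral f a b c d = 0 := by
  have := integral_boundary_rect_eq_zero_of_differentiable_on_off_countable f
    ⟨a, c⟩ ⟨b, d⟩ ∅ countable_empty hf.continuousOn (by
      rintro z ⟨hz, -⟩
      simp only [min_eq_left hab, max_eq_right hab, min_eq_left hcd, max_eq_right hcd] at hz
      have := hd z.re z.im hz.1.1 hz.1.2 hz.2.1 hz.2.2
      rwa [re_add_im] at this)
  simpa [rectIntegral] using this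

/-- Opposite sides are subtracted before estimating, so the comparison value `w` cancels and only
the oscillation of `f` counts. -/
theorem norm_rectIntegral_le (hf : Continuous f) {a b c d ε : ℝ} (hab : a ≤ b) (hcd : c ≤ d) (w : ℂ)
    (h : ∀ x ∈ Icc a b, ∀ y ∈ Icc c d, ‖f (x + y * I) - w‖ ≤ ε) :
    ‖rectIntegral f a b c d‖ ≤ 2 * ε * ((b - a) + (d - c)) := by
  have hle : ∀ z₁ z₂ : ℂ, ‖f z₁ - w‖ ≤ ε → ‖f z₂ - w‖ ≤ ε → ‖f z₁ - f z₂‖ ≤ 2 * ε := by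
    intro z₁ z₂ h₁ h₂
    calc ‖f z₁ - f z₂‖ = ‖(f z₁ - w) - (f z₂ - w)‖ := by congr 1; ring
      _ ≤ _ := norm_sub_le _ _
      _ ≤ 2 * ε := by linarith
  have h1 : ‖∫ x in a..b, (f (x + c * I) - f (x + d * I))‖ ≤ 2 * ε * |b - a| := by
    refine intervalIntegral.norm_integral_le_of_norm_le_const fun x hx => ?_
    rw [uIoc_of_le hab] at hx
    exact hle _ _ (h x ⟨hx.1.le, hx.2⟩ c ⟨le_rfl, hcd⟩) (h x ⟨hx.1.le, hx.2⟩ d ⟨hcd, le_rfl⟩)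
  have h2 : ‖∫ y in c..d, (f (b + y * I) - f (a + y * I))‖ ≤ 2 * ε * |d - c| := by
    refine intervalIntegral.norm_integral_le_of_norm_le_const fun y hy => ?_
    rw [uIoc_of_le hcd] at hy
    exact hle _ _ (h b ⟨hab, le_rfl⟩ y ⟨hy.1.le, hy.2⟩) (h a ⟨le_rfl, hab⟩ y ⟨hy.1.le, hy.2⟩)
  rw [abs_of_nonneg (sub_nonneg.2 hab)] at h1
  rw [abs_of_nonneg (sub_nonneg.2 hcd)] at h2
  have : rectIntegral f a b c d = (∫ x in a..b, (f (x + c * I) - f (x + d * I))) +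
      I * ∫ y in c..d, (f (b + y * I) - f (a + y * I)) := by
    rw [intervalIntegral.integral_sub (intervalIntegrable_horizontal hf a b c)
      (intervalIntegrable_horizontal hf a b d), intervalIntegral.integral_sub
      (intervalIntegrable_vertical hf c d b) (intervalIntegrable_vertical hf c d a)]
    simp only [rectIntegral, smul_eq_mul]
    ring
  rw [this]
  refine (norm_add_le _ _).trans ?_
  rw [norm_mul, norm_I, one_mul]
  linarith

/-- **Cauchy's theorem** for a function that is holomorphic off a Lipschitz graph. -/
theorem rectIntegral_eq_zero_of_lipschitz_graph (hf : Continuous f) {φ : ℝ → ℝ} {K : ℝ} (hK : 0 ≤ K)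
    (hφ : ∀ u v, |φ u - φ v| ≤ K * |u - v|) {a b c d : ℝ} (hab : a ≤ b) (hcd : c ≤ d)
    (hd : ∀ x y : ℝ, a < x → x < b → c < y → y < d → y ≠ φ x →
      DifferentiableAt ℂ f (x + y * I)) :
    rectIntegral f a b c d = 0 := by
  have hcont : Continuous fun x => rectIntegral f a x c d := by
    have h1 : ∀ y : ℝ, Continuous fun x => ∫ u in a..x, f (u + y * I) := fun y =>
      intervalIntegral.continuous_primitive (fun a b => intervalIntegrable_horizontal hf a b y) a
    have h2 : Continuous fun x : ℝ => ∫ y in c..d, f (x + y * I) :=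
      intervalIntegral.continuous_parametric_intervalIntegral_of_continuous' (by fun_prop) c d
    simp only [rectIntegral]
    exact (((h1 c).sub (h1 d)).add (h2.const_smul I)).sub continuous_const
  -- Moving the right edge by `Δ` adds a thin strip. Only a window of height `O(Δ)` around the graph
  -- contributes to its integral, and there `f` is almost constant, so the increment is `o(Δ)`.
  have hder : ∀ x ∈ Ico a b,
      HasDerivWithinAt (fun x => rectIntegral f a x c d) 0 (Ici x) x := by
    intro x hx
    rw [hasDerivWithinAt_iff_isLittleO, Asymptotics.isLittleO_iff]
    intro ε hε
    -- The graph may pass above or below the rectangle, so its height is clamped to `[c, d]`.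
    set s : ℝ := max c (min d (φ x)) with hs
    have hcs : c ≤ s := le_max_left _ _
    have hsd : s ≤ d := max_le hcd (min_le_left _ _)
    have hs1 : c < s → s ≤ φ x := fun h => by
      rcases le_max_iff.1 hs.le with h' | h'
      · exact absurd h (not_lt.2 h')
      · exact h'.trans (min_le_right _ _)
    have hs2 : s < d → φ x ≤ s := fun h => by
      have := (le_max_right c (min d (φ x))).trans hs.ge
      rcases min_le_iff.1 this with h' | h'
      · exact absurd h (not_lt.2 h')
      · exact h'
    -- Chosen so that the perimeter bound `2 ε' (Δ + 2 K Δ)` is exactly `ε Δ`.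
    set ε' : ℝ := ε / (2 * (1 + 2 * K)) with hε'
    have hε'0 : 0 < ε' := by positivity
    obtain ⟨δ, hδ, hδf⟩ := Metric.continuousAt_iff.1 (hf.continuousAt (x := x + s * I)) ε' hε'0
    have hev : ∀ᶠ x' in 𝓝[Ici x] x, x' < b ∧ x' - x < δ / (1 + K) := by
      refine nhdsWithin_le_nhds ?_
      refine (eventually_lt_nhds hx.2).and ?_
      have : Tendsto (fun x' => x' - x) (𝓝 x) (𝓝 (x - x)) := tendsto_id.sub_const x
      rw [sub_self] at this
      exact this.eventually_lt_const (by positivity)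
    filter_upwards [hev, self_mem_nhdsWithin] with x' hx' hxx'
    replace hxx' : x ≤ x' := hxx'
    simp only [smul_zero, sub_zero]
    rw [← rectIntegral_add_horizontal hf a x x', add_sub_cancel_left]
    set Δ : ℝ := x' - x with hΔ
    have hΔ0 : 0 ≤ Δ := sub_nonneg.2 hxx'
    set y₁ : ℝ := max c (s - K * Δ) with hy₁
    set y₂ : ℝ := min d (s + K * Δ) with hy₂
    have hKΔ : 0 ≤ K * Δ := by positivity
    have h1 : c ≤ y₁ := le_max_left _ _
    have h2 : y₁ ≤ s := max_le hcs (by linarith)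
    have h3 : s ≤ y₂ := le_min hsd (by linarith)
    have h4 : y₂ ≤ d := min_le_left _ _
    have hφx : ∀ u, x < u → u < x' → |φ u - φ x| ≤ K * Δ := fun u hu hu' =>
      (hφ u x).trans (mul_le_mul_of_nonneg_left (by rw [abs_of_pos (by linarith)]; linarith) hK)
    have hz1 : rectIntegral f x x' c y₁ = 0 := by
      refine rectIntegral_eq_zero_of_differentiableAt hf hxx' h1 fun u v hu hu' hv hv' => ?_
      refine hd u v (by linarith [hx.1]) (by linarith [hx'.1]) hv (by linarith) ?_
      -- A point with `c < v < y₁` exists only if the maximum is not `c`; then `s ≤ φ x`, and the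
      -- graph stays above `y₁`.
      have hy : y₁ = s - K * Δ := by
        rcases max_choice c (s - K * Δ) with h | h
        · rw [hy₁, h] at hv'; linarith
        · exact h
      have := abs_le.1 (hφx u hu hu')
      have := hs1 (by linarith)
      linarith
    have hz2 : rectIntegral f x x' y₂ d = 0 := by
      refine rectIntegral_eq_zero_of_differentiableAt hf hxx' h4 fun u v hu hu' hv hv' => ?_
      refine hd u v (by linarith [hx.1]) (by linarith [hx'.1]) (by linarith) hv' ?_
      have hy : y₂ = s + K * Δ := by
        rcases min_choice d (s + K * Δ) with h | h
        · rw [hy₂, h] at hv; linarith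
        · exact h
      have := abs_le.1 (hφx u hu hu')
      have := hs2 (by linarith)
      linarith
    rw [← rectIntegral_add_vertical hf x x' c y₁ d, hz1, zero_add,
      ← rectIntegral_add_vertical hf x x' y₁ y₂ d, hz2, add_zero]
    have hy12 : y₂ - y₁ ≤ 2 * K * Δ := by
      have := le_max_right c (s - K * Δ)
      have := min_le_right d (s + K * Δ)
      linarith
    have hn := norm_rectIntegral_le hf (ε := ε') hxx' (h2.trans h3) (f (x + s * I)) (by
      intro u hu v hv
      rw [← dist_eq_norm]
      refine (hδf ?_).le
      rw [dist_eq_norm, show (u + v * I : ℂ) - (x + s * I) =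
        ((u - x : ℝ) : ℂ) + ((v - s : ℝ) : ℂ) * I
        by push_cast; ring]
      refine (norm_add_le _ _).trans_lt ?_
      rw [norm_mul, norm_I, mul_one, norm_real, norm_real, Real.norm_eq_abs, Real.norm_eq_abs]
      have e1 : |u - x| ≤ Δ := by rw [abs_of_nonneg (by linarith [hu.1])]; linarith [hu.2]
      have e2 : |v - s| ≤ K * Δ := by
        have := le_max_right c (s - K * Δ)
        have := min_le_right d (s + K * Δ)
        rw [abs_le]
        constructor <;> linarith [hv.1, hv.2]
      have := hx'.2
      rw [lt_div_iff₀ (by positivity)] at this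
      linarith)
    refine hn.trans ?_
    rw [Real.norm_eq_abs, abs_of_nonneg hΔ0]
    calc 2 * ε' * (x' - x + (y₂ - y₁)) ≤ 2 * ε' * (Δ + 2 * K * Δ) := by gcongr
      _ = ε * Δ := by rw [hε']; field_simp
  have := constant_of_has_deriv_right_zero hcont.continuousOn hder b ⟨hab, le_rfl⟩
  rw [show rectIntegral f a b c d = rectIntegral f a a c d from this]
  simp [rectIntegral]
end

/-- This is the hypothesis of Morera's theorem. The corners of a rectangle may come in any order;
swapping them only changes the sign of the integral. -/
theorem isConservativeOn_of_lipschitz_graph {f : ℂ → ℂ} {U : Set ℂ} (hf : ContinuousOn f U)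
    {φ : ℝ → ℝ} {K : ℝ} (hK : 0 ≤ K) (hφ : ∀ u v, |φ u - φ v| ≤ K * |u - v|)
    (hd : ∀ z ∈ U, z.im ≠ φ z.re → DifferentiableAt ℂ f z) : IsConservativeOn f U := by
  intro z w hzw
  rw [← add_eq_zero_iff_eq_neg, wedgeIntegral_add_wedgeIntegral_eq]
  suffices H : ∀ a b c d : ℝ, a ≤ b → c ≤ d → (Icc a b ×ℂ Icc c d ⊆ U) →
      rectIntegral f a b c d = 0 by
    rw [Rectangle] at hzw
    change rectIntegral f z.re w.re z.im w.im = 0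
    rcases le_total z.re w.re with h | h <;> rcases le_total z.im w.im with h' | h' <;>
      simp only [uIcc_of_le h, uIcc_of_le h', uIcc_of_ge h, uIcc_of_ge h'] at hzw <;>
      have := H _ _ _ _ h h' hzw
    · exact this
    · rw [← neg_eq_zero, ← this]
      simp only [rectIntegral, intervalIntegral.integral_symm z.im w.im, smul_eq_mul]
      ring
    · rw [← neg_eq_zero, ← this]
      simp only [rectIntegral, intervalIntegral.integral_symm z.re w.re, smul_eq_mul]
      ring
    · rw [← this]
      simp only [rectIntegral, intervalIntegral.integral_symm z.re w.re,
        intervalIntegral.integral_symm z.im w.im, smul_eq_mul]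
      ring
  intro a b c d hab hcd hU
  -- The retraction onto the rectangle makes `f ∘ p` continuous on the whole plane without changing
  -- `f` on the rectangle.
  set p : ℂ → ℂ := fun z => (projIcc a b hab z.re : ℝ) + (projIcc c d hcd z.im : ℝ) * I with hp
  have hpc : Continuous p := by
    have h1 : Continuous fun z : ℂ => (projIcc a b hab z.re : ℝ) :=
      continuous_subtype_val.comp (continuous_projIcc.comp continuous_re)
    have h2 : Continuous fun z : ℂ => (projIcc c d hcd z.im : ℝ) :=
      continuous_subtype_val.comp (continuous_projIcc.comp continuous_im)
    simp only [hp]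
    exact (continuous_ofReal.comp h1).add ((continuous_ofReal.comp h2).mul continuous_const)
  have hpU : ∀ z, p z ∈ U := fun z => hU (by
    rw [mem_reProdIm]
    simp only [hp]
    constructor
    · simp
    · simp)
  have hpe : ∀ x ∈ Icc a b, ∀ y ∈ Icc c d, p (x + y * I) = x + y * I := by
    intro x hx y hy
    simp only [hp]
    have e1 : ((x : ℂ) + y * I).re = x := by simp
    have e2 : ((x : ℂ) + y * I).im = y := by simp
    rw [e1, e2, projIcc_of_mem hab hx, projIcc_of_mem hcd hy]
  have hfp : Continuous (f ∘ p) := hf.comp_continuous hpc hpU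
  have hz := rectIntegral_eq_zero_of_lipschitz_graph hfp hK hφ hab hcd (by
    intro x y hx hx' hy hy' hne
    have hm : (x + y * I : ℂ) ∈ U := hU (by
      rw [mem_reProdIm]; simp [hx.le, hx'.le, hy.le, hy'.le])
    refine (hd _ hm (by simpa using hne)).congr_of_eventuallyEq ?_
    have hn : Ioo a b ×ℂ Ioo c d ∈ 𝓝 (x + y * I : ℂ) :=
      (isOpen_Ioo.reProdIm isOpen_Ioo).mem_nhds (by rw [mem_reProdIm]; simp [hx, hx', hy, hy'])
    filter_upwards [hn] with w hw
    rw [mem_reProdIm] at hw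
    have := hpe w.re ⟨hw.1.1.le, hw.1.2.le⟩ w.im ⟨hw.2.1.le, hw.2.2.le⟩
    rw [re_add_im] at this
    simp [this])
  rw [← hz]
  have hh : ∀ y ∈ Icc c d, ∫ x in a..b, f (x + y * I) = ∫ x in a..b, (f ∘ p) (x + y * I) := by
    intro y hy
    refine intervalIntegral.integral_congr fun x hx => ?_
    rw [uIcc_of_le hab] at hx
    simp [hpe x hx y hy]
  have hv : ∀ x ∈ Icc a b, ∫ y in c..d, f (x + y * I) = ∫ y in c..d, (f ∘ p) (x + y * I) := by
    intro x hx
    refine intervalIntegral.integral_congr fun y hy => ?_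
    rw [uIcc_of_le hcd] at hy
    simp [hpe x hx y hy]
  rw [rectIntegral, rectIntegral, hh c ⟨le_rfl, hcd⟩, hh d ⟨hcd, le_rfl⟩, hv a ⟨le_rfl, hab⟩,
    hv b ⟨hab, le_rfl⟩]

/-- A continuous function on a disc that is holomorphic off a Lipschitz graph is holomorphic. -/
theorem differentiableOn_ball_of_lipschitz_graph {f : ℂ → ℂ} {z₀ : ℂ} {r : ℝ}
    (hf : ContinuousOn f (Metric.ball z₀ r)) {φ : ℝ → ℝ} {K : ℝ} (hK : 0 ≤ K)
    (hφ : ∀ u v, |φ u - φ v| ≤ K * |u - v|)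
    (hd : ∀ z ∈ Metric.ball z₀ r, z.im ≠ φ z.re → DifferentiableAt ℂ f z) :
    DifferentiableOn ℂ f (Metric.ball z₀ r) :=
  ((isConservativeOn_of_lipschitz_graph hf hK hφ hd).isExactOn_ball hf).differentiableOn
    Metric.isOpen_ball

/-- A negative value would put `p` into the open set `D`, a positive one would keep `D` away from
`p`. -/
theorem eq_zero_of_mem_frontier {D : Set ℂ} (hD : IsOpen D) {ρ : ℂ → ℝ} {p : ℂ}
    (hp : p ∈ frontier D) (hρ : ContinuousAt ρ p) (h : ∀ᶠ k in 𝓝 p, (k ∈ D ↔ ρ k < 0)) :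
    ρ p = 0 := by
  rw [hD.frontier_eq] at hp
  have h1 : 0 ≤ ρ p := not_lt.1 fun h' => hp.2 (h.self_of_nhds.2 h')
  refine le_antisymm (not_lt.1 fun h' => ?_) h1
  have h2 : ∀ᶠ k in 𝓝 p, k ∉ D := by
    filter_upwards [h, hρ.eventually_const_lt h'] with k hk hk' hkD
    exact absurd (hk.1 hkD) (not_lt.2 hk'.le)
  exact (mem_closure_iff_frequently.1 hp.1) h2

/-- A subset of the plane on which `|Im (z - z')| ≤ |Re (z - z')|` lies on a Lipschitz graph. -/
theorem exists_lipschitz_graph {E : Set ℂ}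
    (hE : ∀ z ∈ E, ∀ z' ∈ E, |z.im - z'.im| ≤ |z.re - z'.re|) :
    ∃ φ : ℝ → ℝ, (∀ u v, |φ u - φ v| ≤ 1 * |u - v|) ∧ ∀ z ∈ E, z.im = φ z.re := by
  classical
  -- One height is chosen over each abscissa of `E`. The cone condition makes the choice
  -- 1-Lipschitz, hence extendable to `ℝ`, and unique, since points with equal real parts coincide.
  have hch : ∀ u : ℝ, ∃ v : ℝ, (∃ z ∈ E, z.re = u) → ∃ z ∈ E, z.re = u ∧ z.im = v := by
    intro u
    by_cases h : ∃ z ∈ E, z.re = u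
    · obtain ⟨z, hz, hzu⟩ := h
      exact ⟨z.im, fun _ => ⟨z, hz, hzu, rfl⟩⟩
    · exact ⟨0, fun h' => absurd h' h⟩
  choose ψ hψ using hch
  have hlip : LipschitzOnWith 1 ψ (re '' E) := by
    rintro _ ⟨z, hz, rfl⟩ _ ⟨z', hz', rfl⟩
    obtain ⟨w, hw, hwr, hwi⟩ := hψ z.re ⟨z, hz, rfl⟩
    obtain ⟨w', hw', hwr', hwi'⟩ := hψ z'.re ⟨z', hz', rfl⟩
    have := hE w hw w' hw'
    rw [hwr, hwr', hwi, hwi'] at this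
    rw [ENNReal.coe_one, one_mul, edist_dist, edist_dist]
    exact ENNReal.ofReal_le_ofReal this
  obtain ⟨φ, hφ, heq⟩ := hlip.extend_real
  refine ⟨φ, fun u v => by simpa [Real.dist_eq] using hφ.dist_le_mul u v, fun z hz => ?_⟩
  rw [← heq ⟨z, hz, rfl⟩]
  obtain ⟨w, hw, hwr, hwi⟩ := hψ z.re ⟨z, hz, rfl⟩
  have := hE z hz w hw
  rw [hwr, sub_self, abs_zero] at this
  rw [← hwi]
  exact sub_eq_zero.1 (abs_nonpos_iff.1 this)

/-- **Painlevé's theorem**: smooth contours are removable for continuous functions. -/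
theorem differentiableAt_of_continuous_of_smooth_frontier {D : Set ℂ} (hD : IsOpen D) {ζ : ℂ}
    (hsm : ∃ ρ : ℂ → ℝ, ContDiffAt ℝ 1 ρ ζ ∧ fderiv ℝ ρ ζ ≠ 0 ∧ ∀ᶠ k in 𝓝 ζ, (k ∈ D ↔ ρ k < 0))
    {f : ℂ → ℂ} (hc : ∀ᶠ z in 𝓝 ζ, ContinuousAt f z)
    (hd : ∀ᶠ z in 𝓝 ζ, z ∉ frontier D → DifferentiableAt ℂ f z) : DifferentiableAt ℂ f ζ := by
  obtain ⟨ρ, hρ, hρ0, hρD⟩ := hsm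
  set T := fderiv ℝ ρ ζ with hT
  set a := T 1 with ha
  set b := T I with hb
  have hTz : ∀ z : ℂ, T z = a * z.re + b * z.im := by
    intro z
    conv_lhs => rw [← re_add_im z]
    have : ((z.re : ℂ) + z.im * I) = z.re • (1 : ℂ) + z.im • I := by simp
    rw [this, map_add, map_smul, map_smul]
    simp only [smul_eq_mul]
    ring
  set C := a ^ 2 + b ^ 2 with hC
  have hC0 : 0 < C := by
    by_contra h
    have h1 : a = 0 := by nlinarith [sq_nonneg a, sq_nonneg b]
    have h2 : b = 0 := by nlinarith [sq_nonneg a, sq_nonneg b]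
    refine hρ0 (ContinuousLinearMap.ext fun z => ?_)
    rw [hTz, h1, h2]
    simp
  -- Multiplication by `e` rotates the real axis into the tangent direction of the contour: the
  -- derivative `T (e * w)` depends on `w.im` only.
  set e : ℂ := b - a * I with he
  have hTe : ∀ w : ℂ, T (e * w) = C * w.im := by
    intro w
    rw [hTz, he]
    simp [hC]
    ring
  have he0 : e ≠ 0 := by
    intro h
    have := hTe I
    rw [h, zero_mul, map_zero] at this
    simp at this
    exact hC0.ne this
  have hne : 0 < ‖e‖ := norm_pos_iff.2 he0
  have hstr := (hρ.hasStrictFDerivAt one_ne_zero).isLittleO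
  rw [Asymptotics.isLittleO_iff] at hstr
  -- With this constant, two points of the contour satisfy `4 |Im| ≤ |Re| + |Im|` for their
  -- difference in the rotated coordinate, so the contour is a Lipschitz graph over its tangent.
  have hstr' := hstr (c := C / (4 * ‖e‖)) (by positivity)
  rw [nhds_prod_eq, Filter.Eventually, Filter.mem_prod_self_iff] at hstr'
  have hev : ∀ᶠ z in 𝓝 ζ, ContDiffAt ℝ 1 ρ z := hρ.eventually (by simp)
  obtain ⟨s, hs, hst⟩ := hstr'
  have hall : ∀ᶠ z in 𝓝 ζ, z ∈ s ∧ ContinuousAt f z ∧ (z ∉ frontier D → DifferentiableAt ℂ f z) ∧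
      ContinuousAt ρ z ∧ ∀ᶠ k in 𝓝 z, (k ∈ D ↔ ρ k < 0) := by
    filter_upwards [hs, hc, hd, hev, hρD.eventually_nhds] with z h1 h2 h3 h4 h5
    exact ⟨h1, h2, h3, h4.continuousAt, h5⟩
  have hmap : Tendsto (fun w : ℂ => ζ + e * w) (𝓝 0) (𝓝 ζ) := by
    have : Continuous fun w : ℂ => ζ + e * w := by fun_prop
    simpa using this.tendsto 0
  obtain ⟨r, hr, hball⟩ := Metric.eventually_nhds_iff_ball.1 (hmap.eventually hall)
  obtain ⟨φ, hφ, hgr⟩ := exists_lipschitz_graph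
    (E := {w | w ∈ Metric.ball (0 : ℂ) r ∧ ζ + e * w ∈ frontier D}) (by
    rintro z ⟨hz, hzD⟩ z' ⟨hz', hzD'⟩
    obtain ⟨h1, -, -, h2, h3⟩ := hball z hz
    obtain ⟨h1', -, -, h2', h3'⟩ := hball z' hz'
    have := hst (mk_mem_prod h1 h1')
    simp only [mem_ofPred_eq] at this
    rw [eq_zero_of_mem_frontier hD hzD h2 h3, eq_zero_of_mem_frontier hD hzD' h2' h3',
      show ζ + e * z - (ζ + e * z') = e * (z - z') by ring, ← hT, hTe, norm_mul, sub_self,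
      zero_sub, norm_neg, Real.norm_eq_abs, abs_mul, abs_of_pos hC0, sub_im,
      show C / (4 * ‖e‖) * (‖e‖ * ‖z - z'‖) = C * (‖z - z'‖ / 4) by field_simp] at this
    have h4 := le_of_mul_le_mul_left this hC0
    have h5 := norm_le_abs_re_add_abs_im (z - z')
    rw [sub_re, sub_im] at h5
    have := abs_nonneg (z.re - z'.re)
    linarith)
  have hdiff := differentiableOn_ball_of_lipschitz_graph (f := fun w => f (ζ + e * w)) (z₀ := 0)
    (r := r) (fun w hw => ((hball w hw).2.1.comp (f := fun w => ζ + e * w)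
      (by fun_prop)).continuousWithinAt) zero_le_one hφ (fun w hw hne => by
      have hnD : ζ + e * w ∉ frontier D := fun h => hne (hgr w ⟨hw, h⟩)
      exact ((hball w hw).2.2.1 hnD).comp w
          (by fun_prop : DifferentiableAt ℂ (fun w => ζ + e * w) w))
  have h0 : DifferentiableAt ℂ (fun w => f (ζ + e * w)) ((ζ - ζ) / e) := by
    rw [sub_self, zero_div]
    exact hdiff.differentiableAt (Metric.ball_mem_nhds _ hr)
  have := h0.comp ζ (by fun_prop : DifferentiableAt ℂ (fun z => (z - ζ) / e) ζ)
  refine this.congr_of_eventuallyEq (Eventually.of_forall fun z => ?_)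
  simp [mul_div_cancel₀ _ he0]

/-! ### Contour integrals along the boundary of a quadrature domain -/

/-- The sum of `g` over the orbit of `ζ` under the `n`-th roots of unity. -/
def orbitSum (n : ℕ) (g : ℂ → ℂ) (ζ : ℂ) : ℂ :=
  ∑ j ∈ Finset.range n, g (exp (2 * Real.pi * I * (j / n)) * ζ)

theorem exp_root_eq_pow (n j : ℕ) :
    exp (2 * Real.pi * I * (j / n)) = exp (2 * Real.pi * I / n) ^ j := by
  rw [← exp_nat_mul]
  congr 1
  ring

theorem exp_root_pow {n : ℕ} (hn : n ≠ 0) (j : ℕ) : exp (2 * Real.pi * I * (j / n)) ^ n = 1 := by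
  rw [exp_root_eq_pow, ← pow_mul, mul_comm j n, pow_mul, (isPrimitiveRoot_exp n hn).pow_eq_one,
    one_pow]

theorem exists_root_mul_eq {n : ℕ} (hn : n ≠ 0) {ζ ζ' : ℂ} (h0 : ζ ≠ 0) (h : ζ' ^ n = ζ ^ n) :
    ∃ i < n, ζ' = exp (2 * Real.pi * I * (i / n)) * ζ := by
  have : NeZero n := ⟨hn⟩
  obtain ⟨i, hi, hi'⟩ := (isPrimitiveRoot_exp n hn).eq_pow_of_pow_eq_one (ξ := ζ' / ζ)
    (by rw [div_pow, h, div_self (pow_ne_zero _ h0)])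
  exact ⟨i, hi, by rw [exp_root_eq_pow, hi', div_mul_cancel₀ _ h0]⟩

/-- Rotation by the primitive root shifts the summation index cyclically. Hence the push-forward
does not depend on the branch of the `n`-th root. -/
theorem orbitSum_congr {n : ℕ} (hn : n ≠ 0) (g : ℂ → ℂ) {ζ ζ' : ℂ} (h0 : ζ ≠ 0)
    (h : ζ' ^ n = ζ ^ n) : orbitSum n g ζ' = orbitSum n g ζ := by
  set ω := exp (2 * Real.pi * I / n) with hω
  have hω1 : ω ^ n = 1 := (isPrimitiveRoot_exp n hn).pow_eq_one
  have hstep : ∀ z, orbitSum n g (ω * z) = orbitSum n g z := by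
    intro z
    simp only [orbitSum, exp_root_eq_pow, ← hω]
    have h1 := Finset.sum_range_succ (fun j => g (ω ^ j * z)) n
    rw [Finset.sum_range_succ', hω1, pow_zero] at h1
    rw [← add_right_cancel h1]
    refine Finset.sum_congr rfl fun j _ => ?_
    rw [pow_succ, mul_assoc]
  obtain ⟨i, -, rfl⟩ := exists_root_mul_eq hn h0 h
  rw [exp_root_eq_pow, ← hω]
  clear h
  induction i with
  | zero => simp
  | succ i ih => rw [pow_succ', mul_assoc, hstep, ih]

/-- The push-forward of `F(l) dl` under `l ↦ (l - s)^n`, as a function of `w ≠ 0`. -/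
def pushforward (n : ℕ) (s : ℂ) (F : ℂ → ℂ) (w : ℂ) : ℂ :=
  orbitSum n (fun ζ => F (s + ζ) * ζ) (w ^ ((1 : ℂ) / n)) / (n * w)

theorem pushforward_eq {n : ℕ} (hn : n ≠ 0) (s : ℂ) (F : ℂ → ℂ) {w ζ : ℂ} (hw : w ≠ 0)
    (h : ζ ^ n = w) :
    pushforward n s F w = orbitSum n (fun ζ => F (s + ζ) * ζ) ζ / (n * w) := by
  rw [pushforward, orbitSum_congr hn _ (ζ := ζ)]
  · rintro rfl
    rw [zero_pow hn] at h
    exact hw h.symm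
  · rw [one_div, cpow_nat_inv_pow _ hn, h]

/-- The principal root jumps along its cut. By branch independence it may be replaced near `w` by
`ζ₀ (z / w)^(1/n)`, which is holomorphic because `z / w` stays near `1`. -/
theorem differentiableAt_pushforward {n : ℕ} (hn : n ≠ 0) (s : ℂ) {F : ℂ → ℂ} {w : ℂ} (hw : w ≠ 0)
    (hF : ∀ ζ, ζ ^ n = w → DifferentiableAt ℂ F (s + ζ)) :
    DifferentiableAt ℂ (pushforward n s F) w := by
  set ζ₀ := w ^ ((1 : ℂ) / n) with hζ₀
  have hζ₀n : ζ₀ ^ n = w := by rw [hζ₀, one_div, cpow_nat_inv_pow _ hn]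
  set b : ℂ → ℂ := fun z => ζ₀ * (z / w) ^ ((1 : ℂ) / n) with hb
  have hbw : b w = ζ₀ := by simp [hb, div_self hw]
  have hbn : ∀ z, b z ^ n = z := fun z => by
    rw [hb]
    simp only
    rw [mul_pow, hζ₀n, one_div, cpow_nat_inv_pow _ hn, mul_div_cancel₀ _ hw]
  have hbd : DifferentiableAt ℂ b w := by
    refine DifferentiableAt.const_mul (DifferentiableAt.cpow_const (by fun_prop) ?_) _
    rw [div_self hw]
    exact one_mem_slitPlane
  have heq : pushforward n s F =ᶠ[𝓝 w]
      fun z => orbitSum n (fun ζ => F (s + ζ) * ζ) (b z) / (n * z) := by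
    filter_upwards [isOpen_ne.mem_nhds hw] with z hz
    exact pushforward_eq hn s F hz (hbn z)
  refine DifferentiableAt.congr_of_eventuallyEq ?_ heq
  refine DifferentiableAt.div ?_ (by fun_prop) (mul_ne_zero (by exact_mod_cast hn) hw)
  simp only [orbitSum]
  refine DifferentiableAt.fun_sum fun j _ => ?_
  have h1 : DifferentiableAt ℂ (fun z => exp (2 * Real.pi * I * (j / n)) * b z) w :=
    hbd.const_mul _
  refine DifferentiableAt.mul ?_ h1
  refine DifferentiableAt.comp (g := F) (f := fun z => s + exp (2 * Real.pi * I * (j / n)) * b z) w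
    ?_ (h1.const_add s)
  refine hF _ ?_
  rw [hbw, mul_pow, exp_root_pow hn, hζ₀n, one_mul]

/-- The factor `ζ` in the orbit sum vanishes with `w`. This is the growth bound that makes the
singularity at `w = 0` removable. -/
theorem tendsto_mul_pushforward {n : ℕ} (hn : n ≠ 0) (s : ℂ) {F : ℂ → ℂ} (hF : ContinuousAt F s) :
    Tendsto (fun w => w * pushforward n s F w) (𝓝[≠] 0) (𝓝 0) := by
  have hn' : (n : ℂ) ≠ 0 := by exact_mod_cast hn
  have h1 : Tendsto (fun w : ℂ => w ^ ((1 : ℂ) / n)) (𝓝[≠] 0) (𝓝 0) := by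
    have hpos : 0 < ((1 : ℂ) / n).re := by
      rw [show (1 : ℂ) / n = ((1 / n : ℝ) : ℂ) by push_cast; rfl, ofReal_re]
      have : 0 < n := Nat.pos_of_ne_zero hn
      positivity
    have := (continuousAt_cpow_const_of_re_pos (z := 0) (w := (1 : ℂ) / n) (Or.inl le_rfl)
      hpos).tendsto
    rw [zero_cpow (by rw [one_div]; exact inv_ne_zero hn')] at this
    exact this.mono_left nhdsWithin_le_nhds
  have h2 : Tendsto (fun w : ℂ => orbitSum n (fun ζ => F (s + ζ) * ζ) (w ^ ((1 : ℂ) / n)) / n)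
      (𝓝[≠] 0) (𝓝 0) := by
    have : Tendsto (fun ζ => orbitSum n (fun ζ => F (s + ζ) * ζ) ζ / n) (𝓝 0) (𝓝 0) := by
      have hc : ContinuousAt (fun ζ => orbitSum n (fun ζ => F (s + ζ) * ζ) ζ / n) 0 := by
        simp only [orbitSum]
        refine ContinuousAt.div_const ?_ _
        refine tendsto_finsetSum _ fun j _ => ?_
        refine ContinuousAt.mul ?_ (by fun_prop)
        exact ContinuousAt.comp (g := F) (f := fun z => s + exp (2 * Real.pi * I * (j / n)) * z)
          (by simpa using hF) (by fun_prop)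
      have := hc.tendsto
      simpa [orbitSum] using this
    exact this.comp h1
  refine h2.congr' ?_
  filter_upwards [self_mem_nhdsWithin] with w hw
  have : w ≠ 0 := hw
  rw [pushforward]
  field_simp

/-- The push-forward extends holomorphically across `w = 0`. -/
theorem exists_differentiableAt_pushforward {n : ℕ} (hn : n ≠ 0) (s : ℂ) {F : ℂ → ℂ} {B : Set ℂ}
    (hF : ∀ ζ, ζ ^ n ∈ B → AnalyticAt ℂ F (s + ζ)) :
    ∃ G : ℂ → ℂ, (∀ w ∈ B, DifferentiableAt ℂ G w) ∧ ∀ w ≠ 0, G w = pushforward n s F w := by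
  refine ⟨Function.update (pushforward n s F) 0 (limUnder (𝓝[≠] 0) (pushforward n s F)), ?_,
    fun w hw => Function.update_of_ne hw _ _⟩
  intro w hw
  rcases eq_or_ne w 0 with rfl | h0
  · have hs : AnalyticAt ℂ F s := by simpa using hF 0 (by rwa [zero_pow hn])
    obtain ⟨r, hr, hball⟩ := Metric.eventually_nhds_iff_ball.1 hs.eventually_analyticAt
    have hset : Metric.ball (0 : ℂ) (r ^ n) ∈ 𝓝 (0 : ℂ) := Metric.ball_mem_nhds _ (by positivity)
    refine (differentiableOn_update_limUnder_of_isLittleO hset ?_ ?_).differentiableAt hset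
    · rintro z ⟨hz, hz0⟩
      refine (differentiableAt_pushforward hn s hz0 fun ζ hζ => ?_).differentiableWithinAt
      refine (hball _ ?_).differentiableAt
      rw [Metric.mem_ball, dist_eq_norm, add_sub_cancel_left]
      rw [Metric.mem_ball, dist_zero_right, ← hζ, norm_pow] at hz
      exact lt_of_pow_lt_pow_left₀ n hr.le hz
    -- Division by zero gives the value `0` here, so the growth condition is simply `pushforward =
    -- o(1/w)`.
    · have h0 : pushforward n s F 0 = 0 := by simp [pushforward]
      simp only [h0, sub_zero]
      rw [Asymptotics.isLittleO_iff_tendsto']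
      · refine (tendsto_mul_pushforward hn s hs.continuousAt).congr fun w => ?_
        rw [div_inv_eq_mul, mul_comm]
      · filter_upwards [self_mem_nhdsWithin] with w hw h
        exact absurd (inv_eq_zero.1 h) hw
  · refine (differentiableAt_pushforward hn s h0 fun ζ hζ =>
      (hF ζ (hζ ▸ hw)).differentiableAt).congr_of_eventuallyEq ?_
    filter_upwards [isOpen_ne.mem_nhds h0] with z hz
    exact Function.update_of_ne hz _ _

/-- The boundary branches are differentiable wherever the circle avoids the cut of the principal
root; it meets the real axis for countably many angles only. -/
theorem ae_circleMap_mem_slitPlane (c : ℂ) {R : ℝ} (hR : 0 < R) :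
    ∀ᵐ θ : ℝ, circleMap c R θ ∈ slitPlane := by
  have hcount : {θ : ℝ | (circleMap c R θ).im = 0}.Countable := by
    rcases eq_empty_or_nonempty {θ : ℝ | (circleMap c R θ).im = 0} with h | ⟨θ₀, hθ₀⟩
    · rw [h]; exact countable_empty
    · have him : ∀ θ : ℝ, (circleMap c R θ).im = c.im + R * Real.sin θ := fun θ => by
        simp [circleMap, exp_ofReal_mul_I_im]
      refine Countable.mono (s₂ := (range fun k : ℤ => 2 * k * Real.pi + θ₀) ∪
        range fun k : ℤ => (2 * k + 1) * Real.pi - θ₀) ?_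
        ((countable_range _).union (countable_range _))
      intro θ hθ
      have h1 : Real.sin θ₀ = Real.sin θ := by
        have e1 : c.im + R * Real.sin θ₀ = 0 := by rw [← him]; exact hθ₀
        have e2 : c.im + R * Real.sin θ = 0 := by rw [← him]; exact hθ
        exact mul_left_cancel₀ hR.ne' (by linarith)
      obtain ⟨k, hk | hk⟩ := Real.sin_eq_sin_iff.1 h1
      · exact Or.inl ⟨k, hk.symm⟩
      · exact Or.inr ⟨k, hk.symm⟩
  filter_upwards [hcount.ae_notMem volume] with θ hθ
  exact Or.inr hθ

theorem hasDerivAt_boundaryBranch {n : ℕ} (s₁ s₂ : ℂ) (s₃ : ℝ) (j : ℕ) {θ : ℝ}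
    (h : circleMap s₂ s₃ θ ∈ slitPlane) :
    HasDerivAt (boundaryBranch n s₁ s₂ s₃ j)
      (exp (2 * Real.pi * I * (j / n)) * (circleMap s₂ s₃ θ) ^ ((1 : ℂ) / n) /
        (n * circleMap s₂ s₃ θ) * deriv (circleMap s₂ s₃) θ) θ := by
  have h0 : circleMap s₂ s₃ θ ≠ 0 := slitPlane_ne_zero h
  have h1 := ((((hasDerivAt_id (circleMap s₂ s₃ θ)).cpow_const (c := (1 : ℂ) / n) h).comp θ
    (hasDerivAt_circleMap s₂ s₃ θ))).const_mul (exp (2 * Real.pi * I * (j / n)))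
  have h2 := h1.const_add s₁
  rw [(hasDerivAt_circleMap s₂ s₃ θ).deriv]
  refine HasDerivAt.congr_deriv h2 ?_
  rw [id, cpow_sub _ _ h0, cpow_one, ← div_div]
  simp only [one_div]
  ring

/-- Both sides are the derivative at the node `lam j - s₁` of `X^n - s₂ = ∏ (X - (lam l - s₁))`. -/
theorem prod_sub_eq_mul_pow {n : ℕ} {s₁ s₂ : ℂ} (lam : Fin n → ℂ)
    (hlam : ∀ j, (lam j - s₁) ^ n = s₂) (hinj : Function.Injective lam) (j : Fin n) :
    ∏ l ∈ Finset.univ.erase j, (lam j - lam l) = n * (lam j - s₁) ^ (n - 1) := by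
  have hn : 0 < n := j.pos
  set v : Fin n → ℂ := fun j => lam j - s₁ with hv
  have hvinj : Function.Injective v := fun a b hab => hinj (sub_left_injective hab)
  have hnod : Lagrange.nodal Finset.univ v = Polynomial.X ^ n - Polynomial.C s₂ := by
    refine Polynomial.eq_of_degree_sub_lt_of_eval_index_eq (v := v) Finset.univ hvinj.injOn ?_ ?_
    · have hm1 : (Lagrange.nodal Finset.univ v).Monic := Lagrange.nodal_monic
      have hd : (Lagrange.nodal Finset.univ v).degree = n := by
        rw [Lagrange.degree_nodal]; simp
      have := Polynomial.degree_sub_lt_left (p := Lagrange.nodal Finset.univ v)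
        (q := Polynomial.X ^ n - Polynomial.C s₂)
        (by rw [hd, Polynomial.degree_X_pow_sub_C hn]) hm1.ne_zero
        (by rw [hm1.leadingCoeff, (Polynomial.monic_X_pow_sub_C s₂ hn.ne').leadingCoeff])
      rw [hd] at this
      simpa using this
    · intro i _
      rw [Lagrange.eval_nodal_at_node (Finset.mem_univ i)]
      simp [hv, hlam]
  have h1 := Lagrange.eval_nodal_derivative_eval_node_eq (v := v) (Finset.mem_univ j)
  rw [hnod, Lagrange.eval_nodal] at h1
  simp only [hv, Polynomial.derivative_sub, Polynomial.derivative_X_pow, Polynomial.derivative_C,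
    sub_zero, Polynomial.eval_mul, Polynomial.eval_pow, Polynomial.eval_X, sub_sub_sub_cancel_right,
    map_natCast, Polynomial.eval_natCast] at h1
  exact h1.symm

/-- The root of unity that carries `lam j₀ - s₁` to `lam j - s₁` determines `j`, so its index is an
injection of `Fin n` into itself, hence a permutation. -/
theorem orbitSum_eq_sum_roots {n : ℕ} {s₁ s₂ : ℂ} (hs : s₂ ≠ 0) (lam : Fin n → ℂ)
    (hlam : ∀ j, (lam j - s₁) ^ n = s₂) (hinj : Function.Injective lam) (g : ℂ → ℂ) (j₀ : Fin n) :
    orbitSum n g (lam j₀ - s₁) = ∑ j, g (lam j - s₁) := by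
  have hn : n ≠ 0 := j₀.pos.ne'
  have h0 : lam j₀ - s₁ ≠ 0 := fun h => hs (by rw [← hlam j₀, h, zero_pow hn])
  have hex : ∀ j : Fin n, ∃ i : Fin n, lam j - s₁ = exp (2 * Real.pi * I * ((i : ℕ) / n)) *
      (lam j₀ - s₁) := by
    intro j
    obtain ⟨i, hi, h⟩ := exists_root_mul_eq hn h0 ((hlam j).trans (hlam j₀).symm)
    exact ⟨⟨i, hi⟩, h⟩
  choose σ hσ using hex
  have hσinj : Function.Injective σ := fun a b hab => hinj (sub_left_injective (b := s₁)
    ((hσ a).trans (by rw [hab, ← hσ b])))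
  rw [orbitSum, Finset.sum_range]
  rw [← (Finite.injective_iff_bijective.1 hσinj).sum_comp]
  exact Finset.sum_congr rfl fun j _ => by rw [hσ j]

/-- The residue formula for the conjugate weight on the boundary of a quadrature domain. -/
theorem boundaryIntegral_conj_pow_mul {n : ℕ} (hn : n ≠ 0) {s₁ s₂ : ℂ} {s₃ : ℝ} (hs₃ : 0 < s₃)
    {F : ℂ → ℂ} (hF : ∀ l, ‖(l - s₁) ^ n - s₂‖ ≤ s₃ → AnalyticAt ℂ F l) (lam : Fin n → ℂ)
    (hlam : ∀ j, (lam j - s₁) ^ n = s₂) (hinj : Function.Injective lam) :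
    boundaryIntegral n s₁ s₂ s₃ (fun l => (conj l - conj s₁) ^ n * F l) =
      2 * Real.pi * I *
        ∑ j, (s₃ : ℂ) ^ 2 * F (lam j) / ∏ l ∈ Finset.univ.erase j, (lam j - lam l) := by
  have hn' : (n : ℂ) ≠ 0 := by exact_mod_cast hn
  obtain ⟨G, hG, hGe⟩ := exists_differentiableAt_pushforward hn s₁ (F := F)
    (B := Metric.closedBall s₂ s₃) (fun ζ hζ => hF _ (by
      rw [add_sub_cancel_left]; simpa [dist_eq_norm] using hζ))
  have h1 : boundaryIntegral n s₁ s₂ s₃ (fun l => (conj l - conj s₁) ^ n * F l) =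
      ∮ w in C(s₂, s₃), (conj s₂ * G w + (s₃ : ℂ) ^ 2 * ((w - s₂)⁻¹ • G w)) := by
    rw [boundaryIntegral, circleIntegral]
    refine intervalIntegral.integral_congr_ae ?_
    filter_upwards [ae_circleMap_mem_slitPlane s₂ hs₃] with θ hθ _
    set w := circleMap s₂ s₃ θ with hw
    have hw0 : w ≠ 0 := slitPlane_ne_zero hθ
    have hwe : w = s₂ + s₃ * exp (θ * I) := rfl
    have hsub : w - s₂ = s₃ * exp (θ * I) := by rw [hwe]; ring
    have hs0 : (s₃ : ℂ) ≠ 0 := by exact_mod_cast hs₃.ne'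
    -- The Schwarz function of the circle: `|w - s₂|² = s₃²` expresses the conjugate of `w` as a
    -- meromorphic function of `w`.
    have hconj : conj w = conj s₂ + (s₃ : ℂ) ^ 2 * (w - s₂)⁻¹ := by
      rw [hsub, hwe, map_add, map_mul, conj_ofReal, ← exp_conj, map_mul, conj_ofReal, conj_I,
        mul_neg, exp_neg]
      field_simp
    rw [hGe w hw0, pushforward, orbitSum]
    have hterm : ∀ j ∈ Finset.range n,
        (conj (boundaryBranch n s₁ s₂ s₃ j θ) - conj s₁) ^ n * F (boundaryBranch n s₁ s₂ s₃ j θ) *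
          deriv (boundaryBranch n s₁ s₂ s₃ j) θ =
        conj w * deriv (circleMap s₂ s₃) θ / (n * w) *
          (F (s₁ + exp (2 * Real.pi * I * (j / n)) * w ^ ((1 : ℂ) / n)) *
            (exp (2 * Real.pi * I * (j / n)) * w ^ ((1 : ℂ) / n))) := by
      intro j _
      rw [(hasDerivAt_boundaryBranch s₁ s₂ s₃ j hθ).deriv, ← map_sub, ← map_pow,
        boundaryBranch_sub_pow hn, ← hwe, ← hw,
        show boundaryBranch n s₁ s₂ s₃ j θ =
          s₁ + exp (2 * Real.pi * I * (j / n)) * w ^ ((1 : ℂ) / n) from rfl]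
      ring
    rw [Finset.sum_congr rfl hterm, ← Finset.mul_sum, hconj, smul_eq_mul, smul_eq_mul]
    ring
  have hGc : ContinuousOn G (Metric.closedBall s₂ s₃) := fun w hw =>
    (hG w hw).continuousAt.continuousWithinAt
  have hGs : ContinuousOn G (Metric.sphere s₂ s₃) := hGc.mono Metric.sphere_subset_closedBall
  have hGd : ∀ w ∈ Metric.ball s₂ s₃ \ ∅, DifferentiableAt ℂ G w := fun w hw =>
    hG w (Metric.ball_subset_closedBall hw.1)
  -- The term with the constant `conj s₂` vanishes by Cauchy's theorem; the other one is evaluated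
  -- by Cauchy's formula at the centre.
  have h2 : (∮ w in C(s₂, s₃), (conj s₂ * G w + (s₃ : ℂ) ^ 2 * ((w - s₂)⁻¹ • G w))) =
      2 * Real.pi * I * ((s₃ : ℂ) ^ 2 * G s₂) := by
    rw [circleIntegral.integral_add, circleIntegral.integral_const_mul,
      circleIntegral.integral_const_mul,
      circleIntegral_eq_zero_of_differentiable_on_off_countable hs₃.le countable_empty hGc hGd,
      circleIntegral_sub_inv_smul_of_differentiable_on_off_countable countable_empty
        (Metric.mem_ball_self hs₃) hGc hGd, smul_eq_mul]
    · ring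
    · exact (hGs.const_smul (conj s₂)).circleIntegrable hs₃.le
    · refine ContinuousOn.circleIntegrable hs₃.le ?_
      refine continuousOn_const.mul (ContinuousOn.smul (ContinuousOn.inv₀ (f := fun w => w - s₂)
        (by fun_prop) ?_) hGs)
      intro w hw h
      rw [sub_eq_zero.1 h] at hw
      simp at hw
      exact hs₃.ne hw
  rw [h1, h2]
  congr 1
  have j₀ : Fin n := ⟨0, Nat.pos_of_ne_zero hn⟩
  suffices hG0 : G s₂ = ∑ j, F (lam j) / ∏ l ∈ Finset.univ.erase j, (lam j - lam l) by
    rw [hG0, Finset.mul_sum]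
    exact Finset.sum_congr rfl fun j _ => (mul_div_assoc _ _ _).symm
  -- If `s₂ = 0`, all roots equal `s₁` and distinctness forces `n = 1`. The formula for the
  -- push-forward is void at `0`, so `G 0` is found as a limit.
  rcases eq_or_ne s₂ 0 with h0 | h0
  · have hl : ∀ j, lam j = s₁ := fun j =>
      sub_eq_zero.1 (pow_eq_zero_iff hn |>.1 ((hlam j).trans h0))
    have hn1 : n = 1 := by
      have : Subsingleton (Fin n) := ⟨fun a b => hinj ((hl a).trans (hl b).symm)⟩
      have := Fintype.card_le_one_iff_subsingleton.2 this
      rw [Fintype.card_fin] at this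
      omega
    subst hn1
    have hG1 : G =ᶠ[𝓝[≠] 0] fun w => F (s₁ + w) := by
      filter_upwards [self_mem_nhdsWithin] with w hw
      have : w ≠ 0 := hw
      rw [hGe w hw]
      simp [pushforward, orbitSum]
      field_simp
    have hFc : ContinuousAt (fun w => F (s₁ + w)) 0 := by
      refine ContinuousAt.comp (g := F) ?_ (by fun_prop)
      exact (hF _ (by rw [h0]; simpa using hs₃.le)).continuousAt
    have hGc0 : ContinuousAt G 0 := (hG 0 (by rw [h0]; simpa using hs₃.le)).continuousAt
    have := tendsto_nhds_unique ((hGc0.tendsto.mono_left nhdsWithin_le_nhds).congr' hG1)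
      (hFc.tendsto.mono_left nhdsWithin_le_nhds)
    rw [h0, this]
    simp [hl]
  · rw [hGe _ h0, pushforward_eq hn _ _ h0 (hlam j₀), orbitSum_eq_sum_roots h0 lam hlam hinj,
      Finset.sum_div]
    refine Finset.sum_congr rfl fun j _ => ?_
    have hj0 : lam j - s₁ ≠ 0 := fun h => h0 (by rw [← hlam j, h, zero_pow hn])
    rw [prod_sub_eq_mul_pow lam hlam hinj, add_sub_cancel]
    rw [← hlam j]
    obtain ⟨m, rfl⟩ := Nat.exists_eq_succ_of_ne_zero hn
    rw [Nat.succ_sub_one, pow_succ]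
    field_simp

/-! ### Partial fractions -/

/-- The rational function `a + g / k + ∑ i, P i / (k - p i)`. -/
def partialFraction {ι : Type*} [Fintype ι] (a g : ℂ) (P p : ι → ℂ) (k : ℂ) : ℂ :=
  a + g / k + ∑ i, P i / (k - p i)

section
variable {ι : Type*} [Fintype ι]

theorem conj_partialFraction (a g : ℂ) (P p : ι → ℂ) (k : ℂ) :
    conj (partialFraction a g P p (conj k)) =
      partialFraction (conj a) (conj g) (fun i => conj (P i)) (fun i => conj (p i)) k := by
  simp [partialFraction]

theorem neg_partialFraction (a g : ℂ) (P p : ι → ℂ) (k : ℂ) :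
    -partialFraction a g P p k = partialFraction (-a) (-g) (fun i => -P i) p k := by
  simp only [partialFraction, neg_div, Finset.sum_neg_distrib]
  ring

theorem differentiableAt_partialFraction (a g : ℂ) {P p : ι → ℂ} {k : ℂ} (hk : k ≠ 0)
    (h : ∀ i, P i = 0 ∨ k ≠ p i) : DifferentiableAt ℂ (partialFraction a g P p) k := by
  unfold partialFraction
  refine ((differentiableAt_const _).add (by fun_prop (disch := assumption))).add
    (DifferentiableAt.fun_sum fun i _ => ?_)
  rcases h i with h | h
  · simp [h]
  · have := sub_ne_zero.2 h
    fun_prop (disch := assumption)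

/-- With the `i`-th residue set to zero the function is continuous at `p i`, so only the removed
term contributes. -/
theorem tendsto_mul_partialFraction (a g : ℂ) {P p : ι → ℂ} (hp : Function.Injective p)
    (i : ι) (hi : p i ≠ 0) :
    Tendsto (fun k => (k - p i) * partialFraction a g P p k) (𝓝[≠] (p i)) (𝓝 (P i)) := by
  classical
  have h1 : ContinuousAt (fun k => (k - p i) *
      partialFraction a g (Function.update P i 0) p k) (p i) :=
    ContinuousAt.mul (by fun_prop) (differentiableAt_partialFraction a g hi fun j => by
      rcases eq_or_ne j i with rfl | hj
      · left; simp
      · right; exact fun h => hj (hp h.symm)).continuousAt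
  have h2 := (h1.tendsto.mono_left (nhdsWithin_le_nhds (s := {p i}ᶜ))).add_const (P i)
  simp only [sub_self, zero_mul, zero_add] at h2
  refine h2.congr' ?_
  filter_upwards [self_mem_nhdsWithin] with k hk
  have hk' : k - p i ≠ 0 := sub_ne_zero.2 hk
  have h3 : ∑ j, P j / (k - p j) = ∑ j, Function.update P i 0 j / (k - p j) + P i / (k - p i) := by
    rw [← Finset.add_sum_erase _ _ (Finset.mem_univ i),
      ← Finset.add_sum_erase (a := i) _ (fun j => Function.update P i 0 j / (k - p j))
        (Finset.mem_univ i)]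
    simp only [Function.update_self, zero_div, zero_add]
    rw [add_comm]
    congr 1
    refine Finset.sum_congr rfl fun j hj => ?_
    rw [Function.update_of_ne (Finset.ne_of_mem_erase hj)]
  simp only [partialFraction]
  rw [h3, ← add_assoc, mul_add _ _ (P i / (k - p i)), mul_div_cancel₀ _ hk']

theorem tendsto_div_sub_cobounded (c : ℂ) :
    Tendsto (fun k : ℂ => k / (k - c)) (Bornology.cobounded ℂ) (𝓝 1) := by
  have h1 : Tendsto (fun k : ℂ => 1 - c * k⁻¹) (Bornology.cobounded ℂ) (𝓝 (1 - c * 0)) :=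
    (tendsto_inv₀_cobounded.const_mul c).const_sub 1
  have h2 := h1.inv₀ (by simp)
  simp only [mul_zero, sub_zero, inv_one] at h2
  refine h2.congr' ?_
  filter_upwards [Bornology.eventually_ne_cobounded 0] with k hk
  rw [show 1 - c * k⁻¹ = (k - c) / k by field_simp, inv_div]

theorem tendsto_mul_partialFraction_sub_cobounded (a g : ℂ) (P p : ι → ℂ) :
    Tendsto (fun k => k * (partialFraction a g P p k - a)) (Bornology.cobounded ℂ)
      (𝓝 (g + ∑ i, P i)) := by
  have h : Tendsto (fun k => g + ∑ i, P i * (k / (k - p i))) (Bornology.cobounded ℂ)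
      (𝓝 (g + ∑ i, P i * 1)) :=
    (tendsto_finsetSum _ fun i _ => (tendsto_div_sub_cobounded (p i)).const_mul _).const_add g
  simp only [mul_one] at h
  refine h.congr' ?_
  filter_upwards [Bornology.eventually_ne_cobounded 0] with k hk
  simp only [partialFraction, add_assoc, add_sub_cancel_left]
  rw [mul_add, mul_div_cancel₀ _ hk, Finset.mul_sum]
  congr 1
  exact Finset.sum_congr rfl fun i _ => by ring

theorem isBigO_partialFraction_sub_cobounded (a g : ℂ) (P p : ι → ℂ) :
    (fun k => partialFraction a g P p k - a) =O[Bornology.cobounded ℂ] fun k => k⁻¹ := by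
  have h := ((tendsto_mul_partialFraction_sub_cobounded a g P p).isBigO_one ℂ).mul
    (Asymptotics.isBigO_refl (fun k : ℂ => k⁻¹) (Bornology.cobounded ℂ))
  refine h.congr' ?_ (Eventually.of_forall fun k => one_mul _)
  filter_upwards [Bornology.eventually_ne_cobounded 0] with k hk
  field_simp

theorem isBigO_partialFraction_sub_zero (a g : ℂ) {P p : ι → ℂ} (hp : ∀ i, p i ≠ 0) :
    (fun k => partialFraction a g P p k - g / k) =O[𝓝[≠] 0] fun _ => (1 : ℂ) := by
  have h : ContinuousAt (fun k => a + ∑ i, P i / (k - p i)) 0 := by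
    refine continuousAt_const.add (tendsto_finsetSum _ fun i _ => ?_)
    refine ContinuousAt.div continuousAt_const (by fun_prop) ?_
    rw [zero_sub]; exact neg_ne_zero.2 (hp i)
  refine ((h.tendsto.mono_left nhdsWithin_le_nhds).isBigO_one ℂ).congr_left fun k => ?_
  simp only [partialFraction]
  ring

/-- The real zeros accumulate at `1`, and the complement of finitely many poles is connected, so the
function vanishes identically by the identity theorem and with it all its residues. -/
theorem eq_zero_of_partialFraction_eq_zero {P p : ι → ℂ} (hp : Function.Injective p)
    (hp0 : ∀ i, (p i).im ≠ 0)
    (h : ∀ x : ℝ, x ≠ 0 → partialFraction 0 0 P p x = 0) : P = 0 := by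
  have hfin : (range p).Finite := finite_range p
  set f : ℂ → ℂ := fun k => ∑ i, P i / (k - p i) with hf
  have hfe : partialFraction 0 0 P p = f := by
    ext k
    simp [partialFraction, hf]
  have hdiff : DifferentiableOn ℂ f (range p)ᶜ := by
    intro k hk
    refine (DifferentiableAt.fun_sum fun i _ => ?_).differentiableWithinAt
    have : k - p i ≠ 0 := sub_ne_zero.2 fun h => hk ⟨i, h.symm⟩
    fun_prop (disch := assumption)
  have hconn : IsPreconnected (range p)ᶜ :=
    (hfin.countable.isConnected_compl_of_one_lt_rank (by simp)).isPreconnected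
  have h1 : (1 : ℂ) ∈ (range p)ᶜ := by
    rintro ⟨i, hi⟩
    exact hp0 i (by rw [hi]; simp)
  have hfreq : ∃ᶠ z in 𝓝[≠] (1 : ℂ), f z = 0 := by
    have ht : Tendsto (fun x : ℝ => (x : ℂ)) (𝓝[≠] 1) (𝓝[≠] 1) := by
      refine tendsto_nhdsWithin_iff.2 ⟨?_, ?_⟩
      · simpa using (continuous_ofReal.tendsto (1 : ℝ)).mono_left nhdsWithin_le_nhds
      · filter_upwards [self_mem_nhdsWithin] with x hx
        have : x ≠ 1 := hx
        simpa using this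
    refine ht.frequently (Eventually.frequently ?_)
    filter_upwards [nhdsWithin_le_nhds (isOpen_ne.mem_nhds (one_ne_zero (α := ℝ)))] with x hx
    rw [← hfe]
    exact h x hx
  have hana := hdiff.analyticOnNhd hfin.isClosed.isOpen_compl
  have hzero := hana.eqOn_zero_of_preconnected_of_frequently_eq_zero
    hconn h1 hfreq
  funext i
  have hpi : p i ≠ 0 := fun h => hp0 i (by rw [h]; simp)
  refine tendsto_nhds_unique (tendsto_mul_partialFraction 0 0 (P := P) hp i hpi) ?_
  refine Tendsto.congr' ?_ tendsto_const_nhds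
  have hs : ∀ᶠ k in 𝓝[≠] (p i), k ∉ range p := by
    have := (hfin.subset (sdiff_subset (t := {p i}))).isClosed.isOpen_compl.mem_nhds
      (x := p i) (fun h => h.2 rfl)
    filter_upwards [nhdsWithin_le_nhds this, self_mem_nhdsWithin] with k hk hk' hkr
    exact hk ⟨hkr, hk'⟩
  filter_upwards [hs] with k hk
  rw [hfe, hzero hk]
  simp

/-- As the two pole sets are disjoint, the residue of the product at a pole of one factor is the
residue there times the value of the other. The last term corrects for `1 / (p (k - p)) = (1 / k) (1
/ (k - p) + 1 / p)`. -/
theorem partialFraction_mul {κ : Type*} [Fintype κ] (a g b h : ℂ) {P p : ι → ℂ} {R r : κ → ℂ}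
    (hpr : ∀ i j, p i ≠ r j) (hp : ∀ i, p i ≠ 0) (hr : ∀ j, r j ≠ 0) {k : ℂ} (hk : k ≠ 0)
    (hkp : ∀ i, k ≠ p i) (hkr : ∀ j, k ≠ r j) :
    partialFraction a g P p k * partialFraction b h R r k =
      (a + g / k) * (b + h / k) +
        (∑ i, P i * partialFraction b h R r (p i) / (k - p i) +
          ∑ j, R j * partialFraction a g P p (r j) / (k - r j)) -
        (h * ∑ i, P i / p i + g * ∑ j, R j / r j) / k := by
  have e1 : ∑ i, P i * partialFraction b h R r (p i) / (k - p i) =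
      (b + h / k) * ∑ i, P i / (k - p i) + h / k * ∑ i, P i / p i +
        ∑ i, ∑ j, P i * R j / ((p i - r j) * (k - p i)) := by
    rw [Finset.mul_sum, Finset.mul_sum, ← Finset.sum_add_distrib, ← Finset.sum_add_distrib]
    refine Finset.sum_congr rfl fun i _ => ?_
    rw [partialFraction, mul_add, add_div, Finset.mul_sum, Finset.sum_div]
    congr 1
    · have := hp i
      have := sub_ne_zero.2 (hkp i)
      field_simp
      ring
    · refine Finset.sum_congr rfl fun j _ => ?_
      rw [mul_div_assoc', div_div]
  have e2 : ∑ j, R j * partialFraction a g P p (r j) / (k - r j) =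
      (a + g / k) * ∑ j, R j / (k - r j) + g / k * ∑ j, R j / r j +
        ∑ i, ∑ j, P i * R j / ((r j - p i) * (k - r j)) := by
    rw [Finset.sum_comm, Finset.mul_sum, Finset.mul_sum, ← Finset.sum_add_distrib,
      ← Finset.sum_add_distrib]
    refine Finset.sum_congr rfl fun j _ => ?_
    rw [partialFraction, mul_add, add_div, Finset.mul_sum, Finset.sum_div]
    congr 1
    · have := hr j
      have := sub_ne_zero.2 (hkr j)
      field_simp
      ring
    · refine Finset.sum_congr rfl fun i _ => ?_
      rw [mul_div_assoc', div_div, mul_comm (R j)]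
  have e3 : (∑ i, P i / (k - p i)) * ∑ j, R j / (k - r j) =
      ∑ i, ∑ j, P i * R j / ((p i - r j) * (k - p i)) +
        ∑ i, ∑ j, P i * R j / ((r j - p i) * (k - r j)) := by
    rw [Finset.sum_mul_sum, ← Finset.sum_add_distrib]
    refine Finset.sum_congr rfl fun i _ => ?_
    rw [← Finset.sum_add_distrib]
    refine Finset.sum_congr rfl fun j _ => ?_
    have h1 := sub_ne_zero.2 (hkp i)
    have h2 := sub_ne_zero.2 (hkr j)
    have h3 := sub_ne_zero.2 (hpr i j)
    have h4 : r j - p i ≠ 0 := sub_ne_zero.2 (hpr i j).symm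
    rw [show r j - p i = -(p i - r j) by ring]
    field_simp
    ring
  rw [e1, e2]
  simp only [partialFraction]
  linear_combination e3

/-- A function with removable singularities at finitely many points of an open set extends
holomorphically across them. -/
theorem exists_differentiableOn_extension {V : Set ℂ} (hV : IsOpen V) (S : Finset ℂ) :
    ∀ {f : ℂ → ℂ}, ↑S ⊆ V → DifferentiableOn ℂ f (V \ ↑S) →
    (∀ s ∈ S, Tendsto (fun k => (k - s) * f k) (𝓝[≠] s) (𝓝 0)) →
    ∃ F : ℂ → ℂ, DifferentiableOn ℂ F V ∧ EqOn f F (V \ ↑S) := by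
  classical
  induction S using Finset.induction_on with
  | empty =>
    intro f _ hf _
    exact ⟨f, by simpa using hf, fun _ _ => rfl⟩
  | insert s S hs ih =>
    intro f hSV hf hlim
    rw [Finset.coe_insert, insert_subset_iff] at hSV
    set f' := Function.update f s (limUnder (𝓝[≠] s) f) with hf'
    have hnhds : (V \ (S : Set ℂ)) ∈ 𝓝 s :=
      (hV.sdiff S.finite_toSet.isClosed).mem_nhds ⟨hSV.1, by simpa using hs⟩
    have hd : DifferentiableOn ℂ f' (V \ ↑S) := by
      refine differentiableOn_update_limUnder_of_isLittleO hnhds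
        (hf.mono fun k hk => ⟨hk.1.1, ?_⟩) ?_
      · simp only [Finset.coe_insert, mem_insert_iff, not_or]
        exact ⟨hk.2, hk.1.2⟩
      · rw [Asymptotics.isLittleO_iff_tendsto']
        · have h1 : Tendsto (fun k => (k - s) * f s) (𝓝[≠] s) (𝓝 0) := by
            have : ContinuousAt (fun k => (k - s) * f s) s := by fun_prop
            simpa using this.tendsto.mono_left nhdsWithin_le_nhds
          have := (hlim s (Finset.mem_insert_self _ _)).sub h1
          rw [sub_zero] at this
          refine this.congr fun k => ?_
          rw [div_inv_eq_mul]
          ring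
        · filter_upwards [self_mem_nhdsWithin] with k hk h
          exact absurd (sub_eq_zero.1 (inv_eq_zero.1 h)) hk
    obtain ⟨F, hF, hFe⟩ := ih hSV.2 hd fun s' hs' => by
      refine (hlim s' (Finset.mem_insert_of_mem hs')).congr' ?_
      have hne : s' ≠ s := fun h => hs (h ▸ hs')
      filter_upwards [nhdsWithin_le_nhds (isOpen_ne.mem_nhds hne)] with k hk
      rw [hf', Function.update_of_ne hk]
    refine ⟨F, hF, fun k hk => ?_⟩
    obtain ⟨hkV, hk⟩ := hk
    simp only [Finset.coe_insert, mem_insert_iff, not_or] at hk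
    rw [← hFe ⟨hkV, hk.2⟩, hf', Function.update_of_ne hk.1]

/-- A function with finitely many simple poles and a limit at infinity is given by its partial
fraction decomposition. -/
theorem eq_partialFraction {f : ℂ → ℂ} {p : ι → ℂ} (hp : Function.Injective p) (hp0 : ∀ i, p i ≠ 0)
    {c g : ℂ} {R : ι → ℂ} (hf : DifferentiableOn ℂ f ({0} ∪ range p)ᶜ)
    (hzero : Tendsto (fun k => k * f k) (𝓝[≠] 0) (𝓝 g))
    (hres : ∀ i, Tendsto (fun k => (k - p i) * f k) (𝓝[≠] (p i)) (𝓝 (R i)))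
    (hinf : Tendsto f (Bornology.cobounded ℂ) (𝓝 c)) :
    EqOn f (partialFraction c g R p) ({0} ∪ range p)ᶜ := by
  classical
  set S : Finset ℂ := insert 0 (Finset.univ.image p) with hS
  have hSc : (S : Set ℂ) = {0} ∪ range p := by
    ext k
    simp [hS]
  have hmul0 : Tendsto (fun k => k * partialFraction c g R p k) (𝓝[≠] 0) (𝓝 g) := by
    have h : ContinuousAt (fun k => k * (c + ∑ i, R i / (k - p i)) + g) 0 := by
      refine ContinuousAt.add (continuousAt_id.mul
        (continuousAt_const.add (tendsto_finsetSum _ fun i _ => ?_))) continuousAt_const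
      refine ContinuousAt.div continuousAt_const (by fun_prop) ?_
      rw [zero_sub]; exact neg_ne_zero.2 (hp0 i)
    have h' := h.tendsto.mono_left (nhdsWithin_le_nhds (s := {0}ᶜ))
    simp only [zero_mul, zero_add] at h'
    refine h'.congr' ?_
    filter_upwards [self_mem_nhdsWithin] with k hk
    have : k ≠ 0 := hk
    simp only [partialFraction]
    field_simp
    ring
  -- All singularities of the difference are removable. Its extension is entire and tends to `0` at
  -- infinity, so Liouville's theorem applies.
  obtain ⟨F, hF, hFe⟩ := exists_differentiableOn_extension isOpen_univ S
    (f := fun k => f k - partialFraction c g R p k) (subset_univ _) (by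
      rw [hSc, ← compl_eq_univ_sdiff]
      refine hf.sub fun k hk => (differentiableAt_partialFraction c g (fun h => hk (Or.inl h))
        fun i => Or.inr fun h => hk (Or.inr ⟨i, h.symm⟩)).differentiableWithinAt) (by
      intro s hs
      simp only [mul_sub]
      rw [hS, Finset.mem_insert, Finset.mem_image] at hs
      rcases hs with rfl | ⟨i, -, rfl⟩
      · simpa using hzero.sub hmul0
      · simpa using (hres i).sub (tendsto_mul_partialFraction c g (P := R) hp i (hp0 i)))
  rw [← compl_eq_univ_sdiff] at hFe
  rw [differentiableOn_univ] at hF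
  have hpinf : Tendsto (partialFraction c g R p) (Bornology.cobounded ℂ) (𝓝 c) := by
    have := (isBigO_partialFraction_sub_cobounded c g R p).trans_tendsto tendsto_inv₀_cobounded
    simpa using this.add_const c
  have hFinf : Tendsto F (cocompact ℂ) (𝓝 0) := by
    rw [← Metric.cobounded_eq_cocompact]
    have h := hinf.sub hpinf
    rw [sub_self] at h
    refine h.congr' ?_
    have : ((S : Set ℂ)ᶜ) ∈ Bornology.cobounded ℂ := S.finite_toSet.isBounded
    filter_upwards [this] with k hk
    exact hFe hk
  intro k hk
  have h1 := hFe (hSc ▸ hk : k ∈ ((S : Set ℂ)ᶜ))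
  rw [hF.apply_eq_of_tendsto_cocompact k hFinf] at h1
  exact sub_eq_zero.1 h1
end

/-! ### The linear system of a row of the breather problem -/

/-- The residue relations of a row
`(a + g / k + ∑ P i / (k - η i), d + b / k + ∑ Q i / (k - conj (η i)))`. -/
def IsRow {ι : Type*} [Fintype ι] (η A : ι → ℂ) (a g d b : ℂ) (P Q : ι → ℂ) : Prop :=
  (∀ i, P i = A i * partialFraction d b Q (fun j => conj (η j)) (η i)) ∧
  ∀ i, Q i = -conj (A i) * partialFraction a g P η (conj (η i))

section
variable {ι : Type*} {η : ι → ℂ}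

theorem ne_zero_of_ne_conj (hη : ∀ i j, η i ≠ conj (η j)) (i : ι) : η i ≠ 0 := fun h =>
  hη i i (by rw [h, map_zero])

theorem conj_injective_comp (hinj : Function.Injective η) :
    Function.Injective fun i => conj (η i) :=
  fun _ _ h => hinj ((starRingEnd ℂ).injective h)

theorem im_ne_zero_of_ne_conj (hη : ∀ i j, η i ≠ conj (η j)) (i : ι) : (η i).im ≠ 0 := fun h =>
  hη i i (conj_eq_iff_im.2 h).symm

end

section
variable {ι : Type*} [Fintype ι] {η A : ι → ℂ}

/-- The squared norm of a row has no poles off the origin. -/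
theorem IsRow.norm_sq_eq (hη : ∀ i j, η i ≠ conj (η j)) {a g d b : ℂ} {P Q : ι → ℂ}
    (h : IsRow η A a g d b P Q) {k : ℂ} (hk : k ≠ 0) (hk1 : ∀ i, k ≠ η i)
    (hk2 : ∀ i, k ≠ conj (η i)) {X : ℂ}
    (hX : X = conj g * ∑ i, P i / η i + conj b * ∑ i, Q i / conj (η i)) :
    partialFraction a g P η k * conj (partialFraction a g P η (conj k)) +
      partialFraction d b Q (fun j => conj (η j)) k *
        conj (partialFraction d b Q (fun j => conj (η j)) (conj k)) =
    (a + g / k) * (conj a + conj g / k) + (d + b / k) * (conj d + conj b / k) -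
      (X + conj X) / k := by
  have h0 := ne_zero_of_ne_conj hη
  have h0' : ∀ i, conj (η i) ≠ 0 := fun i => (map_ne_zero _).2 (h0 i)
  have hη' : ∀ i j, conj (η i) ≠ η j := fun i j => (hη j i).symm
  rw [conj_partialFraction, conj_partialFraction, partialFraction_mul _ _ _ _ hη h0 h0' hk hk1 hk2]
  simp only [conj_conj]
  rw [partialFraction_mul _ _ _ _ hη' h0' h0 hk hk2 hk1]
  -- The residues of the two products at `η i` are opposite: `P i` is `A i` times the second entry
  -- at `η i`, and `conj (Q i)` is `-A i` times the conjugate of the first entry at `conj (η i)`.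
  have e1 : ∀ i, P i * partialFraction (conj a) (conj g) (fun i => conj (P i))
      (fun i => conj (η i)) (η i) / (k - η i) +
      conj (Q i) * partialFraction d b Q (fun j => conj (η j)) (η i) / (k - η i) = 0 := by
    intro i
    rw [h.2 i, map_mul, conj_partialFraction, h.1 i, map_neg, conj_conj]
    ring
  have e2 : ∀ i, conj (P i) * partialFraction a g P η (conj (η i)) / (k - conj (η i)) +
      Q i * partialFraction (conj d) (conj b) (fun i => conj (Q i)) η (conj (η i)) /
        (k - conj (η i)) = 0 := by
    intro i
    have := conj_partialFraction d b Q (fun j => conj (η j)) (conj (η i))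
    simp only [conj_conj] at this
    rw [← this, h.2 i, h.1 i, map_mul]
    ring
  have s1 := Finset.sum_eq_zero fun i (_ : i ∈ Finset.univ) => e1 i
  have s2 := Finset.sum_eq_zero fun i (_ : i ∈ Finset.univ) => e2 i
  rw [Finset.sum_add_distrib] at s1 s2
  have hX' : conj X = g * ∑ i, conj (P i) / conj (η i) + b * ∑ i, conj (Q i) / η i := by
    rw [hX]
    simp
  rw [hX', hX]
  linear_combination s1 + s2

/-- Vanishing lemma: with homogeneous data the norm identity on the real axis reads `|f|² + |g|² =
0`. -/
theorem IsRow.eq_zero (hinj : Function.Injective η) (hη : ∀ i j, η i ≠ conj (η j)) {P Q : ι → ℂ}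
    (h : IsRow η A 0 0 0 0 P Q) : P = 0 ∧ Q = 0 := by
  have hx : ∀ x : ℝ, x ≠ 0 → partialFraction 0 0 P η x = 0 ∧
      partialFraction 0 0 Q (fun j => conj (η j)) x = 0 := by
    intro x hx
    have him := im_ne_zero_of_ne_conj hη
    have := h.norm_sq_eq hη (k := x) (by exact_mod_cast hx)
      (fun i hi => him i (by rw [← hi, ofReal_im]))
      (fun i hi => him i (by
        have := congrArg im hi
        rw [ofReal_im, conj_im] at this
        linarith)) rfl
    simp only [conj_ofReal, mul_conj, map_zero, zero_div, add_zero, zero_mul, sub_zero] at this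
    have h2 : normSq (partialFraction 0 0 P η x) +
      normSq (partialFraction 0 0 Q (fun j => conj (η j)) x) = 0 := by exact_mod_cast this
    have n1 := normSq_nonneg (partialFraction 0 0 P η x)
    have n2 := normSq_nonneg (partialFraction 0 0 Q (fun j => conj (η j)) x)
    exact ⟨normSq_eq_zero.1 (by linarith), normSq_eq_zero.1 (by linarith)⟩
  refine ⟨eq_zero_of_partialFraction_eq_zero hinj (im_ne_zero_of_ne_conj hη)
      fun x h0 => (hx x h0).1,
    eq_zero_of_partialFraction_eq_zero (conj_injective_comp hinj) (fun i => ?_)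
      fun x h0 => (hx x h0).2⟩
  rw [conj_im]
  exact neg_ne_zero.2 (im_ne_zero_of_ne_conj hη i)

theorem partialFraction_sub (a g a' g' : ℂ) (P P' p : ι → ℂ) (k : ℂ) :
    partialFraction a g P p k - partialFraction a' g' P' p k =
      partialFraction (a - a') (g - g') (P - P') p k := by
  simp only [partialFraction, Pi.sub_apply, sub_div, Finset.sum_sub_distrib]
  ring

theorem IsRow.sub {a g d b a' g' d' b' : ℂ} {P Q P' Q' : ι → ℂ} (h : IsRow η A a g d b P Q)
    (h' : IsRow η A a' g' d' b' P' Q') :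
    IsRow η A (a - a') (g - g') (d - d') (b - b') (P - P') (Q - Q') := by
  refine ⟨fun i => ?_, fun i => ?_⟩
  · rw [Pi.sub_apply, h.1, h'.1, ← partialFraction_sub, mul_sub]
  · rw [Pi.sub_apply, h.2, h'.2, ← partialFraction_sub, mul_sub]

theorem IsRow.unique (hinj : Function.Injective η) (hη : ∀ i j, η i ≠ conj (η j))
    {a g d b : ℂ} {P Q P' Q' : ι → ℂ} (h : IsRow η A a g d b P Q)
    (h' : IsRow η A a g d b P' Q') : P = P' ∧ Q = Q' := by
  have := h.sub h'
  simp only [sub_self] at this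
  exact (this.eq_zero hinj hη).imp sub_eq_zero.1 sub_eq_zero.1

/-- The system is square, so the vanishing lemma gives existence as well. The constants and the
`1/k` terms form its right-hand side. -/
theorem exists_isRow (hinj : Function.Injective η) (hη : ∀ i j, η i ≠ conj (η j))
    (a g d b : ℂ) : ∃ P Q, IsRow η A a g d b P Q := by
  let T : (ι → ℂ) × (ι → ℂ) →ₗ[ℂ] (ι → ℂ) × (ι → ℂ) :=
    { toFun := fun v => (fun i => v.1 i - A i * ∑ j, v.2 j / (η i - conj (η j)),
        fun i => v.2 i + conj (A i) * ∑ j, v.1 j / (conj (η i) - η j))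
      map_add' := fun v w => by
        refine Prod.ext ?_ ?_ <;> funext i <;>
          simp only [Prod.fst_add, Prod.snd_add, Pi.add_apply, add_div, Finset.sum_add_distrib] <;>
          ring
      map_smul' := fun c v => by
        refine Prod.ext ?_ ?_ <;> funext i <;>
          simp only [Prod.smul_fst, Prod.smul_snd, Pi.smul_apply, smul_eq_mul, mul_div_assoc,
            ← Finset.mul_sum, RingHom.id_apply] <;>
          ring }
  have hT : ∀ v, T v = (fun i => v.1 i - A i * ∑ j, v.2 j / (η i - conj (η j)),
        fun i => v.2 i + conj (A i) * ∑ j, v.1 j / (conj (η i) - η j)) := fun v => rfl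
  have hTinj : Function.Injective T := by
    rw [injective_iff_map_eq_zero]
    intro v hv
    rw [hT, Prod.ext_iff] at hv
    have hrow : IsRow η A 0 0 0 0 v.1 v.2 := by
      refine ⟨fun i => ?_, fun i => ?_⟩
      · have := congrFun hv.1 i
        simp only [partialFraction, zero_div, zero_add]
        exact sub_eq_zero.1 this
      · have := congrFun hv.2 i
        simp only [partialFraction, zero_div, zero_add]
        rw [neg_mul]
        exact eq_neg_of_add_eq_zero_left this
    exact Prod.ext (hrow.eq_zero hinj hη).1 (hrow.eq_zero hinj hη).2
  obtain ⟨⟨P, Q⟩, hPQ⟩ := LinearMap.injective_iff_surjective.1 hTinj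
    (fun i => A i * (d + b / η i), fun i => -conj (A i) * (a + g / conj (η i)))
  rw [hT, Prod.ext_iff] at hPQ
  refine ⟨P, Q, fun i => ?_, fun i => ?_⟩
  · have := congrFun hPQ.1 i
    simp only at this
    rw [partialFraction]
    linear_combination this
  · have := congrFun hPQ.2 i
    simp only at this
    rw [partialFraction]
    linear_combination this

/-- Symmetry `(f, g) ↦ (-g(k*)*, f(k*)*)`, which turns a first row of the breather matrix into a
second row. -/
theorem IsRow.conj_swap {a g d b : ℂ} {P Q : ι → ℂ} (h : IsRow η A a g d b P Q) :
    IsRow η A (-conj d) (-conj b) (conj a) (conj g) (fun i => -conj (Q i))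
      (fun i => conj (P i)) := by
  refine ⟨fun i => ?_, fun i => ?_⟩
  · change -conj (Q i) = _
    rw [← conj_partialFraction a g P η, h.2 i, map_mul, map_neg, conj_conj]
    ring
  · have := conj_partialFraction d b Q (fun j => conj (η j)) (conj (η i))
    simp only [conj_conj] at this
    change conj (P i) = _
    rw [← neg_partialFraction, ← this, h.1 i, map_mul]
    ring

/-- The entries of a row do not vanish simultaneously at `η m` and `conj (η m)`. -/
theorem IsRow.ne_zero (hinj : Function.Injective η) (hη : ∀ i j, η i ≠ conj (η j)) {q : ℂ}
    {P Q : ι → ℂ} (h : IsRow η A 1 0 0 q P Q) {m : ι} (hm : ‖η m‖ ≠ ‖q‖) :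
    ¬(partialFraction 0 q Q (fun j => conj (η j)) (η m) = 0 ∧
      partialFraction 1 0 P η (conj (η m)) = 0) := by
  rintro ⟨h2, h1⟩
  have h0 := ne_zero_of_ne_conj hη m
  have him := im_ne_zero_of_ne_conj hη m
  -- Both residues at the index `m` vanish, so all four factors in the norm identity are continuous
  -- at `η m`, and each product contains a factor that is zero there.
  have hP : P m = 0 := by rw [h.1, h2, mul_zero]
  have hQ : Q m = 0 := by rw [h.2, h1, mul_zero]
  have c1 : ContinuousAt (partialFraction 1 0 P η) (η m) :=
    (differentiableAt_partialFraction _ _ h0 fun i => by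
      rcases eq_or_ne i m with rfl | hi
      · exact Or.inl hP
      · exact Or.inr fun h => hi (hinj h.symm)).continuousAt
  have c2 : ContinuousAt (partialFraction 0 q Q fun j => conj (η j)) (η m) :=
    (differentiableAt_partialFraction _ _ h0 fun i => Or.inr (hη m i)).continuousAt
  have c1' : ContinuousAt (fun k => conj (partialFraction 1 0 P η (conj k))) (η m) := by
    simp only [conj_partialFraction]
    exact (differentiableAt_partialFraction _ _ h0 fun i => Or.inr (hη m i)).continuousAt
  have c2' : ContinuousAt (fun k => conj (partialFraction 0 q Q (fun j => conj (η j)) (conj k)))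
      (η m) := by
    simp only [conj_partialFraction, conj_conj]
    refine (differentiableAt_partialFraction _ _ h0 fun i => ?_).continuousAt
    rcases eq_or_ne i m with rfl | hi
    · left; rw [hQ, map_zero]
    · exact Or.inr fun h => hi (hinj h.symm)
  have hlim := ((c1.mul c1').add (c2.mul c2')).tendsto.mono_left (nhdsWithin_le_nhds (s := {η m}ᶜ))
  set X := conj (0 : ℂ) * ∑ i, P i / η i + conj q * ∑ i, Q i / conj (η i) with hX
  have c3 : ContinuousAt (fun k => (1 + 0 / k) * (conj 1 + conj 0 / k) +
      (0 + q / k) * (conj 0 + conj q / k) - (X + conj X) / k) (η m) := by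
    fun_prop (disch := assumption)
  have hlim' := c3.tendsto.mono_left (nhdsWithin_le_nhds (s := {η m}ᶜ))
  have hev : ∀ᶠ k in 𝓝[≠] (η m), k ≠ 0 ∧ (∀ i, k ≠ η i) ∧ ∀ i, k ≠ conj (η i) := by
    refine Filter.Eventually.and (nhdsWithin_le_nhds (isOpen_ne.mem_nhds h0))
      (Filter.Eventually.and ?_ ?_)
    · refine eventually_all.2 fun i => ?_
      rcases eq_or_ne i m with rfl | hi
      · exact self_mem_nhdsWithin
      · exact nhdsWithin_le_nhds (isOpen_ne.mem_nhds fun h => hi (hinj h.symm))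
    · exact eventually_all.2 fun i => nhdsWithin_le_nhds (isOpen_ne.mem_nhds (hη m i))
  have heq := tendsto_nhds_unique hlim (hlim'.congr' (by
    filter_upwards [hev] with k hk
    exact (h.norm_sq_eq hη hk.1 hk.2.1 hk.2.2 hX).symm))
  simp only [Pi.add_apply, Pi.mul_apply, h1, h2, map_zero, mul_zero, zero_mul, add_zero, zero_div,
    map_one, mul_one,
    zero_add] at heq
  obtain ⟨x, hx⟩ : ∃ x : ℝ, X + conj X = x := ⟨_, add_conj X⟩
  rw [hx, div_mul_div_comm, mul_conj] at heq
  set z := η m with hz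
  -- The right-hand side of the norm identity must vanish at `z`, which gives a quadratic equation
  -- with real coefficients. Its nonreal roots are conjugate to each other with product `|q|²`, so
  -- `|z| = |q|`.
  have hpoly : z * z - x * z + normSq q = 0 := by
    field_simp at heq
    linear_combination -heq
  have hre := congrArg re hpoly
  have him' := congrArg im hpoly
  simp at hre him'
  have hx2 : x = 2 * z.re := by
    have : z.im * (2 * z.re - x) = 0 := by linear_combination him'
    rcases mul_eq_zero.1 this with h | h
    · exact absurd h him
    · linarith
  have hn : normSq z = normSq q := by
    rw [normSq_apply z]
    rw [hx2] at hre
    linear_combination -hre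
  apply hm
  rw [← Real.sqrt_sq (norm_nonneg z), ← Real.sqrt_sq (norm_nonneg q), ← normSq_eq_norm_sq,
    ← normSq_eq_norm_sq, hn]
end

/-! ### Solutions of the breather problem -/

/-- The singular set of the breather problem. -/
def poleSet {ι : Type*} (η : ι → ℂ) : Set ℂ := {0} ∪ (range η ∪ range fun i => conj (η i))

/-- The residue condition without the requirement that the pole be a genuine one. -/
def HasWeakResidue (M : ℂ → Mat) (p : ℂ) (N : Mat) : Prop :=
  ∃ R : Mat, Tendsto (fun k => (k - p) • M k) (𝓝[≠] p) (𝓝 R) ∧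
    Tendsto (fun k => M k * N) (𝓝[≠] p) (𝓝 R)

/-- The breather problem with lower triangular residues at `η i` and upper triangular ones at
`conj (η i)`. -/
structure IsResidueRHP {ι : Type*} (qm : ℂ) (η A : ι → ℂ) (M : ℂ → Mat) : Prop where
  analytic : ∀ i j, DifferentiableOn ℂ (fun k => M k i j) (poleSet η)ᶜ
  normalized : IsNormalized qm M
  lower : ∀ m, HasWeakResidue M (η m) !![0, 0; A m, 0]
  upper : ∀ m, HasWeakResidue M (conj (η m)) !![0, -conj (A m); 0, 0]

section
variable {ι : Type*} [Fintype ι]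

/-- The residues `P`, `Q` of a matrix solution satisfy the linear system of the breather problem. -/
def IsSolution (qm : ℂ) (η A : ι → ℂ) (P Q : Fin 2 → ι → ℂ) : Prop :=
  ∀ i, IsRow η A ((1 : Mat) i 0) (I * (sigma3 * Qminus qm) i 0) ((1 : Mat) i 1)
    (I * (sigma3 * Qminus qm) i 1) (P i) (Q i)

/-- The matrix with the residues `P`, `Q`. -/
def rowMatrix (qm : ℂ) (η : ι → ℂ) (P Q : Fin 2 → ι → ℂ) (k : ℂ) : Mat :=
  Matrix.of fun i j => ![partialFraction ((1 : Mat) i 0) (I * (sigma3 * Qminus qm) i 0) (P i) η k,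
    partialFraction ((1 : Mat) i 1) (I * (sigma3 * Qminus qm) i 1) (Q i)
      (fun m => conj (η m)) k] j

variable {qm : ℂ} {η A : ι → ℂ}

theorem rowMatrix_apply_zero (P Q : Fin 2 → ι → ℂ) (k : ℂ) (i : Fin 2) :
    rowMatrix qm η P Q k i 0 =
      partialFraction ((1 : Mat) i 0) (I * (sigma3 * Qminus qm) i 0) (P i) η k := rfl

theorem rowMatrix_apply_one (P Q : Fin 2 → ι → ℂ) (k : ℂ) (i : Fin 2) :
    rowMatrix qm η P Q k i 1 =
      partialFraction ((1 : Mat) i 1) (I * (sigma3 * Qminus qm) i 1) (Q i)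
        (fun m => conj (η m)) k := rfl

theorem eventually_notMem_poleSet (η : ι → ℂ) (p : ℂ) : ∀ᶠ k in 𝓝[≠] p, k ∉ poleSet η := by
  have hfin : (poleSet η \ {p}).Finite :=
    ((finite_singleton 0).union ((finite_range _).union (finite_range _))).subset sdiff_subset
  have := hfin.isClosed.isOpen_compl.mem_nhds (x := p) fun h => h.2 rfl
  filter_upwards [nhdsWithin_le_nhds this, self_mem_nhdsWithin] with k hk hk' hkr
  exact hk ⟨hkr, hk'⟩

theorem tendsto_mat_iff {l : Filter ℂ} {M : ℂ → Mat} {R : Mat} :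
    Tendsto M l (𝓝 R) ↔ ∀ i j, Tendsto (fun k => M k i j) l (𝓝 (R i j)) :=
  tendsto_pi_nhds.trans (forall_congr' fun _ => tendsto_pi_nhds)

theorem IsNormalized.tendsto_infty {M : ℂ → Mat} (h : IsNormalized qm M) (i j : Fin 2) :
    Tendsto (fun k => M k i j) (Bornology.cobounded ℂ) (𝓝 ((1 : Mat) i j)) := by
  have := (h.at_infty i j).trans_tendsto tendsto_inv₀_cobounded
  simpa using this.add_const ((1 : Mat) i j)

theorem IsNormalized.tendsto_zero {M : ℂ → Mat} (h : IsNormalized qm M) (i j : Fin 2) :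
    Tendsto (fun k => k * M k i j) (𝓝[≠] 0) (𝓝 (I * (sigma3 * Qminus qm) i j)) := by
  have h1 : Tendsto (fun k : ℂ => k) (𝓝[≠] 0) (𝓝 0) :=
    tendsto_id.mono_left nhdsWithin_le_nhds
  have h2 := (((Asymptotics.isBigO_refl (fun k : ℂ => k) (𝓝[≠] 0)).mul (h.at_zero i j)).congr_right
    fun k => mul_one k).trans_tendsto h1
  have h3 := h2.add_const (I * (sigma3 * Qminus qm) i j)
  rw [zero_add] at h3
  refine h3.congr' ?_
  filter_upwards [self_mem_nhdsWithin] with k hk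
  have : k ≠ 0 := hk
  field_simp
  ring

/-- A matrix entry may a priori have poles at both families `η i` and `conj (η i)`; this drops the
family whose residues turn out to be zero. -/
theorem partialFraction_elim_right (a g : ℂ) (P p r : ι → ℂ) (k : ℂ) :
    partialFraction a g (Sum.elim P (0 : ι → ℂ)) (Sum.elim p r) k = partialFraction a g P p k := by
  simp [partialFraction]

theorem partialFraction_elim_left (a g : ℂ) (P p r : ι → ℂ) (k : ℂ) :
    partialFraction a g (Sum.elim (0 : ι → ℂ) P) (Sum.elim r p) k = partialFraction a g P p k := by
  simp [partialFraction]

/-- Liouville's theorem makes every entry a partial fraction. At each pole, one column of the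
residue relation says that one column of `M` is regular, and the other column is an equation of the
linear system. -/
theorem IsResidueRHP.exists_eq_rowMatrix (hinj : Function.Injective η)
    (hη : ∀ i j, η i ≠ conj (η j)) {M : ℂ → Mat} (h : IsResidueRHP qm η A M) :
    ∃ P Q, IsSolution qm η A P Q ∧ EqOn M (rowMatrix qm η P Q) (poleSet η)ᶜ := by
  choose Rl hl hl' using h.lower
  choose Ru hu hu' using h.upper
  set p : ι ⊕ ι → ℂ := Sum.elim η fun m => conj (η m) with hp
  have hpinj : Function.Injective p := by
    refine hinj.sumElim (conj_injective_comp hinj) fun a b => hη a b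
  have hp0 : ∀ m, p m ≠ 0 := by
    rintro (m | m)
    · exact ne_zero_of_ne_conj hη m
    · exact (map_ne_zero _).2 (ne_zero_of_ne_conj hη m)
  have hset : ({0} ∪ range p : Set ℂ) = poleSet η := by
    rw [hp, Sum.elim_range, poleSet]
  have hpf : ∀ i j, EqOn (fun k => M k i j) (partialFraction ((1 : Mat) i j)
      (I * (sigma3 * Qminus qm) i j) (Sum.elim (fun m => Rl m i j) fun m => Ru m i j) p)
      (poleSet η)ᶜ := by
    intro i j
    rw [← hset]
    refine eq_partialFraction hpinj hp0 (hset ▸ h.analytic i j) (h.normalized.tendsto_zero i j) ?_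
      (h.normalized.tendsto_infty i j)
    rintro (m | m)
    · exact tendsto_mat_iff.1 (hl m) i j
    · exact tendsto_mat_iff.1 (hu m) i j
  -- The residue matrix is strictly lower triangular, so the second column of `M k * N` is
  -- identically zero.
  have z1 : ∀ i m, Rl m i 1 = 0 := fun i m => by
    refine tendsto_nhds_unique (tendsto_mat_iff.1 (hl' m) i 1)
      (tendsto_const_nhds.congr fun k => ?_)
    simp [Matrix.mul_apply, Fin.sum_univ_two]
  have z0 : ∀ i m, Ru m i 0 = 0 := fun i m => by
    refine tendsto_nhds_unique (tendsto_mat_iff.1 (hu' m) i 0)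
      (tendsto_const_nhds.congr fun k => ?_)
    simp [Matrix.mul_apply, Fin.sum_univ_two]
  have heq : EqOn M (rowMatrix qm η (fun i m => Rl m i 0) fun i m => Ru m i 1) (poleSet η)ᶜ := by
    intro k hk
    ext i j
    fin_cases j
    · refine (hpf i 0 hk).trans ?_
      simp only [z0]
      exact partialFraction_elim_right _ _ _ _ _ _
    · refine (hpf i 1 hk).trans ?_
      simp only [z1]
      exact partialFraction_elim_left _ _ _ _ _ _
  refine ⟨fun i m => Rl m i 0, fun i m => Ru m i 1, fun i => ⟨fun m => ?_, fun m => ?_⟩, heq⟩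
  · have h1 := tendsto_mat_iff.1 (hl' m) i 0
    simp only [Matrix.mul_apply, Fin.sum_univ_two] at h1
    have h2 : Tendsto (fun k => M k i 1 * A m) (𝓝[≠] (η m)) (𝓝 (Rl m i 0)) := by
      simpa using h1
    have h3 := ((differentiableAt_partialFraction ((1 : Mat) i 1) (I * (sigma3 * Qminus qm) i 1)
      (P := fun m => Ru m i 1) (p := fun m => conj (η m)) (ne_zero_of_ne_conj hη m)
      fun j => Or.inr (hη m j)).continuousAt.tendsto.mono_left
        (nhdsWithin_le_nhds (s := {η m}ᶜ))).mul_const (A m)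
    rw [mul_comm]
    refine tendsto_nhds_unique h2 (h3.congr' ?_)
    filter_upwards [eventually_notMem_poleSet η (η m)] with k hk
    rw [heq hk, rowMatrix_apply_one]
  · have h1 := tendsto_mat_iff.1 (hu' m) i 1
    simp only [Matrix.mul_apply, Fin.sum_univ_two] at h1
    have h2 : Tendsto (fun k => M k i 0 * -conj (A m)) (𝓝[≠] (conj (η m))) (𝓝 (Ru m i 1)) := by
      simpa using h1
    have h3 := ((differentiableAt_partialFraction ((1 : Mat) i 0) (I * (sigma3 * Qminus qm) i 0)
      (P := fun m => Rl m i 0) (p := η) (k := conj (η m))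
      ((map_ne_zero _).2 (ne_zero_of_ne_conj hη m))
      fun j => Or.inr (hη j m).symm).continuousAt.tendsto.mono_left
        (nhdsWithin_le_nhds (s := {conj (η m)}ᶜ))).mul_const (-conj (A m))
    rw [mul_comm]
    refine tendsto_nhds_unique h2 (h3.congr' ?_)
    filter_upwards [eventually_notMem_poleSet η (conj (η m))] with k hk
    rw [heq hk, rowMatrix_apply_zero]

theorem IsResidueRHP.eqOn (hinj : Function.Injective η) (hη : ∀ i j, η i ≠ conj (η j))
    {M M' : ℂ → Mat} (h : IsResidueRHP qm η A M) (h' : IsResidueRHP qm η A M') :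
    EqOn M M' (poleSet η)ᶜ := by
  obtain ⟨P, Q, hs, he⟩ := h.exists_eq_rowMatrix hinj hη
  obtain ⟨P', Q', hs', he'⟩ := h'.exists_eq_rowMatrix hinj hη
  have hP : P = P' := funext fun i => ((hs i).unique hinj hη (hs' i)).1
  have hQ : Q = Q' := funext fun i => ((hs i).unique hinj hη (hs' i)).2
  subst hP hQ
  exact fun k hk => (he hk).trans (he' hk).symm

/-- The first row solves the linear system and the second is its image under `IsRow.conj_swap`. The
two nonvanishing statements are what makes the poles genuine. -/
theorem exists_isSolution (hinj : Function.Injective η) (hη : ∀ i j, η i ≠ conj (η j))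
    (hq : ∀ m, ‖η m‖ ≠ ‖qm‖) : ∃ P Q, IsSolution qm η A P Q ∧
      (∀ m, ∃ i, rowMatrix qm η P Q (η m) i 1 ≠ 0) ∧
      ∀ m, ∃ i, rowMatrix qm η P Q (conj (η m)) i 0 ≠ 0 := by
  obtain ⟨P, Q, h⟩ := exists_isRow (A := A) hinj hη 1 0 0 (I * qm)
  have hS : ∀ i j, (sigma3 * Qminus qm) i j = (!![0, qm; conj qm, 0] : Mat) i j := by
    intro i j
    fin_cases i <;> fin_cases j <;> simp [sigma3, Qminus]
  have hne : ∀ m, _ := fun m => h.ne_zero hinj hη (m := m) (by simpa using hq m)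
  have hr := h.conj_swap
  have f1 : ∀ m, partialFraction 1 0 (fun i => conj (P i)) (fun i => conj (η i)) (η m) =
      conj (partialFraction 1 0 P η (conj (η m))) := fun m => by
    rw [conj_partialFraction, map_one, map_zero]
  have f2 : ∀ m, partialFraction 0 (I * conj qm) (fun i => -conj (Q i)) η (conj (η m)) =
      -conj (partialFraction 0 (I * qm) Q (fun i => conj (η i)) (η m)) := fun m => by
    have := conj_partialFraction 0 (I * qm) Q (fun j => conj (η j)) (conj (η m))
    simp only [conj_conj] at this
    rw [this, neg_partialFraction]
    simp
  refine ⟨![P, fun i => -conj (Q i)], ![Q, fun i => conj (P i)],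
    Fin.forall_fin_two.2 ⟨?_, ?_⟩, fun m => ?_, fun m => ?_⟩
  · simpa [hS] using h
  · simpa [hS] using hr
  -- By the symmetry of the rows, the two entries of this column are the two numbers that cannot
  -- both vanish by `IsRow.ne_zero`, one of them conjugated.
  · by_contra! hc
    have c0 := hc 0
    have c1 := hc 1
    rw [rowMatrix_apply_one] at c0 c1
    simp only [hS] at c0 c1
    simp [f1] at c0 c1
    exact hne m ⟨c0, c1⟩
  · by_contra! hc
    have c0 := hc 0
    have c1 := hc 1
    rw [rowMatrix_apply_zero] at c0 c1
    simp only [hS] at c0 c1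
    simp [f2] at c0 c1
    exact hne m ⟨c1, c0⟩

section
variable {P Q : Fin 2 → ι → ℂ}

theorem differentiableAt_rowMatrix {k : ℂ} (hk : k ∉ poleSet η) (i j : Fin 2) :
    DifferentiableAt ℂ (fun k => rowMatrix qm η P Q k i j) k := by
  have h0 : k ≠ 0 := fun h => hk (Or.inl h)
  fin_cases j
  · exact differentiableAt_partialFraction _ _ h0 fun m => Or.inr fun h =>
      hk (Or.inr (Or.inl ⟨m, h.symm⟩))
  · exact differentiableAt_partialFraction _ _ h0 fun m => Or.inr fun h =>
      hk (Or.inr (Or.inr ⟨m, h.symm⟩))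

theorem isNormalized_rowMatrix (hη : ∀ i j, η i ≠ conj (η j)) :
    IsNormalized qm (rowMatrix qm η P Q) := by
  have h0 := ne_zero_of_ne_conj hη
  have h0' : ∀ i, conj (η i) ≠ 0 := fun i => (map_ne_zero _).2 (h0 i)
  refine ⟨fun i j => ?_, fun i j => ?_⟩
  · fin_cases j <;> exact isBigO_partialFraction_sub_cobounded _ _ _ _
  · simp only [div_mul_eq_mul_div]
    fin_cases j
    · exact isBigO_partialFraction_sub_zero _ _ h0
    · exact isBigO_partialFraction_sub_zero _ _ h0'

theorem recovers_rowMatrix :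
    Recovers (rowMatrix qm η P Q) (-I * (I * (sigma3 * Qminus qm) 0 1 + ∑ m, Q 0 m)) := by
  have := (tendsto_mul_partialFraction_sub_cobounded ((1 : Mat) 0 1)
    (I * (sigma3 * Qminus qm) 0 1) (Q 0) fun m => conj (η m)).const_mul (-I)
  refine this.congr fun k => ?_
  rw [rowMatrix_apply_one]
  simp

/-- The linear system is the residue relation itself. The residue is nonzero because it is `A m`
times the second column at `η m`. -/
theorem IsSolution.lower (hinj : Function.Injective η) (hη : ∀ i j, η i ≠ conj (η j))
    (h : IsSolution qm η A P Q) {m : ι} (hne : ∃ i, rowMatrix qm η P Q (η m) i 1 ≠ 0) :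
    HasResidueCondition (rowMatrix qm η P Q) (η m) !![0, 0; A m, 0] := by
  have h0 := ne_zero_of_ne_conj hη m
  have hc : ∀ i, Tendsto (fun k => rowMatrix qm η P Q k i 1) (𝓝[≠] (η m))
      (𝓝 (rowMatrix qm η P Q (η m) i 1)) := fun i =>
    (differentiableAt_partialFraction _ _ h0
      fun j => Or.inr (hη m j)).continuousAt.tendsto.mono_left
      nhdsWithin_le_nhds
  have hid : Tendsto (fun k => k - η m) (𝓝[≠] (η m)) (𝓝 0) := by
    have : ContinuousAt (fun k => k - η m) (η m) := by fun_prop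
    simpa using this.tendsto.mono_left (nhdsWithin_le_nhds (s := {η m}ᶜ))
  refine ⟨Matrix.of fun i j => ![P i m, 0] j, tendsto_mat_iff.2 fun i j => ?_,
    tendsto_mat_iff.2 fun i j => ?_, fun hN hR => ?_⟩
  · fin_cases j
    · exact tendsto_mul_partialFraction _ _ hinj m h0
    · simpa using hid.mul (hc i)
  · simp only [Matrix.mul_apply, Fin.sum_univ_two]
    fin_cases j
    · have := (hc i).mul_const (A m)
      rw [mul_comm, rowMatrix_apply_one, ← (h i).1 m] at this
      simpa using this
    · simp
  · obtain ⟨i, hi⟩ := hne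
    have hA : A m ≠ 0 := by
      rintro hA
      apply hN
      ext a b
      fin_cases a <;> fin_cases b <;> simp [hA]
    have hPi : P i m = 0 := congrFun (congrFun hR i) 0
    rw [(h i).1 m, ← rowMatrix_apply_one (P := P)] at hPi
    exact (mul_ne_zero hA hi) hPi

theorem IsSolution.upper (hinj : Function.Injective η) (hη : ∀ i j, η i ≠ conj (η j))
    (h : IsSolution qm η A P Q) {m : ι} (hne : ∃ i, rowMatrix qm η P Q (conj (η m)) i 0 ≠ 0) :
    HasResidueCondition (rowMatrix qm η P Q) (conj (η m)) !![0, -conj (A m); 0, 0] := by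
  have h0 : conj (η m) ≠ 0 := (map_ne_zero _).2 (ne_zero_of_ne_conj hη m)
  have hc : ∀ i, Tendsto (fun k => rowMatrix qm η P Q k i 0) (𝓝[≠] (conj (η m)))
      (𝓝 (rowMatrix qm η P Q (conj (η m)) i 0)) := fun i =>
    (differentiableAt_partialFraction _ _ h0 fun j =>
      Or.inr (hη j m).symm).continuousAt.tendsto.mono_left nhdsWithin_le_nhds
  have hid : Tendsto (fun k => k - conj (η m)) (𝓝[≠] (conj (η m))) (𝓝 0) := by
    have : ContinuousAt (fun k => k - conj (η m)) (conj (η m)) := by fun_prop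
    simpa using this.tendsto.mono_left (nhdsWithin_le_nhds (s := {conj (η m)}ᶜ))
  refine ⟨Matrix.of fun i j => ![0, Q i m] j, tendsto_mat_iff.2 fun i j => ?_,
    tendsto_mat_iff.2 fun i j => ?_, fun hN hR => ?_⟩
  · fin_cases j
    · simpa using hid.mul (hc i)
    · exact tendsto_mul_partialFraction _ _ (conj_injective_comp hinj) m h0
  · simp only [Matrix.mul_apply, Fin.sum_univ_two]
    fin_cases j
    · simp
    · have := (hc i).mul_const (-conj (A m))
      rw [mul_comm, rowMatrix_apply_zero, ← (h i).2 m] at this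
      simpa using this
  · obtain ⟨i, hi⟩ := hne
    have hA : -conj (A m) ≠ 0 := by
      rintro hA
      apply hN
      ext a b
      fin_cases a <;> fin_cases b <;> simp [hA]
    have hQi : Q i m = 0 := congrFun (congrFun hR i) 1
    rw [(h i).2 m, ← rowMatrix_apply_zero (Q := Q)] at hQi
    exact (mul_ne_zero hA hi) hQi
end
end

/-! ### Riemann-Hilbert problems with nilpotent jumps across contours -/

/-- All entries of `M` are complex differentiable at `k`. -/
def EntrywiseDifferentiableAt (M : ℂ → Mat) (k : ℂ) : Prop :=
  ∀ i j, DifferentiableAt ℂ (fun k => M k i j) k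

theorem EntrywiseDifferentiableAt.continuousAt {M : ℂ → Mat} {k : ℂ}
    (h : EntrywiseDifferentiableAt M k) : ContinuousAt M k :=
  tendsto_mat_iff.2 fun i j => (h i j).continuousAt

theorem EntrywiseDifferentiableAt.mul {M N : ℂ → Mat} {k : ℂ}
    (h : EntrywiseDifferentiableAt M k) (h' : EntrywiseDifferentiableAt N k) :
    EntrywiseDifferentiableAt (fun k => M k * N k) k := by
  intro i j
  simp only [Matrix.mul_apply, Fin.sum_univ_two]
  exact ((h i 0).mul (h' 0 j)).add ((h i 1).mul (h' 1 j))

theorem EntrywiseDifferentiableAt.congr_of_eventuallyEq {M N : ℂ → Mat} {k : ℂ}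
    (h : EntrywiseDifferentiableAt M k) (h' : N =ᶠ[𝓝 k] M) : EntrywiseDifferentiableAt N k :=
  fun i j => (h i j).congr_of_eventuallyEq (h'.mono fun _ hz => congrFun (congrFun hz i) j)

theorem entrywiseDifferentiableAt_one_add_smul {n : ℂ → ℂ} {k : ℂ} (h : DifferentiableAt ℂ n k)
    (U : Mat) : EntrywiseDifferentiableAt (fun k => 1 + n k • U) k := by
  intro i j
  simp only [Matrix.add_apply, Matrix.smul_apply, smul_eq_mul]
  fun_prop

theorem entrywiseDifferentiableAt_one_sub_smul {n : ℂ → ℂ} {k : ℂ} (h : DifferentiableAt ℂ n k)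
    (U : Mat) : EntrywiseDifferentiableAt (fun k => 1 - n k • U) k := by
  intro i j
  simp only [Matrix.sub_apply, Matrix.smul_apply, smul_eq_mul]
  fun_prop

theorem one_sub_mul_one_add {U : Mat} (hU : U * U = 0) (c : ℂ) : (1 - c • U) * (1 + c • U) = 1 := by
  have : (c • U) * (c • U) = 0 := by rw [Matrix.smul_mul, Matrix.mul_smul, hU, smul_zero, smul_zero]
  rw [mul_add, mul_one, sub_mul, one_mul, this, sub_zero, sub_add_cancel]

theorem one_add_mul_one_sub {U : Mat} (hU : U * U = 0) (c : ℂ) : (1 + c • U) * (1 - c • U) = 1 := by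
  have := one_sub_mul_one_add hU (-c)
  simpa [sub_eq_add_neg] using this

/-- `M` has continuous boundary values `Mi` from inside and `Mo` from outside `D`, and
`Mo = Mi (1 + n U)`. -/
def HasNilpotentJump (M : ℂ → Mat) (D : Set ℂ) (n : ℂ → ℂ) (U : Mat) : Prop :=
  ∃ Mi Mo : ℂ → Mat, ContinuousOn Mi (frontier D) ∧ ContinuousOn Mo (frontier D) ∧
    ∀ ζ ∈ frontier D, Tendsto M (𝓝[D] ζ) (𝓝 (Mi ζ)) ∧
      Tendsto M (𝓝[(closure D)ᶜ] ζ) (𝓝 (Mo ζ)) ∧ Mo ζ = Mi ζ * (1 + n ζ • U)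

/-- The inside is the left of a counterclockwise contour, so `Mi = Mo (1 - n U)`, and `1 + n U` is
the inverse factor. Both orientations thus lead to the same relation from inside to outside. -/
theorem hasJumpCCW_iff {M V : ℂ → Mat} {D : Set ℂ} {n : ℂ → ℂ} {U : Mat} (hU : U * U = 0)
    (hV : ∀ ζ ∈ frontier D, V ζ = 1 - n ζ • U) :
    HasJumpCCW M D V ↔ HasNilpotentJump M D n U := by
  constructor
  · rintro ⟨Mp, Mm, hp, hm, h⟩
    refine ⟨Mp, Mm, hp, hm, fun ζ hζ => ⟨(h ζ hζ).1, (h ζ hζ).2.1, ?_⟩⟩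
    rw [(h ζ hζ).2.2, hV ζ hζ, mul_assoc, one_sub_mul_one_add hU, mul_one]
  · rintro ⟨Mi, Mo, hi, ho, h⟩
    refine ⟨Mi, Mo, hi, ho, fun ζ hζ => ⟨(h ζ hζ).1, (h ζ hζ).2.1, ?_⟩⟩
    rw [(h ζ hζ).2.2, hV ζ hζ, mul_assoc, one_add_mul_one_sub hU, mul_one]

theorem hasJumpCW_iff {M V : ℂ → Mat} {D : Set ℂ} {n : ℂ → ℂ} {U : Mat}
    (hV : ∀ ζ ∈ frontier D, V ζ = 1 + n ζ • U) :
    HasJumpCW M D V ↔ HasNilpotentJump M D n U := by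
  constructor
  · rintro ⟨Mp, Mm, hp, hm, h⟩
    refine ⟨Mm, Mp, hm, hp, fun ζ hζ => ⟨(h ζ hζ).2.1, (h ζ hζ).1, ?_⟩⟩
    rw [(h ζ hζ).2.2, hV ζ hζ]
  · rintro ⟨Mi, Mo, hi, ho, h⟩
    refine ⟨Mo, Mi, ho, hi, fun ζ hζ => ⟨(h ζ hζ).2.1, (h ζ hζ).1, ?_⟩⟩
    rw [(h ζ hζ).2.2, hV ζ hζ]

/-- Contours with disjoint closed interiors `D r`, and meromorphic functions `n r` whose poles `S r`
lie in `D r`, together with square-zero matrices `U r`. -/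
structure IsContourSystem {ρ : Type*} (D : ρ → Set ℂ) (U : ρ → Mat) (n : ρ → ℂ → ℂ)
    (S : ρ → Finset ℂ) : Prop where
  contour : ∀ r, IsContourInterior (D r)
  disjoint : ∀ r r', r ≠ r' → Disjoint (closure (D r)) (closure (D r'))
  zero_notMem : ∀ r, (0 : ℂ) ∉ closure (D r)
  sq : ∀ r, U r * U r = 0
  subset : ∀ r, ↑(S r) ⊆ D r
  diff : ∀ r k, k ≠ 0 → k ∉ S r → DifferentiableAt ℂ (n r) k

/-- The Riemann-Hilbert problem with the jumps `1 + n r • U r` across the contours. -/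
structure IsContourRHP {ρ : Type*} (qm : ℂ) (D : ρ → Set ℂ) (U : ρ → Mat) (n : ρ → ℂ → ℂ)
    (M : ℂ → Mat) : Prop where
  analytic : ∀ k, k ≠ 0 → (∀ r, k ∉ frontier (D r)) → EntrywiseDifferentiableAt M k
  normalized : IsNormalized qm M
  jump : ∀ r, HasNilpotentJump M (D r) (n r) (U r)

/-- The piecewise defined factor that removes the jumps. -/
def jumpFactor {ρ : Type*} [Fintype ρ] (D : ρ → Set ℂ) (U : ρ → Mat) (n : ρ → ℂ → ℂ) (k : ℂ) :
    Mat :=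
  1 + ∑ r, (D r).indicator (fun k => n r k • U r) k

theorem isNormalized_congr {qm : ℂ} {M M' : ℂ → Mat} (h : IsNormalized qm M)
    (hinf : M =ᶠ[Bornology.cobounded ℂ] M') (hzero : M =ᶠ[𝓝 0] M') : IsNormalized qm M' := by
  refine ⟨fun i j => (h.at_infty i j).congr' ?_ EventuallyEq.rfl,
    fun i j => (h.at_zero i j).congr' ?_ EventuallyEq.rfl⟩
  · filter_upwards [hinf] with k hk
    rw [hk]
  · filter_upwards [nhdsWithin_le_nhds hzero] with k hk
    rw [hk]

section
variable {ρ : Type*} {D : ρ → Set ℂ} {U : ρ → Mat} {n : ρ → ℂ → ℂ} {S : ρ → Finset ℂ}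

theorem IsContourSystem.eq_of_mem (hG : IsContourSystem D U n S) {r r' : ρ} {k : ℂ}
    (h : k ∈ closure (D r))
    (h' : k ∈ closure (D r')) : r = r' := by
  by_contra hne
  exact disjoint_left.1 (hG.disjoint r r' hne) h h'

theorem IsContourSystem.notMem_of_mem_frontier (hG : IsContourSystem D U n S) {r : ρ} {k : ℂ}
    (h : k ∈ frontier (D r)) (r' : ρ) :
    k ∉ D r' := by
  intro h'
  obtain rfl := hG.eq_of_mem (frontier_subset_closure h) (subset_closure h')
  rw [(hG.contour r).isOpen.frontier_eq] at h
  exact h.2 h'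

variable [Fintype ρ]

theorem IsContourSystem.eventually_notMem (hG : IsContourSystem D U n S) {r : ρ} {ζ : ℂ}
    (h : ζ ∈ closure (D r)) :
    ∀ᶠ k in 𝓝 ζ, ∀ r', r' ≠ r → k ∉ closure (D r') := by
  refine eventually_all.2 fun r' => ?_
  by_cases hr : r' = r
  · exact Eventually.of_forall fun k hk => absurd hr hk
  · filter_upwards [isClosed_closure.isOpen_compl.mem_nhds
      (fun h' => hr (hG.eq_of_mem h' h) : ζ ∈ (closure (D r'))ᶜ)] with k hk _
    exact hk

theorem eventually_notMem_closure {ζ : ℂ} (h : ∀ r, ζ ∉ closure (D r)) :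
    ∀ᶠ k in 𝓝 ζ, ∀ r, k ∉ closure (D r) :=
  eventually_all.2 fun r => isClosed_closure.isOpen_compl.mem_nhds (h r)

theorem IsContourSystem.eventually_cobounded (hG : IsContourSystem D U n S) :
    ∀ᶠ k in Bornology.cobounded ℂ, ∀ r, k ∉ closure (D r) :=
  eventually_all.2 fun r => Bornology.isBounded_def.1 (hG.contour r).isBounded.closure

theorem jumpFactor_of_mem (hG : IsContourSystem D U n S) {r : ρ} {k : ℂ} (h : k ∈ D r) :
    jumpFactor D U n k = 1 + n r k • U r := by
  rw [jumpFactor, Finset.sum_eq_single r]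
  · rw [indicator_of_mem h]
  · intro r' _ hr
    exact indicator_of_notMem (fun h' =>
      hr (hG.eq_of_mem (subset_closure h') (subset_closure h))) _
  · simp

theorem jumpFactor_of_notMem {k : ℂ} (h : ∀ r, k ∉ D r) : jumpFactor D U n k = 1 := by
  rw [jumpFactor, Finset.sum_eq_zero, add_zero]
  exact fun r _ => indicator_of_notMem (h r) _

theorem jumpFactor_mul_cancel (hG : IsContourSystem D U n S) (k : ℂ) :
    ∃ T : Mat, jumpFactor D U n k * T = 1 := by
  by_cases h : ∃ r, k ∈ D r
  · obtain ⟨r, hr⟩ := h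
    exact ⟨_, by rw [jumpFactor_of_mem hG hr]; exact one_add_mul_one_sub (hG.sq r) _⟩
  · exact ⟨1, by rw [jumpFactor_of_notMem (not_exists.1 h), one_mul]⟩

/-- Removing the jumps of a solution turns them into poles. -/
theorem IsContourRHP.exists_dressed
    (hG : IsContourSystem D U n S) {qm : ℂ} {M : ℂ → Mat} (h : IsContourRHP qm D U n M) :
    ∃ M' : ℂ → Mat, (∀ k, (∀ r, k ∉ frontier (D r)) → M' k = M k * jumpFactor D U n k) ∧
      (∀ k, k ≠ 0 → (∀ r, k ∉ S r) → EntrywiseDifferentiableAt M' k) ∧ IsNormalized qm M' ∧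
      ∀ r, ∀ p ∈ S r, ∀ c, Tendsto (fun k => (k - p) * n r k) (𝓝[≠] p) (𝓝 c) →
        HasWeakResidue M' p (c • U r) := by
  classical
  choose Mi Mo hi ho hj using h.jump
  -- The values of `M` on the contours are unrestricted, so the outer boundary values are inserted
  -- there.
  set M' : ℂ → Mat := fun k => if h : ∃ r, k ∈ frontier (D r) then Mo h.choose k else
    M k * jumpFactor D U n k with hM'
  have hoff : ∀ k, (∀ r, k ∉ frontier (D r)) → M' k = M k * jumpFactor D U n k := by
    intro k hk
    rw [hM']
    simp only
    rw [dif_neg (not_exists.2 hk)]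
  have hon : ∀ r, ∀ k ∈ frontier (D r), M' k = Mo r k := by
    intro r k hk
    have hex : ∃ r, k ∈ frontier (D r) := ⟨r, hk⟩
    rw [hM']
    simp only
    rw [dif_pos hex, hG.eq_of_mem (frontier_subset_closure hex.choose_spec)
      (frontier_subset_closure hk)]
  have hnf : ∀ r, ∀ k ∈ D r, ∀ r', k ∉ frontier (D r') := fun r k hk r' hk' =>
    hG.notMem_of_mem_frontier hk' r hk
  have hin : ∀ r, ∀ k ∈ D r, M' k = M k * (1 + n r k • U r) := fun r k hk => by
    rw [hoff k (hnf r k hk), jumpFactor_of_mem hG hk]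
  have hout : ∀ k, (∀ r, k ∉ closure (D r)) → M' k = M k := fun k hk => by
    rw [hoff k fun r hr => hk r (frontier_subset_closure hr),
      jumpFactor_of_notMem fun r hr => hk r (subset_closure hr), mul_one]
  have hne0 : ∀ r, ∀ k ∈ closure (D r), k ≠ 0 := fun r k hk h0 => hG.zero_notMem r (h0 ▸ hk)
  have dOff : ∀ k, k ≠ 0 → (∀ r, k ∉ S r) → (∀ r, k ∉ frontier (D r)) →
      EntrywiseDifferentiableAt M' k := by
    intro k h0 hS hk
    have hMd := h.analytic k h0 hk
    by_cases hD : ∃ r, k ∈ D r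
    · obtain ⟨r, hr⟩ := hD
      refine (hMd.mul (entrywiseDifferentiableAt_one_add_smul (hG.diff r k h0 (hS r))
        (U r))).congr_of_eventuallyEq ?_
      filter_upwards [(hG.contour r).isOpen.mem_nhds hr] with z hz using hin r z hz
    · refine hMd.congr_of_eventuallyEq ?_
      have : ∀ r, k ∉ closure (D r) := fun r hr => by
        have hkr := hk r
        rw [(hG.contour r).isOpen.frontier_eq] at hkr
        exact hkr ⟨hr, fun h => hD ⟨r, h⟩⟩
      filter_upwards [eventually_notMem_closure this] with z hz using hout z hz
  have hSf : ∀ r, ∀ k ∈ frontier (D r), ∀ r', k ∉ S r' := fun r k hk r' hk' =>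
    hG.notMem_of_mem_frontier hk r' (hG.subset r' hk')
  have cOn : ∀ r, ∀ ζ ∈ frontier (D r), ContinuousAt M' ζ := by
    intro r ζ hζ
    obtain ⟨t1, t2, t3⟩ := hj r ζ hζ
    have hN : ContinuousAt (fun k => 1 + n r k • U r) ζ :=
      (entrywiseDifferentiableAt_one_add_smul (hG.diff r ζ
      (hne0 r ζ (frontier_subset_closure hζ)) (hSf r ζ hζ r)) (U r)).continuousAt
    rw [ContinuousAt, hon r ζ hζ]
    -- A neighbourhood splits into inside, outside and contour. The three limits agree because `Mi
    -- (1 + n U) = Mo`.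
    have hcover : 𝓝 ζ ≤ 𝓝[D r] ζ ⊔ (𝓝[(closure (D r))ᶜ] ζ ⊔ 𝓝[frontier (D r)] ζ) := by
      rw [← nhdsWithin_union, ← nhdsWithin_union, ← nhdsWithin_univ]
      refine nhdsWithin_mono _ fun k _ => ?_
      by_cases hk : k ∈ D r
      · exact Or.inl hk
      · by_cases hk' : k ∈ closure (D r)
        · exact Or.inr (Or.inr (by rw [(hG.contour r).isOpen.frontier_eq]; exact ⟨hk', hk⟩))
        · exact Or.inr (Or.inl hk')
    refine Tendsto.mono_left ?_ hcover
    refine Tendsto.sup ?_ (Tendsto.sup ?_ ?_)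
    · rw [t3]
      refine (t1.mul (hN.tendsto.mono_left nhdsWithin_le_nhds)).congr' ?_
      filter_upwards [self_mem_nhdsWithin] with k hk using (hin r k hk).symm
    · refine t2.congr' ?_
      filter_upwards [self_mem_nhdsWithin,
        nhdsWithin_le_nhds (hG.eventually_notMem (frontier_subset_closure hζ))] with k hk hk'
      refine (hout k fun r' => ?_).symm
      rcases eq_or_ne r' r with rfl | hr
      · exact hk
      · exact hk' r' hr
    · refine (ho r ζ hζ).tendsto.congr' ?_
      filter_upwards [self_mem_nhdsWithin] with k hk using (hon r k hk).symm
  have dOn : ∀ r, ∀ ζ ∈ frontier (D r), EntrywiseDifferentiableAt M' ζ := by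
    intro r ζ hζ i j
    have hnear : ∀ᶠ k in 𝓝 ζ, k ≠ 0 ∧ (∀ r', k ∉ S r') ∧ ∀ r', r' ≠ r → k ∉ frontier (D r') := by
      refine (isOpen_ne.eventually_mem (hne0 r ζ (frontier_subset_closure hζ))).and
        (Filter.Eventually.and ?_ ?_)
      · exact eventually_all.2 fun r' =>
          ((S r').finite_toSet.isClosed.isOpen_compl.eventually_mem
            (show ζ ∈ (↑(S r') : Set ℂ)ᶜ from hSf r ζ hζ r')).mono fun k hk => hk
      · filter_upwards [hG.eventually_notMem (frontier_subset_closure hζ)] with k hk r' hr hk'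
        exact hk r' hr (frontier_subset_closure hk')
    have hdnear : ∀ᶠ k in 𝓝 ζ, k ∉ frontier (D r) → EntrywiseDifferentiableAt M' k := by
      filter_upwards [hnear] with k hk hk'
      refine dOff k hk.1 hk.2.1 fun r' => ?_
      rcases eq_or_ne r' r with rfl | hr
      · exact hk'
      · exact hk.2.2 r' hr
    -- Continuous across the contour and holomorphic off it, so Painlevé's theorem applies.
    refine differentiableAt_of_continuous_of_smooth_frontier (hG.contour r).isOpen
      ((hG.contour r).smooth ζ hζ) ?_ (hdnear.mono fun k hk hk' => hk hk' i j)
    filter_upwards [hdnear] with k hk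
    by_cases hk' : k ∈ frontier (D r)
    · exact tendsto_mat_iff.1 (cOn r k hk') i j
    · exact (hk hk' i j).continuousAt
  refine ⟨M', hoff, fun k h0 hS => ?_, isNormalized_congr h.normalized ?_ ?_, ?_⟩
  · by_cases hk : ∃ r, k ∈ frontier (D r)
    · exact dOn _ k hk.choose_spec
    · exact dOff k h0 hS (not_exists.1 hk)
  · filter_upwards [hG.eventually_cobounded] with k hk using (hout k hk).symm
  · filter_upwards [eventually_notMem_closure hG.zero_notMem] with k hk using (hout k hk).symm
  · intro r p hp c hc
    have hpD : p ∈ D r := hG.subset r hp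
    have hMc : Tendsto M (𝓝[≠] p) (𝓝 (M p)) :=
      ((h.analytic p (hne0 r p (subset_closure hpD)) (hnf r p hpD)).continuousAt.tendsto).mono_left
        nhdsWithin_le_nhds
    have hDn : ∀ᶠ k in 𝓝[≠] p, k ∈ D r :=
      nhdsWithin_le_nhds ((hG.contour r).isOpen.mem_nhds hpD)
    have hid : Tendsto (fun k => k - p) (𝓝[≠] p) (𝓝 0) := by
      have : ContinuousAt (fun k => k - p) p := by fun_prop
      simpa using this.tendsto.mono_left (nhdsWithin_le_nhds (s := {p}ᶜ))
    -- `M` is regular at `p`, so the pole comes from `n` alone. As `U² = 0`, multiplying `M' = M (1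
    -- + n U)` by `c U` leaves `c M U`, which stays bounded.
    refine ⟨c • (M p * U r), ?_, ?_⟩
    · have h1 := (hid.smul hMc).add (hc.smul (hMc.mul_const (U r)))
      rw [zero_smul, zero_add] at h1
      refine h1.congr' ?_
      filter_upwards [hDn] with k hk
      rw [hin r k hk, mul_add, mul_one, smul_add, Matrix.mul_smul, smul_smul]
    · have h1 := (hMc.mul_const (U r)).const_smul c
      refine h1.congr' ?_
      filter_upwards [hDn] with k hk
      rw [hin r k hk, mul_assoc, add_mul, one_mul, Matrix.smul_mul, Matrix.mul_smul, hG.sq,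
        smul_zero, smul_zero, add_zero, Matrix.mul_smul]

/-- Conversely, a matrix with poles yields a solution of the problem with jumps. -/
theorem IsContourSystem.exists_isContourRHP
    (hG : IsContourSystem D U n S) {qm : ℂ} {M : ℂ → Mat} (hM : IsNormalized qm M)
    (hd : ∀ k, k ≠ 0 → (∀ r, k ∉ S r) → EntrywiseDifferentiableAt M k)
    (hres : ∀ r, ∀ p ∈ S r, ∀ i j,
      Tendsto (fun k => (k - p) * (M k * (1 - n r k • U r)) i j) (𝓝[≠] p) (𝓝 0)) :
    ∃ M₂, IsContourRHP qm D U n M₂ ∧ ∀ k, (∀ r, k ∉ closure (D r)) → M₂ k = M k := by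
  classical
  have hne0 : ∀ r, ∀ k ∈ closure (D r), k ≠ 0 := fun r k hk h0 => hG.zero_notMem r (h0 ▸ hk)
  have hS1 : ∀ r, ∀ k ∈ closure (D r), k ∉ S r → ∀ r', k ∉ S r' := by
    intro r k hk hkS r' hr'
    obtain rfl := hG.eq_of_mem hk (subset_closure (hG.subset r' hr'))
    exact hkS hr'
  have hdin : ∀ r, ∀ k ∈ closure (D r), k ∉ S r →
      EntrywiseDifferentiableAt (fun k => M k * (1 - n r k • U r)) k := fun r k hk hkS =>
    (hd k (hne0 r k hk) (hS1 r k hk hkS)).mul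
      (entrywiseDifferentiableAt_one_sub_smul (hG.diff r k (hne0 r k hk) hkS) (U r))
  -- By hypothesis `M (1 - n U)` has only removable singularities inside; its extension is the
  -- solution there.
  have hext : ∀ r i j, ∃ F : ℂ → ℂ, DifferentiableOn ℂ F (D r) ∧
      EqOn (fun k => (M k * (1 - n r k • U r)) i j) F (D r \ ↑(S r)) := fun r i j =>
    exists_differentiableOn_extension (hG.contour r).isOpen (S r) (hG.subset r)
      (fun k hk => (hdin r k (subset_closure hk.1) hk.2 i j).differentiableWithinAt)
      fun p hp => hres r p hp i j
  choose F hF hFe using hext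
  set M₂ : ℂ → Mat := fun k => if h : ∃ r, k ∈ D r then Matrix.of (fun i j => F h.choose i j k)
    else M k with hM₂
  have hin : ∀ r, ∀ k ∈ D r, M₂ k = Matrix.of fun i j => F r i j k := by
    intro r k hk
    have hex : ∃ r, k ∈ D r := ⟨r, hk⟩
    rw [hM₂]
    simp only
    rw [dif_pos hex, hG.eq_of_mem (subset_closure hex.choose_spec) (subset_closure hk)]
  have hin' : ∀ r, ∀ k ∈ D r, k ∉ S r → M₂ k = M k * (1 - n r k • U r) := by
    intro r k hk hkS
    rw [hin r k hk]
    ext i j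
    exact (hFe r i j ⟨hk, hkS⟩).symm
  have hout : ∀ k, (∀ r, k ∉ D r) → M₂ k = M k := by
    intro k hk
    rw [hM₂]
    simp only
    rw [dif_neg (not_exists.2 hk)]
  have hout' : ∀ k, (∀ r, k ∉ closure (D r)) → M₂ k = M k := fun k hk =>
    hout k fun r hr => hk r (subset_closure hr)
  refine ⟨M₂, ⟨fun k h0 hk => ?_, isNormalized_congr hM ?_ ?_, fun r => ?_⟩, hout'⟩
  · by_cases hD : ∃ r, k ∈ D r
    · obtain ⟨r, hr⟩ := hD
      have hn := (hG.contour r).isOpen.mem_nhds hr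
      intro i j
      refine ((hF r i j).differentiableAt hn).congr_of_eventuallyEq ?_
      filter_upwards [hn] with z hz
      rw [hin r z hz, Matrix.of_apply]
    · have hcl : ∀ r, k ∉ closure (D r) := fun r hr => by
        have hkr := hk r
        rw [(hG.contour r).isOpen.frontier_eq] at hkr
        exact hkr ⟨hr, fun h => hD ⟨r, h⟩⟩
      refine (hd k h0 fun r hr => hD ⟨r, hG.subset r hr⟩).congr_of_eventuallyEq ?_
      filter_upwards [eventually_notMem_closure hcl] with z hz using hout' z hz
  · filter_upwards [hG.eventually_cobounded] with k hk using (hout' k hk).symm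
  · filter_upwards [eventually_notMem_closure hG.zero_notMem] with k hk using (hout' k hk).symm
  · have hSf : ∀ k ∈ frontier (D r), k ∉ S r := fun k hk hk' =>
      hG.notMem_of_mem_frontier hk r (hG.subset r hk')
    have hcM : ∀ k ∈ frontier (D r), ContinuousAt M k := fun k hk =>
      (hd k (hne0 r k (frontier_subset_closure hk))
        (hS1 r k (frontier_subset_closure hk) (hSf k hk))).continuousAt
    have hcN : ∀ k ∈ frontier (D r), ContinuousAt (fun k => M k * (1 - n r k • U r)) k :=
      fun k hk => (hdin r k (frontier_subset_closure hk) (hSf k hk)).continuousAt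
    -- The poles lie strictly inside, so both functions are continuous across the contour and serve
    -- as inner and outer boundary values.
    refine ⟨fun k => M k * (1 - n r k • U r), M, fun k hk => (hcN k hk).continuousWithinAt,
      fun k hk => (hcM k hk).continuousWithinAt, fun ζ hζ => ⟨?_, ?_, ?_⟩⟩
    · refine ((hcN ζ hζ).tendsto.mono_left nhdsWithin_le_nhds).congr' ?_
      have hSn : ∀ᶠ k in 𝓝[D r] ζ, k ∈ (↑(S r) : Set ℂ)ᶜ :=
        nhdsWithin_le_nhds ((S r).finite_toSet.isClosed.isOpen_compl.mem_nhds (hSf ζ hζ))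
      filter_upwards [self_mem_nhdsWithin, hSn] with k hk hk' using (hin' r k hk hk').symm
    · refine ((hcM ζ hζ).tendsto.mono_left nhdsWithin_le_nhds).congr' ?_
      filter_upwards [self_mem_nhdsWithin,
        nhdsWithin_le_nhds (hG.eventually_notMem (frontier_subset_closure hζ))] with k hk hk'
      refine (hout' k fun r' => ?_).symm
      rcases eq_or_ne r' r with rfl | hr
      · exact hk
      · exact hk' r' hr
    · rw [mul_assoc, one_sub_mul_one_add (hG.sq r), mul_one]
end

/-! ### Equivalence of the problem with poles and the problem with contours -/

section
variable {β ι : Type*}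

/-- The off-diagonal matrices that span the nilpotent parts of the jumps. -/
def nilpotentPart : β ⊕ β → Mat := Sum.elim (fun _ => !![0, 0; 1, 0]) fun _ => !![0, 1; 0, 0]

/-- The off-diagonal entries of the jumps. -/
def jumpEntry [Fintype ι] (η A : β × ι → ℂ) : β ⊕ β → ℂ → ℂ :=
  Sum.elim (fun b => partialFraction 0 0 (fun j => A (b, j)) fun j => η (b, j))
    fun b => partialFraction 0 0 (fun j => -conj (A (b, j))) fun j => conj (η (b, j))

open Classical in
/-- The poles of the off-diagonal entries of the jumps. -/
def jumpPoles [Fintype ι] (η : β × ι → ℂ) : β ⊕ β → Finset ℂ :=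
  Sum.elim (fun b => Finset.univ.image fun j => η (b, j))
    fun b => Finset.univ.image fun j => conj (η (b, j))

theorem nilpotentPart_mul_self (r : β ⊕ β) : nilpotentPart r * nilpotentPart r = 0 := by
  rcases r with b | b <;> ext i j <;> fin_cases i <;> fin_cases j <;> simp [nilpotentPart]

theorem differentiableAt_jumpEntry [Fintype ι] (η A : β × ι → ℂ) (r : β ⊕ β) {k : ℂ} (h0 : k ≠ 0)
    (hk : k ∉ jumpPoles η r) : DifferentiableAt ℂ (jumpEntry η A r) k := by
  rcases r with b | b <;>
    exact differentiableAt_partialFraction _ _ h0 fun j => Or.inr fun h => hk (by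
      simp only [jumpPoles, Sum.elim_inl, Sum.elim_inr, Finset.mem_image, Finset.mem_univ, true_and]
      exact ⟨j, h.symm⟩)

theorem mem_poleSet_iff [Fintype ι] {η : β × ι → ℂ} {k : ℂ} :
    k ∈ poleSet η ↔ k = 0 ∨ ∃ r, k ∈ jumpPoles η r := by
  simp only [poleSet, Sum.exists, jumpPoles, Sum.elim_inl, Sum.elim_inr, Finset.mem_image,
    Finset.mem_univ, true_and, mem_union, mem_singleton_iff, mem_range, Prod.exists]

variable [Fintype β] [Fintype ι] {η A : β × ι → ℂ} {D : β ⊕ β → Set ℂ} {qm : ℂ}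

/-- The residues of the jump entries are the coefficients `A` and `-conj A` of the breather problem,
so the dressed matrix solves it. -/
theorem IsContourRHP.exists_isResidueRHP (hinj : Function.Injective η)
    (hη : ∀ i j, η i ≠ conj (η j))
    (hG : IsContourSystem D nilpotentPart (jumpEntry η A) (jumpPoles η)) {M : ℂ → Mat}
    (h : IsContourRHP qm D nilpotentPart (jumpEntry η A) M) :
    ∃ M', IsResidueRHP qm η A M' ∧ ∀ k, (∀ r, k ∉ frontier (D r)) →
      M' k = M k * jumpFactor D nilpotentPart (jumpEntry η A) k := by
  obtain ⟨M', h1, h2, h3, h4⟩ := h.exists_dressed hG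
  refine ⟨M', ⟨fun i j k hk => ?_, h3, fun m => ?_, fun m => ?_⟩, h1⟩
  · rw [mem_compl_iff, mem_poleSet_iff, not_or, not_exists] at hk
    exact (h2 k hk.1 hk.2 i j).differentiableWithinAt
  · have := h4 (Sum.inl m.1) (η m) (by simp [jumpPoles]) (A m)
      (tendsto_mul_partialFraction 0 0 (P := fun j => A (m.1, j)) (p := fun j => η (m.1, j))
        (fun a b hab => (Prod.ext_iff.1 (hinj hab)).2) m.2 (ne_zero_of_ne_conj hη m))
    simpa [nilpotentPart] using this
  · have := h4 (Sum.inr m.1) (conj (η m)) (by simp [jumpPoles]) (-conj (A m))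
      (tendsto_mul_partialFraction 0 0 (P := fun j => -conj (A (m.1, j)))
        (p := fun j => conj (η (m.1, j)))
        (fun a b hab => (Prod.ext_iff.1 (conj_injective_comp hinj hab)).2) m.2
        ((map_ne_zero _).2 (ne_zero_of_ne_conj hη m)))
    simpa [nilpotentPart] using this

/-- The dressed matrices agree by uniqueness of the pole problem, and the dressing factor is
invertible away from the poles. -/
theorem IsContourRHP.eqOn (hinj : Function.Injective η) (hη : ∀ i j, η i ≠ conj (η j))
    (hG : IsContourSystem D nilpotentPart (jumpEntry η A) (jumpPoles η)) {M M' : ℂ → Mat}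
    (h : IsContourRHP qm D nilpotentPart (jumpEntry η A) M)
    (h' : IsContourRHP qm D nilpotentPart (jumpEntry η A) M') {k : ℂ} (h0 : k ≠ 0)
    (hk : ∀ r, k ∉ frontier (D r)) : M k = M' k := by
  obtain ⟨N, hN, hNe⟩ := h.exists_isResidueRHP hinj hη hG
  obtain ⟨N', hN', hNe'⟩ := h'.exists_isResidueRHP hinj hη hG
  have hNN := hN.eqOn hinj hη hN'
  have hgen : ∀ z, z ∉ poleSet η → (∀ r, z ∉ frontier (D r)) → M z = M' z := by
    intro z hz hzf
    obtain ⟨T, hT⟩ := jumpFactor_mul_cancel hG z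
    have := hNN hz
    rw [hNe z hzf, hNe' z hzf] at this
    rw [← mul_one (M z), ← hT, ← mul_assoc, this, mul_assoc, hT, mul_one]
  -- The undressed matrices are continuous at the pole positions too, so equality extends to them.
  refine tendsto_nhds_unique
    ((h.analytic k h0 hk).continuousAt.tendsto.mono_left (nhdsWithin_le_nhds (s := {k}ᶜ))) ?_
  refine ((h'.analytic k h0 hk).continuousAt.tendsto.mono_left nhdsWithin_le_nhds).congr' ?_
  have hf : ∀ᶠ z in 𝓝 k, ∀ r, z ∉ frontier (D r) :=
    eventually_all.2 fun r => isClosed_frontier.isOpen_compl.mem_nhds (hk r)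
  filter_upwards [eventually_notMem_poleSet η k, nhdsWithin_le_nhds hf] with z hz hzf
  exact (hgen z hz hzf).symm

theorem IsSolution.exists_isContourRHP (hinj : Function.Injective η)
    (hη : ∀ i j, η i ≠ conj (η j))
    (hG : IsContourSystem D nilpotentPart (jumpEntry η A) (jumpPoles η))
    {P Q : Fin 2 → β × ι → ℂ} (h : IsSolution qm η A P Q) :
    ∃ M, IsContourRHP qm D nilpotentPart (jumpEntry η A) M ∧
      ∀ k, (∀ r, k ∉ closure (D r)) → M k = rowMatrix qm η P Q k := by
  refine hG.exists_isContourRHP (isNormalized_rowMatrix hη) (fun k h0 hk => ?_) ?_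
  · refine differentiableAt_rowMatrix ?_
    rw [mem_poleSet_iff, not_or, not_exists]
    exact ⟨h0, hk⟩
  have hid : ∀ p : ℂ, Tendsto (fun k => k - p) (𝓝[≠] p) (𝓝 0) := fun p => by
    have : ContinuousAt (fun k => k - p) p := by fun_prop
    simpa using this.tendsto.mono_left (nhdsWithin_le_nhds (s := {p}ᶜ))
  rintro (b | b) p hp i <;>
    simp only [jumpPoles, Sum.elim_inl, Sum.elim_inr, Finset.mem_image, Finset.mem_univ,
      true_and] at hp <;>
    obtain ⟨a, rfl⟩ := hp
  · have h0 := ne_zero_of_ne_conj hη (b, a)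
    have hc : Tendsto (fun k => rowMatrix qm η P Q k i 1) (𝓝[≠] (η (b, a)))
        (𝓝 (rowMatrix qm η P Q (η (b, a)) i 1)) :=
      (differentiableAt_partialFraction _ _ h0 fun j =>
        Or.inr (hη (b, a) j)).continuousAt.tendsto.mono_left nhdsWithin_le_nhds
    have hn := tendsto_mul_partialFraction 0 0 (P := fun j => A (b, j)) (p := fun j => η (b, j))
        (fun a b hab => (Prod.ext_iff.1 (hinj hab)).2) a h0
    have hP : Tendsto (fun k => (k - η (b, a)) * rowMatrix qm η P Q k i 0) (𝓝[≠] (η (b, a)))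
        (𝓝 (P i (b, a))) := tendsto_mul_partialFraction _ _ hinj (b, a) h0
    refine Fin.forall_fin_two.2 ⟨?_, ?_⟩
    -- The first column of `M (1 - n U)` is the first column of `M` minus `n` times the second; its
    -- residue vanishes by the row equation.
    · have := hP.sub (hn.mul hc)
      rw [rowMatrix_apply_one, ← (h i).1 (b, a), sub_self] at this
      refine this.congr fun k => ?_
      simp only [jumpEntry, nilpotentPart, Matrix.mul_apply, Fin.sum_univ_two, Matrix.sub_apply,
        Matrix.smul_apply, Sum.elim_inl]
      simp
      ring
    · have := (hid (η (b, a))).mul hc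
      rw [zero_mul] at this
      refine this.congr fun k => ?_
      simp only [jumpEntry, nilpotentPart, Matrix.mul_apply, Fin.sum_univ_two, Matrix.sub_apply,
        Matrix.smul_apply, Sum.elim_inl]
      simp
  · have h0 : conj (η (b, a)) ≠ 0 := (map_ne_zero _).2 (ne_zero_of_ne_conj hη (b, a))
    have hc : Tendsto (fun k => rowMatrix qm η P Q k i 0) (𝓝[≠] (conj (η (b, a))))
        (𝓝 (rowMatrix qm η P Q (conj (η (b, a))) i 0)) :=
      (differentiableAt_partialFraction _ _ h0 fun j =>
        Or.inr (hη j (b, a)).symm).continuousAt.tendsto.mono_left nhdsWithin_le_nhds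
    have hn := tendsto_mul_partialFraction 0 0 (P := fun j => -conj (A (b, j)))
        (p := fun j => conj (η (b, j)))
        (fun a b hab => (Prod.ext_iff.1 (conj_injective_comp hinj hab)).2) a h0
    have hQ : Tendsto (fun k => (k - conj (η (b, a))) * rowMatrix qm η P Q k i 1)
        (𝓝[≠] (conj (η (b, a)))) (𝓝 (Q i (b, a))) :=
      tendsto_mul_partialFraction _ _ (conj_injective_comp hinj) (b, a) h0
    refine Fin.forall_fin_two.2 ⟨?_, ?_⟩
    · have := (hid (conj (η (b, a)))).mul hc
      rw [zero_mul] at this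
      refine this.congr fun k => ?_
      simp only [jumpEntry, nilpotentPart, Matrix.mul_apply, Fin.sum_univ_two, Matrix.sub_apply,
        Matrix.smul_apply, Sum.elim_inr]
      simp
    · have := hQ.sub (hn.mul hc)
      rw [rowMatrix_apply_zero, ← (h i).2 (b, a), sub_self] at this
      refine this.congr fun k => ?_
      simp only [jumpEntry, nilpotentPart, Matrix.mul_apply, Fin.sum_univ_two, Matrix.sub_apply,
        Matrix.smul_apply, Sum.elim_inr]
      simp
      ring
end

/-! ### The geometry of the regions and the quadrature domain -/

theorem im_ne_zero_of_mem_regionPlus {q₀ : ℝ} {k : ℂ} (h : k ∈ regionPlus q₀) : k.im ≠ 0 := by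
  intro h0
  have h' : 0 < k.im * (1 - q₀ ^ 2 / ‖k‖ ^ 2) := h
  simp [h0] at h'

theorem im_ne_zero_of_mem_regionMinus {q₀ : ℝ} {k : ℂ} (h : k ∈ regionMinus q₀) : k.im ≠ 0 := by
  intro h0
  have h' : k.im * (1 - q₀ ^ 2 / ‖k‖ ^ 2) < 0 := h
  simp [h0] at h'

theorem norm_ne_of_mem_regionPlus {q₀ : ℝ} (hq₀ : 0 < q₀) {k : ℂ} (h : k ∈ regionPlus q₀) :
    ‖k‖ ≠ q₀ := by
  intro h0
  have h' : 0 < k.im * (1 - q₀ ^ 2 / ‖k‖ ^ 2) := h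
  rw [h0, div_self (by positivity)] at h'
  simp at h'

theorem conj_mem_regionMinus {q₀ : ℝ} {k : ℂ} (h : k ∈ regionPlus q₀) :
    conj k ∈ regionMinus q₀ := by
  have h' : 0 < k.im * (1 - q₀ ^ 2 / ‖k‖ ^ 2) := h
  change (conj k).im * (1 - q₀ ^ 2 / ‖conj k‖ ^ 2) < 0
  rw [conj_im, norm_conj]
  linarith

theorem disjoint_regionPlus_regionMinus (q₀ : ℝ) : Disjoint (regionPlus q₀) (regionMinus q₀) :=
  disjoint_left.2 fun k h h' =>
    lt_asymm (show 0 < k.im * (1 - q₀ ^ 2 / ‖k‖ ^ 2) from h) h'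

/-- The involution `k ↦ -q₀² / k*` exchanges the upper and lower half planes, which separates `Γ₁₊`
from `Γ₂₊` within `𝔻⁺`. -/
theorem im_neg_div_conj (q₀ : ℝ) (k : ℂ) :
    (-(q₀ : ℂ) ^ 2 / conj k).im = -(q₀ ^ 2 / normSq k) * k.im := by
  rw [div_eq_mul_inv, inv_def, conj_conj, normSq_conj, ← ofReal_pow, ← ofReal_neg, ← mul_assoc,
    mul_comm _ ((_ : ℝ) : ℂ), ← mul_assoc, ← ofReal_mul, im_ofReal_mul]
  ring

/-- The imaginary part has constant sign on a connected set on which it does not vanish. -/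
theorem im_mul_im_pos {s : Set ℂ} (hs : IsPreconnected s) (h : ∀ k ∈ s, k.im ≠ 0) {a b : ℂ}
    (ha : a ∈ s) (hb : b ∈ s) : 0 < a.im * b.im := by
  by_contra! hc
  have h0 : (0 : ℝ) ∈ im '' s := by
    rcases mul_nonpos_iff.1 hc with ⟨h1, h2⟩ | ⟨h1, h2⟩
    · exact hs.intermediate_value hb ha continuous_im.continuousOn ⟨h2, h1⟩
    · exact hs.intermediate_value ha hb continuous_im.continuousOn ⟨h1, h2⟩
  obtain ⟨k, hk, hk0⟩ := h0
  exact h k hk hk0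

/-- A connected closure avoiding the real axis lies in one half plane; the points `a` and `b` show
that the two half planes differ. -/
theorem disjoint_closure_of_im_mul_im_neg {D D' : Set ℂ} (hD : IsConnected D) (hD' : IsConnected D')
    (h : ∀ k ∈ closure D, k.im ≠ 0) (h' : ∀ k ∈ closure D', k.im ≠ 0) {a b : ℂ} (ha : a ∈ D)
    (hb : b ∈ D') (hab : a.im * b.im < 0) : Disjoint (closure D) (closure D') := by
  refine disjoint_left.2 fun k hk hk' => ?_
  have h1 := im_mul_im_pos hD.closure.isPreconnected h hk (subset_closure ha)
  have h2 := im_mul_im_pos hD'.closure.isPreconnected h' hk' (subset_closure hb)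
  have : 0 < (k.im * a.im) * (k.im * b.im) := mul_pos h1 h2
  nlinarith [mul_self_nonneg k.im]

/-- A nonconstant polynomial is an open map, so the preimage of the closed disc lies in the closure
of the preimage of the open disc. Thus the assumptions on the closure cover the integration curve.
-/
theorem subset_closure_quadratureDomain {m : ℕ} (hm : m ≠ 0) {s₁ s₂ : ℂ} {s₃ : ℝ} (hs₃ : 0 < s₃)
    {l : ℂ} (hl : ‖(l - s₁) ^ m - s₂‖ ≤ s₃) : l ∈ closure (quadratureDomain m s₁ s₂ s₃) := by
  set f : ℂ → ℂ := fun k => (k - s₁) ^ m with hf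
  have hfa : AnalyticOnNhd ℂ f univ := fun k _ => by
    simp only [hf]
    fun_prop
  have hopen : IsOpenMap f := by
    rcases hfa.is_constant_or_isOpen isPreconnected_univ with ⟨w, hw⟩ | h
    · have h0 := hw s₁ (mem_univ _)
      have h1 := hw (s₁ + 1) (mem_univ _)
      simp only [hf, sub_self, zero_pow hm, add_sub_cancel_left, one_pow] at h0 h1
      exact absurd (h0.trans h1.symm) zero_ne_one
    · exact fun s hs => h s (subset_univ _) hs
  have hset : quadratureDomain m s₁ s₂ s₃ = f ⁻¹' Metric.ball s₂ s₃ := by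
    ext k
    simp [quadratureDomain, hf, dist_eq_norm]
  rw [hset]
  apply hopen.preimage_closure_subset_closure_preimage
  rw [closure_ball _ hs₃.ne', mem_preimage, Metric.mem_closedBall, dist_eq_norm]
  exact hl

/-! ### The entries of the jump matrices -/

section
variable {n : ℕ} {s₁ s₂ : ℂ} {s₃ : ℝ} {r₁ : ℂ → ℂ} {lam c : Fin n → ℂ}

theorem boundaryIntegralConj_eq_conj (m : ℕ) (s₁ s₂ : ℂ) (s₃ : ℝ) (f : ℂ → ℂ) :
    boundaryIntegralConj m s₁ s₂ s₃ f =
      conj (boundaryIntegral m s₁ s₂ s₃ fun l => conj (f l)) := by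
  rw [boundaryIntegralConj, boundaryIntegral,
    intervalIntegral.integral_of_le Real.two_pi_pos.le,
    intervalIntegral.integral_of_le Real.two_pi_pos.le, ← integral_conj]
  congr 1
  ext θ
  simp only [map_sum, map_mul, conj_conj]

/-- The Cauchy-type integrals in the jump matrices are rational functions. -/
theorem boundaryIntegral_eq_sum (hn : n ≠ 0) (hs₃ : 0 < s₃)
    (hr₁ : ∀ l, ‖(l - s₁) ^ n - s₂‖ ≤ s₃ → AnalyticAt ℂ r₁ l)
    (hlam : ∀ j, (lam j - s₁) ^ n = s₂) (hinj : Function.Injective lam)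
    (hc : ∀ j, c j = (s₃ : ℂ) ^ 2 * r₁ (lam j) / ∏ l ∈ Finset.univ.erase j, (lam j - lam l))
    {E κ : ℂ → ℂ} (hE : ∀ l, ‖(l - s₁) ^ n - s₂‖ ≤ s₃ → AnalyticAt ℂ E l)
    (hκ : ∀ l, ‖(l - s₁) ^ n - s₂‖ ≤ s₃ → AnalyticAt ℂ κ l ∧ κ l ≠ 0) :
    boundaryIntegral n s₁ s₂ s₃
      (fun l => (conj l - conj s₁) ^ n * (r₁ l * E l / (2 * Real.pi * I * κ l))) =
      ∑ j, c j * E (lam j) / κ (lam j) := by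
  have hpi : (2 * Real.pi * I : ℂ) ≠ 0 := two_pi_I_ne_zero
  rw [boundaryIntegral_conj_pow_mul hn hs₃ (F := fun l => r₁ l * E l / (2 * Real.pi * I * κ l))
    (fun l hl => ((hr₁ l hl).mul (hE l hl)).div (analyticAt_const.mul (hκ l hl).1)
      (mul_ne_zero hpi (hκ l hl).2)) lam hlam hinj, Finset.mul_sum]
  refine Finset.sum_congr rfl fun j _ => ?_
  have hκj := (hκ (lam j) (by rw [hlam, sub_self, norm_zero]; exact hs₃.le)).2
  rw [hc]
  field_simp

theorem analyticAt_phase (q₀ x t : ℝ) {k : ℂ} (hk : k ≠ 0) :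
    AnalyticAt ℂ (phase q₀ x t) k := by
  unfold phase
  fun_prop (disch := assumption)

theorem conj_phase (q₀ x t : ℝ) (k : ℂ) : conj (phase q₀ x t k) = phase q₀ x t (conj k) := by
  simp [phase, map_ofNat]
end

/-- The poles `z j` and `-q₀² / conj (z j)` with lower triangular residues. -/
def lowerPoles {N : ℕ} (q₀ : ℝ) (z : Fin N → ℂ) (i : Bool × Fin N) : ℂ :=
  cond i.1 (-(q₀ : ℂ) ^ 2 / conj (z i.2)) (z i.2)

/-- The lower left entries of the residue matrices at `lowerPoles`. -/
def lowerCoeffs {N : ℕ} (q₀ : ℝ) (qm : ℂ) (z c : Fin N → ℂ) (x t : ℝ) (i : Bool × Fin N) : ℂ :=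
  cond i.1 (-((q₀ : ℂ) ^ 2 * conj qm / (conj (z i.2) ^ 2 * qm)) * conj (c i.2) *
      exp (-2 * I * phase q₀ x t (-(q₀ : ℂ) ^ 2 / conj (z i.2))))
    (c i.2 * exp (-2 * I * phase q₀ x t (z i.2)))

/-! ### The breather data as poles with lower triangular residues and their conjugates -/

section
variable {N : ℕ} (q₀ : ℝ) (qm : ℂ) (z c : Fin N → ℂ) (x t : ℝ) (j : Fin N)

theorem lowerPoles_false : lowerPoles q₀ z (false, j) = z j := rfl

theorem lowerPoles_true : lowerPoles q₀ z (true, j) = -(q₀ : ℂ) ^ 2 / conj (z j) := rfl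

theorem conj_lowerPoles_true : conj (lowerPoles q₀ z (true, j)) = -(q₀ : ℂ) ^ 2 / z j := by
  simp [lowerPoles_true]

theorem lowerCoeffs_false :
    lowerCoeffs q₀ qm z c x t (false, j) = c j * exp (-2 * I * phase q₀ x t (z j)) := rfl

theorem lowerCoeffs_true : lowerCoeffs q₀ qm z c x t (true, j) =
    -((q₀ : ℂ) ^ 2 * conj qm / (conj (z j) ^ 2 * qm)) * conj (c j) *
      exp (-2 * I * phase q₀ x t (-(q₀ : ℂ) ^ 2 / conj (z j))) := rfl

theorem conj_exp_phase (k : ℂ) :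
    conj (exp (-2 * I * phase q₀ x t k)) = exp (2 * I * phase q₀ x t (conj k)) := by
  rw [← exp_conj]
  simp [conj_phase, map_ofNat]

theorem conj_exp_phase' (k : ℂ) :
    conj (exp (2 * I * phase q₀ x t k)) = exp (-2 * I * phase q₀ x t (conj k)) := by
  rw [← exp_conj]
  simp [conj_phase, map_ofNat]

theorem neg_conj_lowerCoeffs_false : -conj (lowerCoeffs q₀ qm z c x t (false, j)) =
    -conj (c j) * exp (2 * I * phase q₀ x t (conj (z j))) := by
  rw [lowerCoeffs_false, map_mul, conj_exp_phase]
  ring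

theorem neg_conj_lowerCoeffs_true : -conj (lowerCoeffs q₀ qm z c x t (true, j)) =
    ((q₀ : ℂ) ^ 2 * qm / (z j ^ 2 * conj qm)) * c j *
      exp (2 * I * phase q₀ x t (-(q₀ : ℂ) ^ 2 / z j)) := by
  rw [lowerCoeffs_true, map_mul, conj_exp_phase]
  simp

theorem poleSet_lowerPoles : poleSet (lowerPoles q₀ z) = {0} ∪ discreteSpectrum q₀ z := by
  ext k
  simp only [poleSet, discreteSpectrum, mem_union, mem_singleton_iff, mem_range, Prod.exists,
    Bool.exists_bool, lowerPoles_false, lowerPoles_true, mem_ofPred_eq, map_div₀, map_neg, map_pow,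
    conj_ofReal, conj_conj, exists_or, eq_comm (b := k)]
  tauto

variable {q₀ qm z c x t}

/-- Uniqueness does not require genuine poles, so that clause of the residue condition is dropped.
-/
theorem IsBreatherRHP.isResidueRHP {M : ℂ → Mat} (h : IsBreatherRHP q₀ qm z c x t M) :
    IsResidueRHP qm (lowerPoles q₀ z) (lowerCoeffs q₀ qm z c x t) M := by
  refine ⟨?_, h.normalized, ?_, ?_⟩
  · rw [poleSet_lowerPoles]
    exact h.analytic
  · rintro ⟨_ | _, j⟩
    · obtain ⟨R, h1, h2, -⟩ := h.residue₁ j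
      exact ⟨R, h1, h2⟩
    · obtain ⟨R, h1, h2, -⟩ := h.residue₂ j
      exact ⟨R, h1, h2⟩
  · rintro ⟨_ | _, j⟩
    · obtain ⟨R, h1, h2, -⟩ := h.residue₃ j
      rw [neg_conj_lowerCoeffs_false]
      exact ⟨R, h1, h2⟩
    · obtain ⟨R, h1, h2, -⟩ := h.residue₄ j
      rw [neg_conj_lowerCoeffs_true, conj_lowerPoles_true]
      exact ⟨R, h1, h2⟩

theorem IsSolution.isBreatherRHP {P Q : Fin 2 → Bool × Fin N → ℂ}
    (hinj : Function.Injective (lowerPoles q₀ z))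
    (hη : ∀ i j, lowerPoles q₀ z i ≠ conj (lowerPoles q₀ z j))
    (h : IsSolution qm (lowerPoles q₀ z) (lowerCoeffs q₀ qm z c x t) P Q)
    (hl : ∀ m, ∃ i, rowMatrix qm (lowerPoles q₀ z) P Q (lowerPoles q₀ z m) i 1 ≠ 0)
    (hu : ∀ m, ∃ i, rowMatrix qm (lowerPoles q₀ z) P Q (conj (lowerPoles q₀ z m)) i 0 ≠ 0) :
    IsBreatherRHP q₀ qm z c x t (rowMatrix qm (lowerPoles q₀ z) P Q) := by
  refine ⟨fun i j k hk => ?_, isNormalized_rowMatrix hη, fun j => ?_, fun j => ?_, fun j => ?_,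
    fun j => ?_⟩
  · rw [← poleSet_lowerPoles] at hk
    exact (differentiableAt_rowMatrix hk i j).differentiableWithinAt
  · have := h.lower hinj hη (hl (false, j))
    rwa [lowerCoeffs_false, lowerPoles_false] at this
  · have := h.lower hinj hη (hl (true, j))
    rwa [lowerCoeffs_true, lowerPoles_true] at this
  · have := h.upper hinj hη (hu (false, j))
    rwa [neg_conj_lowerCoeffs_false, lowerPoles_false] at this
  · have := h.upper hinj hη (hu (true, j))
    rwa [neg_conj_lowerCoeffs_true, conj_lowerPoles_true] at this
end

/-! ### Rational form of the four jump matrices -/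

section
variable {q₀ : ℝ} {qm : ℂ} {n : ℕ} {s₁ s₂ : ℂ} {s₃ : ℝ} {r₁ : ℂ → ℂ} {lam c : Fin n → ℂ}
  {x t : ℝ} {k : ℂ}

theorem analyticAt_exp_phase (a : ℂ) {l : ℂ} (hl : l ≠ 0) :
    AnalyticAt ℂ (fun l => exp (a * phase q₀ x t l)) l :=
  (analyticAt_const.mul (analyticAt_phase q₀ x t hl)).cexp

theorem analyticAt_weight_mul_exp_phase (hq₀ : q₀ ≠ 0) (hqm : qm ≠ 0) {l : ℂ} (hl : l ≠ 0) :
    AnalyticAt ℂ (fun l => (q₀ : ℂ) ^ 2 * qm / (l ^ 2 * conj qm) *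
      exp (2 * I * phase q₀ x t (-(q₀ : ℂ) ^ 2 / l))) l := by
  have hq : conj qm ≠ 0 := (map_ne_zero _).2 hqm
  have h1 : -(q₀ : ℂ) ^ 2 / l ≠ 0 :=
    div_ne_zero (neg_ne_zero.2 (pow_ne_zero _ (by exact_mod_cast hq₀))) hl
  have h2 : AnalyticAt ℂ (fun l : ℂ => -(q₀ : ℂ) ^ 2 / l) l := by fun_prop (disch := assumption)
  have h3 : AnalyticAt ℂ (fun l => exp (2 * I * phase q₀ x t (-(q₀ : ℂ) ^ 2 / l))) l :=
    (analyticAt_const.mul ((analyticAt_phase q₀ x t h1).fun_comp h2)).cexp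
  have h4 : l ^ 2 * conj qm ≠ 0 := mul_ne_zero (pow_ne_zero _ hl) hq
  have h5 : AnalyticAt ℂ (fun l : ℂ => (q₀ : ℂ) ^ 2 * qm / (l ^ 2 * conj qm)) l := by
    fun_prop (disch := assumption)
  exact h5.mul h3

theorem lowerJump_eq (v : ℂ) : (!![1, 0; -v, 1] : Mat) = 1 - v • !![0, 0; 1, 0] := by
  ext i j
  fin_cases i <;> fin_cases j <;> simp

theorem upperJump_eq (v : ℂ) : (!![1, v; 0, 1] : Mat) = 1 + v • !![0, 1; 0, 0] := by
  ext i j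
  fin_cases i <;> fin_cases j <;> simp

theorem jump₁p_eq (hn : n ≠ 0) (hs₃ : 0 < s₃)
    (hr₁ : ∀ l, ‖(l - s₁) ^ n - s₂‖ ≤ s₃ → AnalyticAt ℂ r₁ l)
    (hlam : ∀ j, (lam j - s₁) ^ n = s₂) (hinj : Function.Injective lam)
    (hc : ∀ j, c j = (s₃ : ℂ) ^ 2 * r₁ (lam j) / ∏ l ∈ Finset.univ.erase j, (lam j - lam l))
    (h0 : ∀ l, ‖(l - s₁) ^ n - s₂‖ ≤ s₃ → l ≠ 0)
    (hk : ∀ l, ‖(l - s₁) ^ n - s₂‖ ≤ s₃ → k ≠ l) :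
    jump₁p q₀ n n s₁ s₂ s₃ r₁ x t k = 1 -
      jumpEntry (lowerPoles q₀ lam) (lowerCoeffs q₀ qm lam c x t) (Sum.inl false) k •
        nilpotentPart (Sum.inl false) := by
  rw [jump₁p, nilpotentPart, Sum.elim_inl, ← lowerJump_eq]
  have := boundaryIntegral_eq_sum hn hs₃ hr₁ hlam hinj hc
    (E := fun l => exp (-2 * I * phase q₀ x t l)) (κ := fun l => k - l)
    (fun l hl => analyticAt_exp_phase _ (h0 l hl))
    (fun l hl => ⟨analyticAt_const.sub analyticAt_id, sub_ne_zero.2 (hk l hl)⟩)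
  simp only [jumpEntry, Sum.elim_inl, partialFraction, zero_div, zero_add, lowerCoeffs_false,
    lowerPoles_false]
  rw [← this]
  simp only [mul_assoc, mul_div_assoc]

/-- Conjugation turns the `dλ*` integral into a `dλ` integral with parameter `conj k`. The sign of
the conjugate of `2πi` is absorbed into the denominator `κ`. -/
theorem jump₁m_eq (hn : n ≠ 0) (hs₃ : 0 < s₃)
    (hr₁ : ∀ l, ‖(l - s₁) ^ n - s₂‖ ≤ s₃ → AnalyticAt ℂ r₁ l)
    (hlam : ∀ j, (lam j - s₁) ^ n = s₂) (hinj : Function.Injective lam)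
    (hc : ∀ j, c j = (s₃ : ℂ) ^ 2 * r₁ (lam j) / ∏ l ∈ Finset.univ.erase j, (lam j - lam l))
    (h0 : ∀ l, ‖(l - s₁) ^ n - s₂‖ ≤ s₃ → l ≠ 0)
    (hk : ∀ l, ‖(l - s₁) ^ n - s₂‖ ≤ s₃ → k ≠ conj l) :
    jump₁m q₀ n n s₁ s₂ s₃ r₁ x t k = 1 +
      jumpEntry (lowerPoles q₀ lam) (lowerCoeffs q₀ qm lam c x t) (Sum.inr false) k •
        nilpotentPart (Sum.inr false) := by
  rw [jump₁m, nilpotentPart, Sum.elim_inr, ← upperJump_eq]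
  have := boundaryIntegral_eq_sum hn hs₃ hr₁ hlam hinj hc
    (E := fun l => exp (-2 * I * phase q₀ x t l)) (κ := fun l => -(conj k - l))
    (fun l hl => analyticAt_exp_phase _ (h0 l hl))
    (fun l hl => ⟨(analyticAt_const.sub analyticAt_id).neg, neg_ne_zero.2 (sub_ne_zero.2
      fun h => hk l hl (by rw [← h, conj_conj]))⟩)
  simp only [jumpEntry, Sum.elim_inr, partialFraction, zero_div, zero_add,
    neg_conj_lowerCoeffs_false, lowerPoles_false]
  rw [boundaryIntegralConj_eq_conj]
  have he : ∀ l, conj ((l - s₁) ^ n * conj (r₁ l) * exp (2 * I * phase q₀ x t (conj l)) /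
      (2 * Real.pi * I * (k - conj l))) = (conj l - conj s₁) ^ n *
        (r₁ l * exp (-2 * I * phase q₀ x t l) / (2 * Real.pi * I * -(conj k - l))) := by
    intro l
    rw [map_div₀, map_mul, map_mul, conj_exp_phase', conj_conj, conj_conj]
    simp only [map_mul, map_pow, map_sub, conj_conj, conj_I, conj_ofReal, map_ofNat]
    rw [mul_assoc, mul_div_assoc]
    congr 2
    ring
  simp only [he]
  rw [this, map_sum]
  suffices ∀ j, conj (c j * exp (-2 * I * phase q₀ x t (lam j)) / -(conj k - lam j)) =
      -conj (c j) * exp (2 * I * phase q₀ x t (conj (lam j))) / (k - conj (lam j)) by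
    rw [Finset.sum_congr rfl fun j _ => this j]
  intro j
  rw [map_div₀, map_mul, conj_exp_phase, map_neg, map_sub, conj_conj]
  rw [neg_mul, neg_div, div_neg]

theorem jump₂m_eq (hn : n ≠ 0) (hs₃ : 0 < s₃)
    (hr₁ : ∀ l, ‖(l - s₁) ^ n - s₂‖ ≤ s₃ → AnalyticAt ℂ r₁ l)
    (hlam : ∀ j, (lam j - s₁) ^ n = s₂) (hinj : Function.Injective lam)
    (hc : ∀ j, c j = (s₃ : ℂ) ^ 2 * r₁ (lam j) / ∏ l ∈ Finset.univ.erase j, (lam j - lam l))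
    (h0 : ∀ l, ‖(l - s₁) ^ n - s₂‖ ≤ s₃ → l ≠ 0)
    (hq₀ : q₀ ≠ 0) (hqm : qm ≠ 0)
    (hk : ∀ l, ‖(l - s₁) ^ n - s₂‖ ≤ s₃ → k ≠ -(q₀ : ℂ) ^ 2 / l) :
    jump₂m q₀ qm n n s₁ s₂ s₃ r₁ x t k = 1 +
      jumpEntry (lowerPoles q₀ lam) (lowerCoeffs q₀ qm lam c x t) (Sum.inr true) k •
        nilpotentPart (Sum.inr true) := by
  rw [jump₂m, nilpotentPart, Sum.elim_inr, ← upperJump_eq]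
  have := boundaryIntegral_eq_sum hn hs₃ hr₁ hlam hinj hc
    (E := fun l => (q₀ : ℂ) ^ 2 * qm / (l ^ 2 * conj qm) *
      exp (2 * I * phase q₀ x t (-(q₀ : ℂ) ^ 2 / l))) (κ := fun l => k + (q₀ : ℂ) ^ 2 / l)
    (fun l hl => analyticAt_weight_mul_exp_phase hq₀ hqm (h0 l hl))
    (fun l hl => ⟨analyticAt_const.add (analyticAt_const.div analyticAt_id (h0 l hl)),
      fun h => hk l hl (by rw [neg_div]; exact eq_neg_of_add_eq_zero_left h)⟩)
  simp only [jumpEntry, Sum.elim_inr, partialFraction, zero_div, zero_add,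
    neg_conj_lowerCoeffs_true, conj_lowerPoles_true]
  have he : ∀ l, (q₀ : ℂ) ^ 2 * qm / (l ^ 2 * conj qm) * (conj l - conj s₁) ^ n * r₁ l *
      exp (2 * I * phase q₀ x t (-(q₀ : ℂ) ^ 2 / l)) / (2 * Real.pi * I * (k + (q₀ : ℂ) ^ 2 / l)) =
      (conj l - conj s₁) ^ n * (r₁ l * ((q₀ : ℂ) ^ 2 * qm / (l ^ 2 * conj qm) *
        exp (2 * I * phase q₀ x t (-(q₀ : ℂ) ^ 2 / l))) /
          (2 * Real.pi * I * (k + (q₀ : ℂ) ^ 2 / l))) := by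
    intro l
    rw [← mul_div_assoc]
    congr 1
    ring
  simp only [he]
  rw [this]
  suffices ∀ j, c j * ((q₀ : ℂ) ^ 2 * qm / (lam j ^ 2 * conj qm) *
      exp (2 * I * phase q₀ x t (-(q₀ : ℂ) ^ 2 / lam j))) / (k + (q₀ : ℂ) ^ 2 / lam j) =
      (q₀ : ℂ) ^ 2 * qm / (lam j ^ 2 * conj qm) * c j *
        exp (2 * I * phase q₀ x t (-(q₀ : ℂ) ^ 2 / lam j)) / (k - -(q₀ : ℂ) ^ 2 / lam j) by
    rw [Finset.sum_congr rfl fun j _ => this j]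
  intro j
  rw [neg_div, sub_neg_eq_add]
  congr 1
  ring

/-- The conjugate of this integral has the weight and exponential of `jump₂m` at `conj k`; again the
sign of the conjugate of `2πi` goes into `κ`. -/
theorem jump₂p_eq (hn : n ≠ 0) (hs₃ : 0 < s₃)
    (hr₁ : ∀ l, ‖(l - s₁) ^ n - s₂‖ ≤ s₃ → AnalyticAt ℂ r₁ l)
    (hlam : ∀ j, (lam j - s₁) ^ n = s₂) (hinj : Function.Injective lam)
    (hc : ∀ j, c j = (s₃ : ℂ) ^ 2 * r₁ (lam j) / ∏ l ∈ Finset.univ.erase j, (lam j - lam l))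
    (h0 : ∀ l, ‖(l - s₁) ^ n - s₂‖ ≤ s₃ → l ≠ 0)
    (hq₀ : q₀ ≠ 0) (hqm : qm ≠ 0)
    (hk : ∀ l, ‖(l - s₁) ^ n - s₂‖ ≤ s₃ → k ≠ -(q₀ : ℂ) ^ 2 / conj l) :
    jump₂p q₀ qm n n s₁ s₂ s₃ r₁ x t k = 1 -
      jumpEntry (lowerPoles q₀ lam) (lowerCoeffs q₀ qm lam c x t) (Sum.inl true) k •
        nilpotentPart (Sum.inl true) := by
  rw [jump₂p, nilpotentPart, Sum.elim_inl, ← lowerJump_eq]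
  have := boundaryIntegral_eq_sum hn hs₃ hr₁ hlam hinj hc
    (E := fun l => (q₀ : ℂ) ^ 2 * qm / (l ^ 2 * conj qm) *
      exp (2 * I * phase q₀ x t (-(q₀ : ℂ) ^ 2 / l)))
    (κ := fun l => -(conj k + (q₀ : ℂ) ^ 2 / l))
    (fun l hl => analyticAt_weight_mul_exp_phase hq₀ hqm (h0 l hl))
    (fun l hl => ⟨(analyticAt_const.add (analyticAt_const.div analyticAt_id (h0 l hl))).neg,
      neg_ne_zero.2 fun h => hk l hl (by
        have := congrArg conj (eq_neg_of_add_eq_zero_left h)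
        simpa [neg_div] using this)⟩)
  simp only [jumpEntry, Sum.elim_inl, partialFraction, zero_div, zero_add,
    lowerCoeffs_true, lowerPoles_true]
  rw [boundaryIntegralConj_eq_conj]
  have he : ∀ l, conj ((q₀ : ℂ) ^ 2 * conj qm / (conj l ^ 2 * qm) * (l - s₁) ^ n * conj (r₁ l) *
      exp (-2 * I * phase q₀ x t (-(q₀ : ℂ) ^ 2 / conj l)) /
        (2 * Real.pi * I * (k + (q₀ : ℂ) ^ 2 / conj l))) =
      (conj l - conj s₁) ^ n * (r₁ l * ((q₀ : ℂ) ^ 2 * qm / (l ^ 2 * conj qm) *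
        exp (2 * I * phase q₀ x t (-(q₀ : ℂ) ^ 2 / l))) /
          (2 * Real.pi * I * -(conj k + (q₀ : ℂ) ^ 2 / l))) := by
    intro l
    rw [map_div₀, map_mul, map_mul, map_mul, conj_exp_phase, ← mul_div_assoc]
    simp only [map_mul, map_pow, map_sub, map_add, map_div₀, map_neg, conj_conj, conj_I,
      conj_ofReal, map_ofNat]
    congr 1 <;> ring
  simp only [he]
  rw [this, map_sum]
  suffices ∀ j, conj (c j * ((q₀ : ℂ) ^ 2 * qm / (lam j ^ 2 * conj qm) *
      exp (2 * I * phase q₀ x t (-(q₀ : ℂ) ^ 2 / lam j))) / -(conj k + (q₀ : ℂ) ^ 2 / lam j)) =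
      -((q₀ : ℂ) ^ 2 * conj qm / (conj (lam j) ^ 2 * qm)) * conj (c j) *
        exp (-2 * I * phase q₀ x t (-(q₀ : ℂ) ^ 2 / conj (lam j))) /
          (k - -(q₀ : ℂ) ^ 2 / conj (lam j)) by
    rw [Finset.sum_congr rfl fun j _ => this j]
  intro j
  rw [map_div₀, map_mul, map_mul, conj_exp_phase']
  simp only [map_mul, map_pow, map_add, map_div₀, map_neg, conj_conj, conj_ofReal]
  rw [neg_div ((conj (lam j))), sub_neg_eq_add, div_neg, ← neg_div]
  congr 1
  ring
end

/-! ### The contours of the breather gas -/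

/-- The interiors of the four contours as one family. -/
def interiors (D₁p D₂p D₁m D₂m : Set ℂ) : Bool ⊕ Bool → Set ℂ :=
  Sum.elim (fun b => cond b D₂p D₁p) fun b => cond b D₂m D₁m

/-- The contours lie in the regions `𝔻⁺` and `𝔻⁻` and encircle the four images of the closed
quadrature domain. -/
structure IsGasContours (q₀ : ℝ) (n : ℕ) (s₁ s₂ : ℂ) (s₃ : ℝ) (D₁p D₂p D₁m D₂m : Set ℂ) :
    Prop where
  contour : ∀ r, IsContourInterior (interiors D₁p D₂p D₁m D₂m r)
  one_plus_subset : closure D₁p ⊆ regionPlus q₀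
  two_plus_subset : closure D₂p ⊆ regionPlus q₀
  one_minus_subset : closure D₁m ⊆ regionMinus q₀
  two_minus_subset : closure D₂m ⊆ regionMinus q₀
  one_plus : ∀ l, ‖(l - s₁) ^ n - s₂‖ ≤ s₃ → l ∈ D₁p
  two_plus : ∀ l, ‖(l - s₁) ^ n - s₂‖ ≤ s₃ → -(q₀ : ℂ) ^ 2 / conj l ∈ D₂p
  one_minus : ∀ l, ‖(l - s₁) ^ n - s₂‖ ≤ s₃ → conj l ∈ D₁m
  two_minus : ∀ l, ‖(l - s₁) ^ n - s₂‖ ≤ s₃ → -(q₀ : ℂ) ^ 2 / l ∈ D₂m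

section
variable {q₀ : ℝ} {qm : ℂ} {n : ℕ} {s₁ s₂ : ℂ} {s₃ : ℝ} {r₁ : ℂ → ℂ} {lam c : Fin n → ℂ}
  {x t : ℝ} {D₁p D₂p D₁m D₂m : Set ℂ}

theorem IsGasContours.im_ne_zero (hG : IsGasContours q₀ n s₁ s₂ s₃ D₁p D₂p D₁m D₂m)
    (r : Bool ⊕ Bool) {k : ℂ} (hk : k ∈ closure (interiors D₁p D₂p D₁m D₂m r)) : k.im ≠ 0 := by
  rcases r with (_ | _) | (_ | _)
  · exact im_ne_zero_of_mem_regionPlus (hG.one_plus_subset hk)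
  · exact im_ne_zero_of_mem_regionPlus (hG.two_plus_subset hk)
  · exact im_ne_zero_of_mem_regionMinus (hG.one_minus_subset hk)
  · exact im_ne_zero_of_mem_regionMinus (hG.two_minus_subset hk)

theorem IsGasContours.ne_zero (hG : IsGasContours q₀ n s₁ s₂ s₃ D₁p D₂p D₁m D₂m) {l : ℂ}
    (hl : ‖(l - s₁) ^ n - s₂‖ ≤ s₃) : l ≠ 0 := by
  rintro rfl
  exact hG.im_ne_zero (Sum.inl false) (subset_closure (hG.one_plus 0 hl)) zero_im

theorem im_mul_im_neg_div_conj (hq₀ : 0 < q₀) {l : ℂ} (hl : l.im ≠ 0) :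
    l.im * (-(q₀ : ℂ) ^ 2 / conj l).im < 0 := by
  have h0 : l ≠ 0 := by
    rintro rfl
    exact hl zero_im
  have h1 : 0 < q₀ ^ 2 / normSq l * (l.im * l.im) :=
    mul_pos (div_pos (pow_pos hq₀ 2) (normSq_pos.2 h0)) (mul_self_pos.2 hl)
  rw [im_neg_div_conj]
  nlinarith

/-- Contours in `𝔻⁺` and `𝔻⁻` are disjoint because the regions are. Two contours in the same region
lie in opposite half planes; the point `l` and its images decide which. -/
theorem IsGasContours.disjoint (hq₀ : 0 < q₀)
    (hG : IsGasContours q₀ n s₁ s₂ s₃ D₁p D₂p D₁m D₂m) {l : ℂ}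
    (hl : ‖(l - s₁) ^ n - s₂‖ ≤ s₃) {r r' : Bool ⊕ Bool} (hr : r ≠ r') :
    Disjoint (closure (interiors D₁p D₂p D₁m D₂m r))
      (closure (interiors D₁p D₂p D₁m D₂m r')) := by
  have him := hG.im_ne_zero (Sum.inl false) (subset_closure (hG.one_plus l hl))
  have hneg := im_mul_im_neg_div_conj hq₀ him
  have hpp : Disjoint (closure D₁p) (closure D₂p) :=
    disjoint_closure_of_im_mul_im_neg (hG.contour (Sum.inl false)).isConnected
      (hG.contour (Sum.inl true)).isConnected (fun _ => hG.im_ne_zero (Sum.inl false))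
      (fun _ => hG.im_ne_zero (Sum.inl true)) (hG.one_plus l hl) (hG.two_plus l hl) hneg
  have hmm : Disjoint (closure D₁m) (closure D₂m) :=
    disjoint_closure_of_im_mul_im_neg (hG.contour (Sum.inr false)).isConnected
      (hG.contour (Sum.inr true)).isConnected (fun _ => hG.im_ne_zero (Sum.inr false))
      (fun _ => hG.im_ne_zero (Sum.inr true)) (hG.one_minus l hl) (hG.two_minus l hl) (by
        have : -(q₀ : ℂ) ^ 2 / l = conj (-(q₀ : ℂ) ^ 2 / conj l) := by simp
        rw [this, conj_im, conj_im, neg_mul_neg]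
        exact hneg)
  have hpm : ∀ {A B : Set ℂ}, A ⊆ regionPlus q₀ → B ⊆ regionMinus q₀ → Disjoint A B :=
    fun hA hB => (disjoint_regionPlus_regionMinus q₀).mono hA hB
  have h1 := hG.one_plus_subset
  have h2 := hG.two_plus_subset
  have h3 := hG.one_minus_subset
  have h4 := hG.two_minus_subset
  rcases r with (_ | _) | (_ | _) <;> rcases r' with (_ | _) | (_ | _)
  · exact absurd rfl hr
  · exact hpp
  · exact hpm h1 h3
  · exact hpm h1 h4
  · exact hpp.symm
  · exact absurd rfl hr
  · exact hpm h2 h3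
  · exact hpm h2 h4
  · exact (hpm h1 h3).symm
  · exact (hpm h2 h3).symm
  · exact absurd rfl hr
  · exact hmm
  · exact (hpm h1 h4).symm
  · exact (hpm h2 h4).symm
  · exact hmm.symm
  · exact absurd rfl hr

theorem norm_root_le (hs₃ : 0 < s₃) (hlam : ∀ j, (lam j - s₁) ^ n = s₂) (j : Fin n) :
    ‖(lam j - s₁) ^ n - s₂‖ ≤ s₃ := by
  rw [hlam, sub_self, norm_zero]
  exact hs₃.le

theorem IsGasContours.lowerPoles_mem (hs₃ : 0 < s₃) (hlam : ∀ j, (lam j - s₁) ^ n = s₂)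
    (hG : IsGasContours q₀ n s₁ s₂ s₃ D₁p D₂p D₁m D₂m) (i : Bool × Fin n) :
    lowerPoles q₀ lam i ∈ interiors D₁p D₂p D₁m D₂m (Sum.inl i.1) ∧
      conj (lowerPoles q₀ lam i) ∈ interiors D₁p D₂p D₁m D₂m (Sum.inr i.1) := by
  obtain ⟨_ | _, j⟩ := i
  · exact ⟨hG.one_plus _ (norm_root_le hs₃ hlam j), hG.one_minus _ (norm_root_le hs₃ hlam j)⟩
  · rw [conj_lowerPoles_true]
    exact ⟨hG.two_plus _ (norm_root_le hs₃ hlam j), hG.two_minus _ (norm_root_le hs₃ hlam j)⟩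

theorem IsGasContours.lowerPoles_mem_regionPlus (hs₃ : 0 < s₃)
    (hlam : ∀ j, (lam j - s₁) ^ n = s₂)
    (hG : IsGasContours q₀ n s₁ s₂ s₃ D₁p D₂p D₁m D₂m) (i : Bool × Fin n) :
    lowerPoles q₀ lam i ∈ regionPlus q₀ := by
  have h := subset_closure (hG.lowerPoles_mem hs₃ hlam i).1
  obtain ⟨_ | _, j⟩ := i
  · exact hG.one_plus_subset h
  · exact hG.two_plus_subset h

theorem IsGasContours.lowerPoles_ne_conj (hs₃ : 0 < s₃) (hlam : ∀ j, (lam j - s₁) ^ n = s₂)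
    (hG : IsGasContours q₀ n s₁ s₂ s₃ D₁p D₂p D₁m D₂m) (i j : Bool × Fin n) :
    lowerPoles q₀ lam i ≠ conj (lowerPoles q₀ lam j) := by
  intro h
  have hi := hG.lowerPoles_mem_regionPlus hs₃ hlam i
  rw [h] at hi
  exact disjoint_left.1 (disjoint_regionPlus_regionMinus q₀) hi
    (conj_mem_regionMinus (hG.lowerPoles_mem_regionPlus hs₃ hlam j))

/-- The poles `z j` and `-q₀² / conj (z j)` lie inside different contours, and within each family
the map from the roots is injective. -/
theorem IsGasContours.lowerPoles_injective (hq₀ : 0 < q₀) (hs₃ : 0 < s₃)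
    (hlam : ∀ j, (lam j - s₁) ^ n = s₂) (hinj : Function.Injective lam)
    (hG : IsGasContours q₀ n s₁ s₂ s₃ D₁p D₂p D₁m D₂m) :
    Function.Injective (lowerPoles q₀ lam) := by
  rintro ⟨b, j⟩ ⟨b', j'⟩ h
  have h1 := subset_closure (hG.lowerPoles_mem hs₃ hlam (b, j)).1
  have h2 := subset_closure (hG.lowerPoles_mem hs₃ hlam (b', j')).1
  rw [h] at h1
  have hb : b = b' := by
    by_contra hne
    exact disjoint_left.1 (hG.disjoint hq₀ (norm_root_le hs₃ hlam j)
      (fun h => hne (Sum.inl.inj h))) h1 h2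
  subst hb
  cases b
  · exact Prod.ext rfl (hinj h)
  · have hq : -(q₀ : ℂ) ^ 2 ≠ 0 :=
      neg_ne_zero.2 (pow_ne_zero _ (by exact_mod_cast hq₀.ne'))
    rw [lowerPoles_true, lowerPoles_true, div_eq_mul_inv, div_eq_mul_inv] at h
    rw [hinj ((starRingEnd ℂ).injective (inv_injective (mul_left_cancel₀ hq h)))]

theorem IsGasContours.isContourSystem (hq₀ : 0 < q₀) (hn : n ≠ 0) (hs₃ : 0 < s₃)
    (hlam : ∀ j, (lam j - s₁) ^ n = s₂)
    (hG : IsGasContours q₀ n s₁ s₂ s₃ D₁p D₂p D₁m D₂m) (A : Bool × Fin n → ℂ) :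
    IsContourSystem (interiors D₁p D₂p D₁m D₂m) nilpotentPart
      (jumpEntry (lowerPoles q₀ lam) A) (jumpPoles (lowerPoles q₀ lam)) where
  contour := hG.contour
  disjoint _ _ hr := hG.disjoint hq₀ (norm_root_le hs₃ hlam ⟨0, Nat.pos_of_ne_zero hn⟩) hr
  zero_notMem r h := hG.im_ne_zero r h zero_im
  sq := nilpotentPart_mul_self
  subset r k hk := by
    rcases r with b | b <;>
    · simp only [jumpPoles, Sum.elim_inl, Sum.elim_inr, Finset.coe_image, Finset.coe_univ,
        image_univ, mem_range] at hk
      obtain ⟨j, rfl⟩ := hk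
      first
      | exact (hG.lowerPoles_mem hs₃ hlam (b, j)).1
      | exact (hG.lowerPoles_mem hs₃ hlam (b, j)).2
  diff r _ h0 hk := differentiableAt_jumpEntry _ A r h0 hk

theorem mem_contours_iff {k : ℂ} : k ∈ contours D₁p D₂p D₁m D₂m ↔
    ∃ r, k ∈ frontier (interiors D₁p D₂p D₁m D₂m r) := by
  simp [contours, interiors, or_assoc]

theorem mem_closures_iff {k : ℂ} :
    k ∈ {0} ∪ closure D₁p ∪ closure D₂p ∪ closure D₁m ∪ closure D₂m ↔
      k = 0 ∨ ∃ r, k ∈ closure (interiors D₁p D₂p D₁m D₂m r) := by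
  simp [interiors, or_assoc]

theorem isOpen_compl_zero_union_contours : IsOpen ({0} ∪ contours D₁p D₂p D₁m D₂m)ᶜ :=
  (isClosed_singleton.union (((isClosed_frontier.union isClosed_frontier).union
    isClosed_frontier).union isClosed_frontier)).isOpen_compl

/-- The gas problem has rational jumps. -/
theorem isGasRHP_iff (hq₀ : 0 < q₀) (hqm : qm ≠ 0) (hn : n ≠ 0) (hs₃ : 0 < s₃)
    (hr₁ : ∀ l, ‖(l - s₁) ^ n - s₂‖ ≤ s₃ → AnalyticAt ℂ r₁ l)
    (hlam : ∀ j, (lam j - s₁) ^ n = s₂) (hinj : Function.Injective lam)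
    (hc : ∀ j, c j = (s₃ : ℂ) ^ 2 * r₁ (lam j) / ∏ l ∈ Finset.univ.erase j, (lam j - lam l))
    (hG : IsGasContours q₀ n s₁ s₂ s₃ D₁p D₂p D₁m D₂m) {M : ℂ → Mat} :
    IsGasRHP q₀ qm n n s₁ s₂ s₃ r₁ D₁p D₂p D₁m D₂m x t M ↔
      IsContourRHP qm (interiors D₁p D₂p D₁m D₂m) nilpotentPart
        (jumpEntry (lowerPoles q₀ lam) (lowerCoeffs q₀ qm lam c x t)) M := by
  have h0 : ∀ l, ‖(l - s₁) ^ n - s₂‖ ≤ s₃ → l ≠ 0 := fun l hl => hG.ne_zero hl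
  have hne : ∀ {r : Bool ⊕ Bool} {k l : ℂ}, k ∈ frontier (interiors D₁p D₂p D₁m D₂m r) →
      l ∈ interiors D₁p D₂p D₁m D₂m r → k ≠ l := by
    rintro r k l hk hl rfl
    rw [(hG.contour r).isOpen.frontier_eq] at hk
    exact hk.2 hl
  have e1 : HasJumpCCW M D₁p (jump₁p q₀ n n s₁ s₂ s₃ r₁ x t) ↔ HasNilpotentJump M D₁p
      (jumpEntry (lowerPoles q₀ lam) (lowerCoeffs q₀ qm lam c x t) (Sum.inl false))
        (nilpotentPart (Sum.inl false)) :=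
    hasJumpCCW_iff (nilpotentPart_mul_self _) fun k hk => jump₁p_eq hn hs₃ hr₁ hlam hinj hc h0
      fun l hl => hne (r := Sum.inl false) hk (hG.one_plus l hl)
  have e2 : HasJumpCCW M D₂p (jump₂p q₀ qm n n s₁ s₂ s₃ r₁ x t) ↔ HasNilpotentJump M D₂p
      (jumpEntry (lowerPoles q₀ lam) (lowerCoeffs q₀ qm lam c x t) (Sum.inl true))
        (nilpotentPart (Sum.inl true)) :=
    hasJumpCCW_iff (nilpotentPart_mul_self _) fun k hk => jump₂p_eq hn hs₃ hr₁ hlam hinj hc h0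
      hq₀.ne' hqm fun l hl => hne (r := Sum.inl true) hk (hG.two_plus l hl)
  have e3 : HasJumpCW M D₁m (jump₁m q₀ n n s₁ s₂ s₃ r₁ x t) ↔ HasNilpotentJump M D₁m
      (jumpEntry (lowerPoles q₀ lam) (lowerCoeffs q₀ qm lam c x t) (Sum.inr false))
        (nilpotentPart (Sum.inr false)) :=
    hasJumpCW_iff fun k hk => jump₁m_eq hn hs₃ hr₁ hlam hinj hc h0
      fun l hl => hne (r := Sum.inr false) hk (hG.one_minus l hl)
  have e4 : HasJumpCW M D₂m (jump₂m q₀ qm n n s₁ s₂ s₃ r₁ x t) ↔ HasNilpotentJump M D₂m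
      (jumpEntry (lowerPoles q₀ lam) (lowerCoeffs q₀ qm lam c x t) (Sum.inr true))
        (nilpotentPart (Sum.inr true)) :=
    hasJumpCW_iff fun k hk => jump₂m_eq hn hs₃ hr₁ hlam hinj hc h0
      hq₀.ne' hqm fun l hl => hne (r := Sum.inr true) hk (hG.two_minus l hl)
  have hmem : ∀ k, k ∈ ({0} ∪ contours D₁p D₂p D₁m D₂m)ᶜ ↔
      k ≠ 0 ∧ ∀ r, k ∉ frontier (interiors D₁p D₂p D₁m D₂m r) := by
    intro k
    rw [mem_compl_iff, mem_union, mem_contours_iff, mem_singleton_iff, not_or, not_exists]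
  constructor
  · intro h
    refine ⟨fun k hk0 hk i j => ?_, h.normalized, ?_⟩
    · exact (h.analytic i j).differentiableAt
        (isOpen_compl_zero_union_contours.mem_nhds ((hmem k).2 ⟨hk0, hk⟩))
    · rintro ((_ | _) | (_ | _))
      · exact e1.1 h.jump_one_plus
      · exact e2.1 h.jump_two_plus
      · exact e3.1 h.jump_one_minus
      · exact e4.1 h.jump_two_minus
  · intro h
    refine ⟨fun i j k hk => ?_, h.normalized, e1.2 (h.jump (Sum.inl false)),
      e2.2 (h.jump (Sum.inl true)), e3.2 (h.jump (Sum.inr false)), e4.2 (h.jump (Sum.inr true))⟩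
    exact (h.analytic k ((hmem k).1 hk).1 ((hmem k).1 hk).2 i j).differentiableWithinAt

/-- The breather problem and the gas problem have unique solutions, which agree near infinity. -/
theorem IsGasContours.exists_solutions (hq₀ : 0 < q₀) (hqm : ‖qm‖ = q₀) (hn : n ≠ 0)
    (hs₃ : 0 < s₃) (hr₁ : ∀ l, ‖(l - s₁) ^ n - s₂‖ ≤ s₃ → AnalyticAt ℂ r₁ l)
    (hlam : ∀ j, (lam j - s₁) ^ n = s₂) (hinj : Function.Injective lam)
    (hc : ∀ j, c j = (s₃ : ℂ) ^ 2 * r₁ (lam j) / ∏ l ∈ Finset.univ.erase j, (lam j - lam l))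
    (hG : IsGasContours q₀ n s₁ s₂ s₃ D₁p D₂p D₁m D₂m) (x t : ℝ) :
    ∃ q : ℂ, (∃ M, IsBreatherRHP q₀ qm lam c x t M ∧
        (∀ M', IsBreatherRHP q₀ qm lam c x t M' →
          EqOn M' M ({0} ∪ discreteSpectrum q₀ lam)ᶜ) ∧ Recovers M q) ∧
      ∃ M₂, IsGasRHP q₀ qm n n s₁ s₂ s₃ r₁ D₁p D₂p D₁m D₂m x t M₂ ∧
        (∀ M', IsGasRHP q₀ qm n n s₁ s₂ s₃ r₁ D₁p D₂p D₁m D₂m x t M' →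
          EqOn M' M₂ ({0} ∪ contours D₁p D₂p D₁m D₂m)ᶜ) ∧ Recovers M₂ q := by
  have hqm0 : qm ≠ 0 := norm_ne_zero_iff.1 (hqm.trans_ne hq₀.ne')
  have hi := hG.lowerPoles_injective hq₀ hs₃ hlam hinj
  have hη := hG.lowerPoles_ne_conj hs₃ hlam
  have hS := hG.isContourSystem hq₀ hn hs₃ hlam (lowerCoeffs q₀ qm lam c x t)
  -- The region `𝔻⁺` omits the circle `|k| = q₀`, the only place where a pole could degenerate.
  obtain ⟨P, Q, hPQ, hl, hu⟩ := exists_isSolution (qm := qm)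
    (A := lowerCoeffs q₀ qm lam c x t) hi hη fun m => by
      rw [hqm]
      exact norm_ne_of_mem_regionPlus hq₀ (hG.lowerPoles_mem_regionPlus hs₃ hlam m)
  have hB := hPQ.isBreatherRHP hi hη hl hu
  have hrec := recovers_rowMatrix (qm := qm) (η := lowerPoles q₀ lam) (P := P) (Q := Q)
  obtain ⟨M₂, hM₂, hMe⟩ := hPQ.exists_isContourRHP hi hη hS
  have hiff := fun M => isGasRHP_iff (x := x) (t := t) (M := M) hq₀ hqm0 hn hs₃ hr₁ hlam hinj hc hG
  refine ⟨_, ⟨_, hB, fun M' hM' => ?_, hrec⟩, M₂, (hiff M₂).2 hM₂, fun M' hM' k hk => ?_, ?_⟩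
  · rw [← poleSet_lowerPoles]
    exact hM'.isResidueRHP.eqOn hi hη hB.isResidueRHP
  · rw [mem_compl_iff, mem_union, mem_contours_iff, mem_singleton_iff, not_or, not_exists] at hk
    exact ((hiff M').1 hM').eqOn hi hη hS hM₂ hk.1 hk.2
  · refine hrec.congr' ?_
    filter_upwards [hS.eventually_cobounded] with k hk
    rw [hMe k hk]

/-- Outside the contours and their interiors, the solutions of the two problems are the same. -/
theorem IsGasContours.eqOn (hq₀ : 0 < q₀) (hqm : qm ≠ 0) (hn : n ≠ 0)
    (hs₃ : 0 < s₃) (hr₁ : ∀ l, ‖(l - s₁) ^ n - s₂‖ ≤ s₃ → AnalyticAt ℂ r₁ l)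
    (hlam : ∀ j, (lam j - s₁) ^ n = s₂) (hinj : Function.Injective lam)
    (hc : ∀ j, c j = (s₃ : ℂ) ^ 2 * r₁ (lam j) / ∏ l ∈ Finset.univ.erase j, (lam j - lam l))
    (hG : IsGasContours q₀ n s₁ s₂ s₃ D₁p D₂p D₁m D₂m) {M M₂ : ℂ → Mat}
    (hM : IsBreatherRHP q₀ qm lam c x t M)
    (hM₂ : IsGasRHP q₀ qm n n s₁ s₂ s₃ r₁ D₁p D₂p D₁m D₂m x t M₂) :
    EqOn M₂ M ({0} ∪ closure D₁p ∪ closure D₂p ∪ closure D₁m ∪ closure D₂m)ᶜ := by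
  have hi := hG.lowerPoles_injective hq₀ hs₃ hlam hinj
  have hη := hG.lowerPoles_ne_conj hs₃ hlam
  have hS := hG.isContourSystem hq₀ hn hs₃ hlam (lowerCoeffs q₀ qm lam c x t)
  obtain ⟨M', hM', he⟩ :=
    ((isGasRHP_iff hq₀ hqm hn hs₃ hr₁ hlam hinj hc hG).1 hM₂).exists_isResidueRHP hi hη hS
  intro k hk
  rw [mem_compl_iff, mem_closures_iff, not_or, not_exists] at hk
  have h1 := he k fun r h => hk.2 r (frontier_subset_closure h)
  -- The dressing factor is `1` outside the contours, so there the gas solution is itself the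
  -- solution of the pole problem.
  rw [jumpFactor_of_notMem fun r h => hk.2 r (subset_closure h), mul_one] at h1
  rw [← h1]
  refine hM'.eqOn hi hη hM.isResidueRHP ?_
  rw [mem_compl_iff, mem_poleSet_iff, not_or, not_exists]
  exact ⟨hk.1, fun r h => hk.2 r (subset_closure (hS.subset r h))⟩
end

end BreatherGas

end

/-! ### The main theorem -/

theorem proposition4
    (q₀ : ℝ) (hq₀ : 0 < q₀) (qm : ℂ) (hqm : ‖qm‖ = q₀)
    (n : ℕ) (hn : 1 ≤ n) (s₁ s₂ : ℂ) (s₃ : ℝ) (hs₃ : 0 < s₃)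
    -- the holomorphic density
    (r₁ : ℂ → ℂ) (hr₁ : AnalyticOnNhd ℂ r₁ (closure (BreatherGas.quadratureDomain n s₁ s₂ s₃)))
    -- the contours, given by their interiors
    (D₁p D₂p D₁m D₂m : Set ℂ)
    (hD₁p : BreatherGas.IsContourInterior D₁p) (hD₂p : BreatherGas.IsContourInterior D₂p)
    (hD₁m : BreatherGas.IsContourInterior D₁m) (hD₂m : BreatherGas.IsContourInterior D₂m)
    (h₁p : closure D₁p ⊆ BreatherGas.regionPlus q₀)
    (h₂p : closure D₂p ⊆ BreatherGas.regionPlus q₀)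
    (h₁m : closure D₁m ⊆ BreatherGas.regionMinus q₀)
    (h₂m : closure D₂m ⊆ BreatherGas.regionMinus q₀)
    (hΩ₁p : ∀ k ∈ closure (BreatherGas.quadratureDomain n s₁ s₂ s₃), k ∈ D₁p)
    (hΩ₂p : ∀ k ∈ closure (BreatherGas.quadratureDomain n s₁ s₂ s₃),
      -(q₀ : ℂ) ^ 2 / (starRingEnd ℂ) k ∈ D₂p)
    (hΩ₁m : ∀ k ∈ closure (BreatherGas.quadratureDomain n s₁ s₂ s₃), (starRingEnd ℂ) k ∈ D₁m)
    (hΩ₂m : ∀ k ∈ closure (BreatherGas.quadratureDomain n s₁ s₂ s₃), -(q₀ : ℂ) ^ 2 / k ∈ D₂m)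
    -- the `n` distinct roots of `(k - s₁)^n = s₂`, and the norming constants
    (lam : Fin n → ℂ) (hlam : ∀ j, (lam j - s₁) ^ n = s₂) (hinj : Function.Injective lam)
    (c : Fin n → ℂ)
    (hc : ∀ j, c j = (s₃ : ℂ) ^ 2 * r₁ (lam j) / ∏ l ∈ Finset.univ.erase j, (lam j - lam l)) :
    -- the `n`-breather solution exists and is the one recovered from the gas problem
    (∃ q : ℝ → ℝ → ℂ, BreatherGas.IsBreatherSolution q₀ qm lam c q ∧
      ∀ x t : ℝ, ∃ M₂ : ℂ → BreatherGas.Mat,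
        BreatherGas.IsGasRHP q₀ qm n n s₁ s₂ s₃ r₁ D₁p D₂p D₁m D₂m x t M₂ ∧
        (∀ M' : ℂ → BreatherGas.Mat,
          BreatherGas.IsGasRHP q₀ qm n n s₁ s₂ s₃ r₁ D₁p D₂p D₁m D₂m x t M' →
          Set.EqOn M' M₂ ({0} ∪ BreatherGas.contours D₁p D₂p D₁m D₂m)ᶜ) ∧
        BreatherGas.Recovers M₂ (q x t)) ∧
    -- outside the contours the matrix solutions of the two problems are the same
    (∀ (x t : ℝ) (M M₂ : ℂ → BreatherGas.Mat),
      BreatherGas.IsBreatherRHP q₀ qm lam c x t M →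
      BreatherGas.IsGasRHP q₀ qm n n s₁ s₂ s₃ r₁ D₁p D₂p D₁m D₂m x t M₂ →
      Set.EqOn M₂ M ({0} ∪ closure D₁p ∪ closure D₂p ∪ closure D₁m ∪ closure D₂m)ᶜ) := by
  have hn0 : n ≠ 0 := Nat.one_le_iff_ne_zero.1 hn
  have hqm0 : qm ≠ 0 := norm_ne_zero_iff.1 (hqm.trans_ne hq₀.ne')
  have hΩ : ∀ l, ‖(l - s₁) ^ n - s₂‖ ≤ s₃ →
      l ∈ closure (BreatherGas.quadratureDomain n s₁ s₂ s₃) :=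
    fun l hl => BreatherGas.subset_closure_quadratureDomain hn0 hs₃ hl
  have hr : ∀ l, ‖(l - s₁) ^ n - s₂‖ ≤ s₃ → AnalyticAt ℂ r₁ l := fun l hl => hr₁ l (hΩ l hl)
  have hG : BreatherGas.IsGasContours q₀ n s₁ s₂ s₃ D₁p D₂p D₁m D₂m :=
    { contour := by
        rintro ((_ | _) | (_ | _))
        exacts [hD₁p, hD₂p, hD₁m, hD₂m]
      one_plus_subset := h₁p
      two_plus_subset := h₂p
      one_minus_subset := h₁m
      two_minus_subset := h₂m
      one_plus := fun l hl => hΩ₁p l (hΩ l hl)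
      two_plus := fun l hl => hΩ₂p l (hΩ l hl)
      one_minus := fun l hl => hΩ₁m l (hΩ l hl)
      two_minus := fun l hl => hΩ₂m l (hΩ l hl) }
  refine ⟨?_, fun x t M M₂ hM hM₂ => hG.eqOn hq₀ hqm0 hn0 hs₃ hr hlam hinj hc hM hM₂⟩
  choose q hq using hG.exists_solutions hq₀ hqm hn0 hs₃ hr hlam hinj hc
  refine ⟨q, ⟨hinj, fun j => ?_, fun x t => (hq x t).1⟩, fun x t => (hq x t).2⟩
  exact hG.lowerPoles_mem_regionPlus hs₃ hlam (false, j)
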